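/- Let $\omega=e^{2\pi i/3}$ and let $M=\mathrm U\oplus\mathrm U(2)\oplus\mathrm A_2(2)$, i.e. $M=\mathbb Z^6$ with the bilinear form $$Q=\begin{bmatrix}0&1\\1&0\end{bmatrix}\oplus\begin{bmatrix}0&2\\2&0\end{bmatrix}\oplus\begin{bmatrix}-4&2\\2&-4\end{bmatrix}.$$ Let $\mathbb D_M=\{[z]\in\mathbb P(M\otimes\mathbb C)\mid {}^tzQz=0,\ {}^tzQ\bar z>0\}$ and let $\mathbb D_M^+$ be its component consisting of the points $[1:z_2:\cdots:z_6]\in\mathbb D_M$ with $\mathrm{Im}\,z_3>0$. Put $\mathrm O(M)=\{g\in\mathrm{GL}_6(\mathbb Z)\mid{}^tgQg=Q\}$, $\mathrm O^+(M)=\{g\in\mathrm O(M)\mid g(\mathbb D_M^+)=\mathbb D_M^+\}$, $\mathrm{SO}^+(M)=\mathrm O^+(M)\cap\mathrm{SL}_6(\mathbb Z)$; let $\mathrm O^+(M)_0$ be the subgroup of those $[a_{ij}]\in\mathrm O^+(M)$ with $\begin{bmatrix}a_{11}&a_{12}\\a_{21}&a_{22}\end{bmatrix}\equiv\mathrm I_2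 \bmod 2$, and $\mathrm{SO}^+(M)_0=\mathrm O^+(M)_0\cap\mathrm{SO}^+(M)$. Let $\mathbb H_2=\{\tau\in\mathrm{GL}_2(\mathbb C)\mid\frac1{2i}(\tau-\tau^*)>0\}$ be the Hermitian upper half space, identified with $\mathbb D_M^+$ by the bijection $$\Psi:\mathbb D_M^+\to\mathbb H_2,\qquad[1:z_2:\cdots:z_6]\mapsto\begin{bmatrix}z_3&z_5+\omega z_6\\z_5+\omega^2z_6&z_4\end{bmatrix}.$$ Let $\mathrm H\Gamma=\{g\in\mathrm{GL}_4(\mathbb Z[\omega])\mid g^*Jg=J\}$ with $J=\begin{bmatrix}0&\mathrm I_2\\-\mathrm I_2&0\end{bmatrix}$, acting on $\mathbb H_2$ by $\begin{bmatrix}A&B\\C&D\end{bmatrix}\cdot\tau=(A\tau+B)(C\tau+D)^{-1}$, let $\mathrm H\Gamma_0(2)$ be the subgroup given by $C\equiv0\bmod 2$, and let $\mu_6=\{\pm1,\pm\omega,\pm\omega^2\}$ be the group of scalar matrices in it. Let $T$ be the involution $\tau\mapsto{}^t\tau$ of $\mathbb H_2$, and $W$ the involution $\tau\mapsto-\frac12\tau^{-1}$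 of $\mathbb H_2$ given by the matrix $\begin{bmatrix}0&-\mathrm I_2\\2\mathrm I_2&0\end{bmatrix}$. Let $\mathrm H\Gamma_0^*(2)=\mathrm H\Gamma_0(2)\rtimes\langle W\rangle$, where $\langle W\rangle$ has order two and $W$ acts on $\mathrm H\Gamma_0(2)$ by conjugation with this matrix. In the semidirect products with $\langle T\rangle$ below, $\langle T\rangle$ has order two and $T$ acts by $g\mapsto\bar g$ on $\mathrm H\Gamma_0(2)$ and fixes $W$. Then there are isomorphisms \begin{align*} \mathrm{SO}^+(M)_0/\{\pm1\}&\cong\mathrm H\Gamma_0(2)/\mu_6, & \mathrm O^+(M)_0/\{\pm1\}&\cong(\mathrm H\Gamma_0(2)/\mu_6)\rtimes\langle T\rangle,\\ \mathrm{SO}^+(M)/\{\pm1\}&\cong\mathrm H\Gamma_0^*(2)/\mu_6, & \mathrm O^+(M)/\{\pm1\}&\cong(\mathrm H\Gamma_0^*(2)/\mu_6)\rtimes\langle T\rangle \end{align*} as groups of automorphisms of $\mathbb D_M^+\cong\mathbb H_2$. That is, in each case both groups act faithfully, on $\mathbb D_M^+$ and on $\mathbb H_2$ respectively, and the isomorphism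 $\varphi$ satisfies $\Psi(g\cdot z)=\varphi(g)\cdot\Psi(z)$ for all $g$ in the group on the left and all $z\in\mathbb D_M^+$. -/

import Mathlib

open scoped Matrix LinearAlgebra.Projectivization Pointwise ComplexOrder

noncomputable section

namespace HessianK3

/-! ### The lattice `M = U ⊕ U(2) ⊕ A₂(2)` and its orthogonal groups -/

/-- The Gram matrix of `U ⊕ U(2) ⊕ A₂(2)` on `ℤ⁶` (with `A₂` negative definite). -/
def Q : Matrix (Fin 6) (Fin 6) ℤ :=
  !![0, 1, 0, 0, 0, 0;
     1, 0, 0, 0, 0, 0;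
     0, 0, 0, 2, 0, 0;
     0, 0, 2, 0, 0, 0;
     0, 0, 0, 0, -4, 2;
     0, 0, 0, 0, 2, -4]

/-- The Gram matrix with complex entries. -/
def QC : Matrix (Fin 6) (Fin 6) ℂ := Q.map (Int.castRingHom ℂ)

/-- The orthogonal group `O(M) = {g ∈ GL₆(ℤ) | ᵗg Q g = Q}`. -/
def OM : Subgroup (GL (Fin 6) ℤ) where
  carrier := {g | g.1ᵀ * Q * g.1 = Q}
  one_mem' := by simp
  mul_mem' {g h} hg hh := by
    simp only [Set.mem_ofPred_eq] at hg hh ⊢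
    calc (g * h).1ᵀ * Q * (g * h).1 = h.1ᵀ * (g.1ᵀ * Q * g.1) * h.1 := by
          rw [Units.val_mul, Matrix.transpose_mul]; simp only [Matrix.mul_assoc]
      _ = Q := by rw [hg, hh]
  inv_mem' {g} hg := by
    simp only [Set.mem_ofPred_eq] at hg ⊢
    have h1 : g.1 * (g⁻¹).1 = 1 := by rw [← Units.val_mul]; simp
    calc (g⁻¹).1ᵀ * Q * (g⁻¹).1 = (g⁻¹).1ᵀ * (g.1ᵀ * Q * g.1) * (g⁻¹).1 := by rw [hg]
      _ = (g.1 * (g⁻¹).1)ᵀ * Q * (g.1 * (g⁻¹).1) := by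
          rw [Matrix.transpose_mul]; simp only [Matrix.mul_assoc]
      _ = Q := by rw [h1]; simp

/-- The projective space `ℙ(M ⊗ ℂ)`. -/
abbrev PM : Type := ℙ ℂ (Fin 6 → ℂ)

/-- The period domain `D_M`: lines spanned by `v` with `ᵗv Q v = 0` and `ᵗv Q v̄ > 0`
(the number `ᵗv Q v̄` is always real, and the conditions do not depend on the choice of `v`). -/
def DM : Set PM :=
  {z | z.rep ⬝ᵥ QC *ᵥ z.rep = 0 ∧ 0 < (z.rep ⬝ᵥ QC *ᵥ star z.rep).re}

/-- The component `D_M⁺` of the period domain: in coordinates `[1 : z₂ : ⋯ : z₆]` it is given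
by `Im z₃ > 0`. -/
def DMplus : Set PM := {z | z ∈ DM ∧ 0 < (z.rep 2 / z.rep 0).im}

/-- The action of `GL₆(ℤ)` on `ℙ(M ⊗ ℂ)` by linear maps `v ↦ g v`. -/
def projPerm : GL (Fin 6) ℤ →* Equiv.Perm PM :=
  (MulAction.toPermHom (LinearMap.GeneralLinearGroup ℂ (Fin 6 → ℂ)) PM).comp
    (Matrix.GeneralLinearGroup.toLin.toMonoidHom.comp
      (Matrix.GeneralLinearGroup.map (Int.castRingHom ℂ)))

/-- `O⁺(M) = {g ∈ O(M) | g(D_M⁺) = D_M⁺}`. -/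
def OMplus : Subgroup (GL (Fin 6) ℤ) :=
  OM ⊓ (MulAction.stabilizer (Equiv.Perm PM) DMplus).comap projPerm

/-- `SO⁺(M) = O⁺(M) ∩ SL₆(ℤ)`. -/
def SOMplus : Subgroup (GL (Fin 6) ℤ) := OMplus ⊓ Matrix.GeneralLinearGroup.det.ker

/-- The first two rows of an element of `O(M)` with the upper left `2 × 2` block congruent to the
identity mod `2` are congruent to `(1 0 0 0 0 0)`, `(0 1 0 0 0 0)` mod `2`. -/
theorem rows_mod_two {g : GL (Fin 6) ℤ} (hg : g ∈ OM)
    (h : ∀ i j : Fin 6, i < 2 → j < 2 → (2 : ℤ) ∣ g.1 i j - (1 : Matrix (Fin 6) (Fin 6) ℤ) i j)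
    (i j : Fin 6) (hi : i < 2) :
    (2 : ℤ) ∣ g.1 i j - (1 : Matrix (Fin 6) (Fin 6) ℤ) i j := by
  have hg' : g.1ᵀ * Q * g.1 = Q := hg
  by_cases hj : j < 2
  · exact h i j hi hj
  have h00 := h 0 0 (by decide) (by decide)
  have h01 := h 0 1 (by decide) (by decide)
  have h10 := h 1 0 (by decide) (by decide)
  have h11 := h 1 1 (by decide) (by decide)
  have e0 := congrFun (congrFun hg' 0) j
  have e1 := congrFun (congrFun hg' 1) j
  simp [Matrix.mul_apply, Fin.sum_univ_six, Q] at e0 e1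
  have q0 : (2 : ℤ) ∣ Q 0 j := by fin_cases j <;> simp [Q] at hj ⊢
  have q1 : (2 : ℤ) ∣ Q 1 j := by fin_cases j <;> simp [Q] at hj ⊢
  simp [Q] at q0 q1
  rw [← e0] at q0
  rw [← e1] at q1
  have k : ∀ i, i < 2 → (1 : Matrix (Fin 6) (Fin 6) ℤ) i j = 0 := by
    intro i hi
    exact Matrix.one_apply_ne (by rintro rfl; exact hj hi)
  rw [k i hi, sub_zero]
  simp at h00 h01 h10 h11
  obtain ⟨a, ha⟩ := h00
  obtain ⟨b, hb⟩ := h01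
  obtain ⟨c, hc⟩ := h10
  obtain ⟨d, hd⟩ := h11
  obtain ⟨u, hu⟩ := q0
  obtain ⟨w, hw⟩ := q1
  have ha' : g.1 0 0 = 2 * a + 1 := by linarith
  have hd' : g.1 1 1 = 2 * d + 1 := by linarith
  rw [ha', hc] at hu
  rw [hb, hd'] at hw
  have hi' : i = 0 ∨ i = 1 := by fin_cases i <;> simp at hi ⊢
  rcases hi' with rfl | rfl
  · refine ⟨w - d * g.1 0 j - b * g.1 1 j - g.1 3 1 * g.1 2 j - g.1 2 1 * g.1 3 j
      + 2 * g.1 4 1 * g.1 4 j - g.1 5 1 * g.1 4 j - g.1 4 1 * g.1 5 j + 2 * g.1 5 1 * g.1 5 j, ?_⟩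
    linear_combination hw
  · refine ⟨u - a * g.1 1 j - c * g.1 0 j - g.1 3 0 * g.1 2 j - g.1 2 0 * g.1 3 j
      + 2 * g.1 4 0 * g.1 4 j - g.1 5 0 * g.1 4 j - g.1 4 0 * g.1 5 j + 2 * g.1 5 0 * g.1 5 j, ?_⟩
    linear_combination hu

/-- `O⁺(M)₀`: the elements `[a_ij]` of `O⁺(M)` whose upper left `2 × 2` block is congruent to the
identity mod `2`. -/
def OMplus0 : Subgroup (GL (Fin 6) ℤ) where
  carrier := {g | g ∈ OMplus ∧ ∀ i j : Fin 6, i < 2 → j < 2 →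
    (2 : ℤ) ∣ g.1 i j - (1 : Matrix (Fin 6) (Fin 6) ℤ) i j}
  one_mem' := ⟨one_mem _, by simp⟩
  mul_mem' {g h} hg hh := by
    refine ⟨mul_mem hg.1 hh.1, fun i j hi hj => ?_⟩
    have r := rows_mod_two hg.1.1 hg.2 i
    have s := hh.2 i j hi hj
    have : (g * h).1 i j - (1 : Matrix (Fin 6) (Fin 6) ℤ) i j =
        (∑ k, (g.1 i k - (1 : Matrix (Fin 6) (Fin 6) ℤ) i k) * h.1 k j)
          + (h.1 i j - (1 : Matrix (Fin 6) (Fin 6) ℤ) i j) := by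
      simp [Matrix.mul_apply, sub_mul, Finset.sum_sub_distrib, Matrix.one_apply]
    rw [this]
    exact dvd_add (Finset.dvd_sum fun k _ => Dvd.dvd.mul_right (r k hi) _) s
  inv_mem' {g} hg := by
    refine ⟨inv_mem hg.1, fun i j hi hj => ?_⟩
    have r := rows_mod_two hg.1.1 hg.2 i
    have h1 : g.1 * (g⁻¹).1 = 1 := by rw [← Units.val_mul]; simp
    have : (g⁻¹).1 i j - (1 : Matrix (Fin 6) (Fin 6) ℤ) i j =
        - ∑ k, (g.1 i k - (1 : Matrix (Fin 6) (Fin 6) ℤ) i k) * (g⁻¹).1 k j := by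
      have := congrFun (congrFun h1 i) j
      rw [Matrix.mul_apply] at this
      simp only [sub_mul, Finset.sum_sub_distrib, this]
      simp [Matrix.one_apply]
    rw [this]
    exact (Finset.dvd_sum fun k _ => Dvd.dvd.mul_right (r k hi) _).neg_right

/-- `SO⁺(M)₀ = O⁺(M)₀ ∩ SO⁺(M)`. -/
def SOMplus0 : Subgroup (GL (Fin 6) ℤ) := OMplus0 ⊓ SOMplus

theorem OMplus0_le : OMplus0 ≤ OMplus := fun _ h => h.1
theorem SOMplus_le : SOMplus ≤ OMplus := inf_le_left
theorem SOMplus0_le : SOMplus0 ≤ OMplus := fun _ h => h.1.1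

/-- The group `{±1}` in `GL₆(ℤ)`. -/
def pmOne : Subgroup (GL (Fin 6) ℤ) where
  carrier := {1, -1}
  one_mem' := Or.inl rfl
  mul_mem' {a b} ha hb := by
    rcases ha with rfl | rfl <;> rcases hb with rfl | rfl <;> simp
  inv_mem' {a} ha := by rcases ha with rfl | rfl <;> simp

instance : pmOne.Normal where
  conj_mem a ha g := by
    rcases ha with rfl | rfl
    · exact Or.inl (by simp)
    · exact Or.inr (by simp)

/-- For a subgroup `K` of `O⁺(M)`, the quotient `K / {±1}`
(the groups considered below all contain `-1`). -/
abbrev ModPM (K : Subgroup (GL (Fin 6) ℤ)) : Type := K ⧸ pmOne.subgroupOf K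

/-- The action of a subgroup `K` of `O⁺(M)` on `D_M⁺`. -/
def actK (K : Subgroup (GL (Fin 6) ℤ)) (hK : K ≤ OMplus) : K →* Equiv.Perm DMplus :=
  (MulAction.toPermHom (MulAction.stabilizer (Equiv.Perm PM) DMplus) DMplus).comp
    ((projPerm.subgroupComap (MulAction.stabilizer (Equiv.Perm PM) DMplus)).comp
      (Subgroup.inclusion (hK.trans inf_le_right)))

theorem projPerm_mk (g : GL (Fin 6) ℤ) (v : Fin 6 → ℂ) (hv : v ≠ 0) :
    ∃ h, projPerm g (.mk ℂ v hv) = .mk ℂ (g.1.map (Int.castRingHom ℂ) *ᵥ v) h :=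
  ⟨_, rfl⟩

theorem projPerm_neg_one : projPerm (-1) = 1 := by
  ext z
  induction z using Projectivization.ind with
  | h v hv =>
    obtain ⟨h, e⟩ := projPerm_mk (-1) v hv
    rw [e]
    simp only [Equiv.Perm.coe_one, id_eq]
    rw [Projectivization.mk_eq_mk_iff']
    refine ⟨-1, ?_⟩
    have : ((-1 : GL (Fin 6) ℤ).1.map (Int.castRingHom ℂ)) = -1 := by
      ext i j
      by_cases hij : i = j <;> simp [hij]
    rw [this, Matrix.neg_mulVec, Matrix.one_mulVec, neg_one_smul]

/-- The induced action of `K / {±1}` on `D_M⁺`. -/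
def actModPM (K : Subgroup (GL (Fin 6) ℤ)) (hK : K ≤ OMplus) :
    ModPM K →* Equiv.Perm DMplus :=
  QuotientGroup.lift _ (actK K hK) (by
    rintro ⟨g, hgK⟩ hg
    rw [Subgroup.mem_subgroupOf] at hg
    rw [MonoidHom.mem_ker]
    ext z
    have : ((actK K hK ⟨g, hgK⟩ z : DMplus) : PM) = projPerm g z := rfl
    rw [this]
    rcases hg with h | h
    · simp only at h
      subst h; simp
    · simp only [Set.mem_singleton_iff] at h
      subst h; rw [projPerm_neg_one]; simp)

/-! ### The Hermitian upper half space of degree two and the Hermitian modular group -/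

/-- `ω = exp(2πi/3)`. -/
def ω : ℂ := Complex.exp (2 * Real.pi * Complex.I / 3)

/-- The ring `ℤ[ω]` of Eisenstein integers. -/
def Eis : Subring ℂ := Subring.closure {ω}

/-- The Hermitian upper half space of degree two: the matrices `τ` with `(τ - τ*) / 2i` positive
definite (such a `τ` is automatically invertible). -/
def H2 : Set (Matrix (Fin 2) (Fin 2) ℂ) :=
  {τ | ((1 / (2 * Complex.I)) • (τ - τᴴ)).PosDef}

/-- Block matrices of size `4 = 2 + 2`. -/
abbrev Mat4 : Type := Matrix (Fin 2 ⊕ Fin 2) (Fin 2 ⊕ Fin 2) ℂ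

/-- The group `GL₄(ℂ)`, with matrices in `2 × 2` blocks. -/
abbrev GL4 : Type := GL (Fin 2 ⊕ Fin 2) ℂ

/-- `J = [0 I; -I 0]`. -/
def J : Mat4 := Matrix.fromBlocks 0 1 (-1) 0

/-- The group of all `g ∈ GL₄(ℂ)` with `g* J g = r J` for some real `r > 0`; it acts on the
Hermitian upper half space by fractional linear transformations. -/
def GU : Subgroup GL4 where
  carrier := {g | ∃ r : ℝ, 0 < r ∧ g.1ᴴ * J * g.1 = (r : ℂ) • J}
  one_mem' := ⟨1, one_pos, by simp⟩
  mul_mem' {g h} := by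
    rintro ⟨r, hr, hg⟩ ⟨s, hs, hh⟩
    refine ⟨r * s, mul_pos hr hs, ?_⟩
    calc (g * h).1ᴴ * J * (g * h).1 = h.1ᴴ * (g.1ᴴ * J * g.1) * h.1 := by
          rw [Units.val_mul, Matrix.conjTranspose_mul]; simp only [Matrix.mul_assoc]
      _ = _ := by
          rw [hg, Matrix.mul_smul, Matrix.smul_mul, hh, smul_smul, Complex.ofReal_mul]
  inv_mem' {g} := by
    rintro ⟨r, hr, hg⟩
    refine ⟨r⁻¹, inv_pos.mpr hr, ?_⟩
    have h1 : g.1 * (g⁻¹).1 = 1 := by rw [← Units.val_mul]; simp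
    have h2 : (r : ℂ) • ((g⁻¹).1ᴴ * J * (g⁻¹).1) = J := by
      calc (r : ℂ) • ((g⁻¹).1ᴴ * J * (g⁻¹).1) = (g⁻¹).1ᴴ * ((r : ℂ) • J) * (g⁻¹).1 := by
            rw [Matrix.mul_smul, Matrix.smul_mul]
        _ = (g.1 * (g⁻¹).1)ᴴ * J * (g.1 * (g⁻¹).1) := by
            rw [← hg, Matrix.conjTranspose_mul]; simp only [Matrix.mul_assoc]
        _ = J := by rw [h1]; simp
    have hr' : (r : ℂ) ≠ 0 := by exact_mod_cast hr.ne'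
    rw [Complex.ofReal_inv, eq_inv_smul_iff₀ hr', h2]

/-- The fractional linear transformation `τ ↦ (Aτ + B)(Cτ + D)⁻¹` for `g = [A B; C D]`. -/
def moebius (g : Mat4) (τ : Matrix (Fin 2) (Fin 2) ℂ) : Matrix (Fin 2) (Fin 2) ℂ :=
  (g.toBlocks₁₁ * τ + g.toBlocks₁₂) * (g.toBlocks₂₁ * τ + g.toBlocks₂₂)⁻¹

theorem block_identity (g : Mat4) (r : ℂ) (hg : gᴴ * J * g = r • J)
    (τ : Matrix (Fin 2) (Fin 2) ℂ) :
    (g.toBlocks₁₁ * τ + g.toBlocks₁₂)ᴴ * (g.toBlocks₂₁ * τ + g.toBlocks₂₂)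
      - (g.toBlocks₂₁ * τ + g.toBlocks₂₂)ᴴ * (g.toBlocks₁₁ * τ + g.toBlocks₁₂)
      = r • (τᴴ - τ) := by
  obtain ⟨A, B, C, D, rfl⟩ : ∃ A B C D, g = Matrix.fromBlocks A B C D :=
    ⟨_, _, _, _, g.fromBlocks_toBlocks.symm⟩
  simp only [J, Matrix.fromBlocks_conjTranspose, Matrix.fromBlocks_multiply,
    Matrix.fromBlocks_smul, Matrix.fromBlocks_inj, mul_zero, mul_one, mul_neg, zero_add, add_zero,
    smul_zero] at hg
  obtain ⟨h1, h2, h3, h4⟩ := hg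
  simp only [Matrix.toBlocks_fromBlocks₁₁, Matrix.toBlocks_fromBlocks₁₂,
    Matrix.toBlocks_fromBlocks₂₁, Matrix.toBlocks_fromBlocks₂₂, Matrix.conjTranspose_add,
    Matrix.conjTranspose_mul]
  have : (τᴴ * Aᴴ + Bᴴ) * (C * τ + D) - (τᴴ * Cᴴ + Dᴴ) * (A * τ + B)
      = τᴴ * (-Cᴴ * A + Aᴴ * C) * τ + τᴴ * (-Cᴴ * B + Aᴴ * D)
        + (-Dᴴ * A + Bᴴ * C) * τ + (-Dᴴ * B + Bᴴ * D) := by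
    noncomm_ring
  rw [this, h1, h2, h3, h4, smul_sub]
  simp [sub_eq_add_neg]

theorem denom_isUnit {g : GL4} (hg : g ∈ GU) {τ : Matrix (Fin 2) (Fin 2) ℂ} (hτ : τ ∈ H2) :
    IsUnit (g.1.toBlocks₂₁ * τ + g.1.toBlocks₂₂) := by
  obtain ⟨r, hr, hg⟩ := hg
  have key := block_identity g.1 r hg τ
  set P := g.1.toBlocks₁₁ * τ + g.1.toBlocks₁₂
  set S := g.1.toBlocks₂₁ * τ + g.1.toBlocks₂₂
  rw [← Matrix.mulVec_injective_iff_isUnit]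
  refine (injective_iff_map_eq_zero (Matrix.mulVecLin S)).mpr fun v hv => ?_
  by_contra hv0
  have hv : S *ᵥ v = 0 := hv
  have pos := Matrix.PosDef.dotProduct_mulVec_pos (M := (1 / (2 * Complex.I)) • (τ - τᴴ)) hτ hv0
  have e := congrArg (fun X => star v ⬝ᵥ X *ᵥ v) key
  simp only [Matrix.sub_mulVec, ← Matrix.mulVec_mulVec, hv, Matrix.mulVec_zero, zero_sub,
    dotProduct_neg] at e
  rw [Matrix.dotProduct_mulVec, ← Matrix.star_mulVec, hv] at e
  simp only [star_zero, zero_dotProduct, neg_zero, Matrix.smul_mulVec, dotProduct_smul,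
    Matrix.sub_mulVec, smul_eq_mul] at e
  have hr' : (r : ℂ) ≠ 0 := by exact_mod_cast hr.ne'
  have e2 := (mul_eq_zero.mp e.symm).resolve_left hr'
  simp only [Matrix.smul_mulVec, dotProduct_smul, Matrix.sub_mulVec, smul_eq_mul] at pos
  rw [dotProduct_sub] at e2 pos
  rw [← neg_sub, e2] at pos
  simp at pos

theorem moebius_mem {g : GL4} (hg : g ∈ GU) {τ : Matrix (Fin 2) (Fin 2) ℂ} (hτ : τ ∈ H2) :
    moebius g.1 τ ∈ H2 := by
  have hu := denom_isUnit hg hτ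
  obtain ⟨r, hr, hg⟩ := hg
  have key := block_identity g.1 r hg τ
  unfold moebius
  set P := g.1.toBlocks₁₁ * τ + g.1.toBlocks₁₂
  set S := g.1.toBlocks₂₁ * τ + g.1.toBlocks₂₂
  have hd : IsUnit S.det := (Matrix.isUnit_iff_isUnit_det S).mp hu
  have s1 : S * S⁻¹ = 1 := Matrix.mul_nonsing_inv S hd
  have s2 : (S⁻¹)ᴴ * Sᴴ = 1 := by rw [← Matrix.conjTranspose_mul, s1, Matrix.conjTranspose_one]
  have e : (1 / (2 * Complex.I)) • (P * S⁻¹ - (P * S⁻¹)ᴴ)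
      = (r : ℂ) • ((S⁻¹)ᴴ * ((1 / (2 * Complex.I)) • (τ - τᴴ)) * S⁻¹) := by
    have : (r : ℂ) • (τ - τᴴ) = Sᴴ * P - Pᴴ * S := by
      rw [← neg_sub τᴴ τ, smul_neg, ← key, neg_sub]
    have h2 : (r : ℂ) • ((S⁻¹)ᴴ * ((1 / (2 * Complex.I)) • (τ - τᴴ)) * S⁻¹)
        = (1 / (2 * Complex.I)) • ((S⁻¹)ᴴ * ((r : ℂ) • (τ - τᴴ)) * S⁻¹) := by
      simp only [Matrix.mul_smul, Matrix.smul_mul]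
      rw [smul_comm]
    rw [h2, this]
    congr 1
    rw [Matrix.mul_sub, Matrix.sub_mul, ← Matrix.mul_assoc, s2, Matrix.one_mul,
      ← Matrix.mul_assoc, Matrix.mul_assoc _ S, s1, Matrix.mul_one, Matrix.conjTranspose_mul]
  change Matrix.PosDef _
  rw [e]
  have hinj : Function.Injective (S⁻¹).mulVec := by
    rw [Matrix.mulVec_injective_iff_isUnit]
    exact (Matrix.isUnit_nonsing_inv_iff).mpr hu
  have := Matrix.PosDef.conjTranspose_mul_mul_same (A := (1 / (2 * Complex.I)) • (τ - τᴴ)) hτ hinj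
  exact this.smul (by exact_mod_cast hr)

theorem moebius_one (τ : Matrix (Fin 2) (Fin 2) ℂ) : moebius 1 τ = τ := by
  have : (1 : Mat4) = Matrix.fromBlocks 1 0 0 1 := Matrix.fromBlocks_one.symm
  unfold moebius
  rw [this]
  simp only [Matrix.toBlocks_fromBlocks₁₁, Matrix.toBlocks_fromBlocks₁₂,
    Matrix.toBlocks_fromBlocks₂₁, Matrix.toBlocks_fromBlocks₂₂]
  simp

theorem moebius_mul {g h : GL4} (hg : g ∈ GU) (hh : h ∈ GU)
    {τ : Matrix (Fin 2) (Fin 2) ℂ} (hτ : τ ∈ H2) :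
    moebius (g * h).1 τ = moebius g.1 (moebius h.1 τ) := by
  have hu := denom_isUnit hh hτ
  have hv := denom_isUnit hg (moebius_mem hh hτ)
  rw [Units.val_mul]
  generalize g.1 = g at *
  generalize h.1 = h at *
  obtain ⟨A, B, C, D, rfl⟩ : ∃ A B C D, g = Matrix.fromBlocks A B C D :=
    ⟨_, _, _, _, g.fromBlocks_toBlocks.symm⟩
  obtain ⟨A', B', C', D', rfl⟩ : ∃ A B C D, h = Matrix.fromBlocks A B C D :=
    ⟨_, _, _, _, h.fromBlocks_toBlocks.symm⟩
  simp only [moebius, Matrix.fromBlocks_multiply, Matrix.toBlocks_fromBlocks₁₁,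
    Matrix.toBlocks_fromBlocks₁₂, Matrix.toBlocks_fromBlocks₂₁,
    Matrix.toBlocks_fromBlocks₂₂] at hu hv ⊢
  set P := A' * τ + B' with hP
  set S := C' * τ + D' with hS
  have hd : IsUnit S.det := (Matrix.isUnit_iff_isUnit_det S).mp hu
  have s1 : S⁻¹ * S = 1 := Matrix.nonsing_inv_mul S hd
  have e1 : (A * A' + B * C') * τ + (A * B' + B * D') = (A * (P * S⁻¹) + B) * S := by
    have : (A * (P * S⁻¹) + B) * S = A * P * (S⁻¹ * S) + B * S := by noncomm_ring
    rw [this, s1, hP, hS]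
    noncomm_ring
  have e2 : (C * A' + D * C') * τ + (C * B' + D * D') = (C * (P * S⁻¹) + D) * S := by
    have : (C * (P * S⁻¹) + D) * S = C * P * (S⁻¹ * S) + D * S := by noncomm_ring
    rw [this, s1, hP, hS]
    noncomm_ring
  rw [e1, e2, Matrix.mul_inv_rev, Matrix.mul_assoc, ← Matrix.mul_assoc S,
    Matrix.mul_nonsing_inv S hd, Matrix.one_mul]

instance : MulAction GU H2 where
  smul g τ := ⟨moebius g.1.1 τ.1, moebius_mem g.2 τ.2⟩
  one_smul τ := Subtype.ext (moebius_one τ.1)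
  mul_smul g h τ := Subtype.ext (moebius_mul g.2 h.2 τ.2)

/-- The action of `GU` on the Hermitian upper half space. -/
def actGU : GU →* Equiv.Perm H2 := MulAction.toPermHom GU H2

theorem actGU_apply (g : GU) (τ : H2) : (actGU g τ).1 = moebius g.1.1 τ.1 := rfl

/-- The Hermitian modular group `HΓ = {g ∈ GL₄(ℤ[ω]) | g* J g = J}`, inside `GL₄(ℂ)`. -/
def HG : Subgroup GL4 where
  carrier := {g | (∀ i j, g.1 i j ∈ Eis ∧ (g⁻¹).1 i j ∈ Eis) ∧ g.1ᴴ * J * g.1 = J}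
  one_mem' := by
    refine ⟨fun i j => ?_, by simp⟩
    by_cases h : i = j
    · subst h; simp
    · simp [Matrix.one_apply_ne h]
  mul_mem' {g h} hg hh := by
    refine ⟨fun i j => ?_, ?_⟩
    · rw [mul_inv_rev, Units.val_mul, Units.val_mul, Matrix.mul_apply, Matrix.mul_apply]
      exact ⟨sum_mem fun k _ => mul_mem (hg.1 i k).1 (hh.1 k j).1,
        sum_mem fun k _ => mul_mem (hh.1 i k).2 (hg.1 k j).2⟩
    · calc (g * h).1ᴴ * J * (g * h).1 = h.1ᴴ * (g.1ᴴ * J * g.1) * h.1 := by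
            rw [Units.val_mul, Matrix.conjTranspose_mul]; simp only [Matrix.mul_assoc]
        _ = J := by rw [hg.2, hh.2]
  inv_mem' {g} hg := by
    refine ⟨fun i j => ⟨(hg.1 i j).2, by rw [inv_inv]; exact (hg.1 i j).1⟩, ?_⟩
    have h1 : g.1 * (g⁻¹).1 = 1 := by rw [← Units.val_mul]; simp
    calc (g⁻¹).1ᴴ * J * (g⁻¹).1 = (g⁻¹).1ᴴ * (g.1ᴴ * J * g.1) * (g⁻¹).1 := by rw [hg.2]
      _ = (g.1 * (g⁻¹).1)ᴴ * J * (g.1 * (g⁻¹).1) := by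
          rw [Matrix.conjTranspose_mul]; simp only [Matrix.mul_assoc]
      _ = J := by rw [h1]; simp

theorem HG_le : HG ≤ GU := fun g hg => ⟨1, one_pos, by rw [hg.2]; simp⟩

theorem ω_pow_three : ω ^ 3 = 1 := by
  rw [ω, ← Complex.exp_nat_mul]
  rw [show ((3 : ℕ) : ℂ) * (2 * Real.pi * Complex.I / 3) = 2 * Real.pi * Complex.I by
    push_cast; ring]
  exact Complex.exp_two_pi_mul_I

theorem ω_im : ω.im = √3 / 2 := by
  rw [ω, show (2 * Real.pi * Complex.I / 3 : ℂ) = ((Real.pi - Real.pi / 3 : ℝ) : ℂ) * Complex.I by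
    push_cast; ring, Complex.exp_ofReal_mul_I_im, Real.sin_pi_sub, Real.sin_pi_div_three]

theorem ω_re : ω.re = -1 / 2 := by
  rw [ω, show (2 * Real.pi * Complex.I / 3 : ℂ) = ((Real.pi - Real.pi / 3 : ℝ) : ℂ) * Complex.I by
    push_cast; ring, Complex.exp_ofReal_mul_I_re, Real.cos_pi_sub, Real.cos_pi_div_three]
  norm_num

theorem sq_sqrt_three : √3 * √3 = 3 := Real.mul_self_sqrt (by norm_num)

theorem ω_quad : ω ^ 2 + ω + 1 = 0 := by
  apply Complex.ext
  · simp [pow_two, ω_re, ω_im]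
    linarith [sq_sqrt_three]
  · simp [pow_two, ω_re, ω_im]
    ring

theorem star_ω : star ω = ω ^ 2 := by
  have : star ω = -1 - ω := by
    apply Complex.ext
    · simp [ω_re]; norm_num
    · simp
  rw [this]
  linear_combination -ω_quad

theorem ω_mem_Eis : ω ∈ Eis := Subring.subset_closure (Set.mem_singleton ω)

theorem star_mem_Eis {x : ℂ} (hx : x ∈ Eis) : star x ∈ Eis := by
  induction hx using Subring.closure_induction with
  | mem x hx =>
    rw [Set.mem_singleton_iff.mp hx, star_ω]
    exact pow_mem ω_mem_Eis 2
  | zero => rw [star_zero]; exact zero_mem _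
  | one => rw [star_one]; exact one_mem _
  | add x y _ _ hx hy => rw [star_add]; exact add_mem hx hy
  | neg x _ hx => rw [star_neg]; exact neg_mem hx
  | mul x y _ _ hx hy => rw [star_mul]; exact mul_mem hy hx

theorem inv_lower_left {g : GL4} (hg : g.1ᴴ * J * g.1 = J) (i j : Fin 2) :
    (g⁻¹).1 (.inr i) (.inl j) = - star (g.1 (.inr j) (.inl i)) := by
  have h1 : g.1 * (g⁻¹).1 = 1 := by rw [← Units.val_mul]; simp
  have h2 : J * (g⁻¹).1 = g.1ᴴ * J := by
    calc J * (g⁻¹).1 = (g.1ᴴ * J * g.1) * (g⁻¹).1 := by rw [hg]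
      _ = g.1ᴴ * J := by rw [Matrix.mul_assoc, h1, Matrix.mul_one]
  have h3 := congrFun (congrFun h2 (.inl i)) (.inl j)
  simpa [Matrix.mul_apply, J, Matrix.one_apply] using h3

/-- `HΓ₀(2)`: the elements `[A B; C D]` of `HΓ` with `C ≡ 0` modulo `2ℤ[ω]`. -/
def HG02 : Subgroup GL4 where
  carrier := {g | g ∈ HG ∧ ∀ i j : Fin 2, ∃ c ∈ Eis, g.1 (.inr i) (.inl j) = 2 * c}
  one_mem' := ⟨one_mem _, fun i j => ⟨0, zero_mem _, by simp⟩⟩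
  mul_mem' {g h} hg hh := by
    refine ⟨mul_mem hg.1 hh.1, fun i j => ?_⟩
    choose c hc ec using hg.2
    choose d hd ed using hh.2
    refine ⟨(∑ k, c i k * h.1 (.inl k) (.inl j)) + ∑ k, g.1 (.inr i) (.inr k) * d k j, ?_, ?_⟩
    · exact add_mem (sum_mem fun k _ => mul_mem (hc _ _) (hh.1.1 _ _).1)
        (sum_mem fun k _ => mul_mem (hg.1.1 _ _).1 (hd _ _))
    · rw [Units.val_mul, Matrix.mul_apply, Fintype.sum_sum_type, mul_add, Finset.mul_sum,
        Finset.mul_sum]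
      congr 1 <;> refine Finset.sum_congr rfl fun k _ => ?_
      · rw [ec]; ring
      · rw [ed]; ring
  inv_mem' {g} hg := by
    refine ⟨inv_mem hg.1, fun i j => ?_⟩
    obtain ⟨c, hc, ec⟩ := hg.2 j i
    refine ⟨-star c, neg_mem (star_mem_Eis hc), ?_⟩
    rw [inv_lower_left hg.1.2, ec]
    simp

theorem HG02_le : HG02 ≤ GU := fun _ h => HG_le h.1

/-- The group of scalar matrices `ζ I₄` with `ζ⁶ = 1`, that is, `{±1, ±ω, ±ω²}`. -/
def mu6 : Subgroup GL4 := (rootsOfUnity 6 ℂ).map (Matrix.GeneralLinearGroup.scalar _)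

theorem mu6_comm {s : GL4} (hs : s ∈ mu6) (g : GL4) : g * s = s * g := by
  obtain ⟨ζ, -, rfl⟩ := hs
  exact (Matrix.GeneralLinearGroup.scalar_commute ζ g).symm

instance : mu6.Normal where
  conj_mem s hs g := by
    rw [mu6_comm hs g]; simpa using hs

theorem moebius_scalar (a : ℂ) (ha : a ≠ 0) (τ : Matrix (Fin 2) (Fin 2) ℂ) :
    moebius (Matrix.scalar _ a) τ = τ := by
  have : (Matrix.scalar (Fin 2 ⊕ Fin 2) a) = Matrix.fromBlocks (a • 1) 0 0 (a • 1) := by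
    ext i j
    rcases i with i | i <;> rcases j with j | j <;>
      simp [Matrix.scalar_apply, Matrix.diagonal_apply, Matrix.one_apply]
  have h2 : (a • (1 : Matrix (Fin 2) (Fin 2) ℂ))⁻¹ = a⁻¹ • 1 := by
    apply Matrix.inv_eq_left_inv
    simp [smul_smul, ha]
  rw [moebius, this]
  simp only [Matrix.toBlocks_fromBlocks₁₁, Matrix.toBlocks_fromBlocks₁₂,
    Matrix.toBlocks_fromBlocks₂₁, Matrix.toBlocks_fromBlocks₂₂, zero_mul, add_zero, zero_add, h2]
  simp [smul_smul, ha]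

/-- `HΓ₀(2) / {±1, ±ω, ±ω²}`. -/
abbrev PHG02 : Type := HG02 ⧸ mu6.subgroupOf HG02

/-- The action of `HΓ₀(2)` on the Hermitian upper half space. -/
def actHG02 : HG02 →* Equiv.Perm H2 := actGU.comp (Subgroup.inclusion HG02_le)

theorem mu6_le_ker : mu6.subgroupOf HG02 ≤ actHG02.ker := by
  rintro ⟨g, hgK⟩ hg
  rw [Subgroup.mem_subgroupOf] at hg
  obtain ⟨ζ, -, h⟩ := hg
  rw [MonoidHom.mem_ker]
  ext1 τ
  apply Subtype.ext
  change moebius g.1 τ.1 = τ.1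
  have : g.1 = Matrix.scalar _ ζ.1 := by
    simp only at h
    rw [← h]; rfl
  rw [this]
  exact moebius_scalar _ ζ.ne_zero _

/-- The induced action of `HΓ₀(2) / {±1, ±ω, ±ω²}` on the Hermitian upper half space. -/
def actPHG02 : PHG02 →* Equiv.Perm H2 := QuotientGroup.lift _ actHG02 mu6_le_ker

/-! ### The involutions `T` and `W`, and semidirect products with them -/

/-- The group of order two. -/
abbrev C2 : Type := Multiplicative (ZMod 2)

theorem C2_cases (x : C2) : x = 1 ∨ x = Multiplicative.ofAdd 1 := by
  revert x; decide

/-- The homomorphism from the group of order two that sends the generator to the involution `f`. -/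
def c2Hom {G : Type*} [Group G] (f : G) (hf : f * f = 1) : C2 →* G where
  toFun x := if x = 1 then 1 else f
  map_one' := by simp
  map_mul' x y := by
    have h1 : (Multiplicative.ofAdd 1 : C2) ≠ 1 := by decide
    have h2 : (Multiplicative.ofAdd 1 : C2) * Multiplicative.ofAdd 1 = 1 := by decide
    rcases C2_cases x with rfl | rfl <;> rcases C2_cases y with rfl | rfl <;>
      simp [h1, h2, hf]

/-- The semidirect product `N ⋊ ⟨f⟩`, where `⟨f⟩` is a group of order two whose generator acts on
`N` by the involutive automorphism `f`. -/
abbrev SemiC2 {N : Type*} [Group N] (f : MulAut N) (hf : f * f = 1) : Type _ :=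
  N ⋊[c2Hom f hf] C2

/-- The homomorphism from `N ⋊ ⟨f⟩` given by `ρ` on `N` and sending the generator of `⟨f⟩`
to `t`. -/
def liftC2 {N P : Type*} [Group N] [Group P] (f : MulAut N) (hf : f * f = 1)
    (ρ : N →* P) (t : P) (ht : t * t = 1) (h : ∀ n, ρ (f n) = t * ρ n * t⁻¹) :
    SemiC2 f hf →* P :=
  SemidirectProduct.lift ρ (c2Hom t ht) (by
    intro x
    ext n
    rcases C2_cases x with rfl | rfl
    · simp
    · have h1 : (Multiplicative.ofAdd 1 : C2) ≠ 1 := by decide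
      simp [c2Hom, h1, h])

/-- The transposition `T : τ ↦ ᵗτ` of the Hermitian upper half space. -/
def T : Equiv.Perm H2 :=
  Function.Involutive.toPerm
    (fun τ => ⟨τ.1ᵀ, by
      have h : Matrix.PosDef ((1 / (2 * Complex.I)) • (τ.1 - τ.1ᴴ)) := τ.2
      have h2 := h.transpose
      rw [Matrix.transpose_smul, Matrix.transpose_sub] at h2
      exact h2⟩)
    (fun τ => Subtype.ext (Matrix.transpose_transpose τ.1))

theorem T_mul_T : T * T = 1 := by
  ext1 τ
  exact Subtype.ext (Matrix.transpose_transpose τ.1)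

/-- Entrywise complex conjugation `g ↦ ḡ` on `GL₄(ℂ)`. -/
def bar : GL4 →* GL4 := Matrix.GeneralLinearGroup.map (starRingEnd ℂ)

theorem bar_apply (g : GL4) (i j) : (bar g).1 i j = star (g.1 i j) := rfl

theorem bar_val (g : GL4) : (bar g).1 = g.1ᴴᵀ := rfl

theorem bar_bar (g : GL4) : bar (bar g) = g := by
  ext i j
  simp [bar_apply]

theorem J_conj : Jᴴᵀ = J := by
  ext i j
  rcases i with i | i <;> rcases j with j | j <;>
    simp [J, Matrix.one_apply]

theorem bar_mem_HG02 {g : GL4} (hg : g ∈ HG02) : bar g ∈ HG02 := by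
  refine ⟨⟨fun i j => ⟨star_mem_Eis (hg.1.1 i j).1, ?_⟩, ?_⟩, fun i j => ?_⟩
  · rw [← map_inv]
    exact star_mem_Eis (hg.1.1 i j).2
  · have h := congrArg (fun X : Mat4 => Xᴴᵀ) hg.1.2
    simp only [Matrix.conjTranspose_mul, Matrix.transpose_mul, J_conj] at h
    rw [bar_val, Matrix.mul_assoc]
    simp only [Matrix.mul_assoc] at h
    exact h
  · obtain ⟨c, hc, ec⟩ := hg.2 i j
    refine ⟨star c, star_mem_Eis hc, ?_⟩
    rw [bar_apply, ec]
    simp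

/-- Complex conjugation as an automorphism of `HΓ₀(2)`. -/
def barAut : MulAut HG02 where
  toFun g := ⟨bar g.1, bar_mem_HG02 g.2⟩
  invFun g := ⟨bar g.1, bar_mem_HG02 g.2⟩
  left_inv g := Subtype.ext (bar_bar g.1)
  right_inv g := Subtype.ext (bar_bar g.1)
  map_mul' g h := Subtype.ext (map_mul bar g.1 h.1)

theorem barAut_mul_self : barAut * barAut = 1 := by
  ext1 g
  exact Subtype.ext (bar_bar g.1)

theorem bar_mem_mu6 {g : GL4} (hg : g ∈ mu6) : bar g ∈ mu6 := by
  obtain ⟨ζ, hζ, rfl⟩ := hg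
  refine ⟨Units.map (starRingEnd ℂ).toMonoidHom ζ, ?_,
    (Matrix.GeneralLinearGroup.map_scalar (starRingEnd ℂ) ζ).symm⟩
  have h : ζ ^ 6 = 1 := (mem_rootsOfUnity _ _).mp hζ
  refine (mem_rootsOfUnity _ _).mpr ?_
  rw [← map_pow, h, map_one]

/-- The symmetry `T(gτ) = ḡ(Tτ)`. -/
theorem T_moebius {g : GL4} (hg : g ∈ HG02) (τ : H2) :
    (moebius g.1 τ.1)ᵀ = moebius (bar g).1 τ.1ᵀ := by
  have hu := denom_isUnit (HG02_le hg) τ.2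
  have hv := denom_isUnit (HG02_le (bar_mem_HG02 hg)) (T τ).2
  have key := hg.1.2
  change IsUnit ((bar g).1.toBlocks₂₁ * τ.1ᵀ + (bar g).1.toBlocks₂₂) at hv
  rw [bar_val] at hv ⊢
  generalize g.1 = g at *
  generalize τ.1 = τ at *
  obtain ⟨A, B, C, D, rfl⟩ : ∃ A B C D, g = Matrix.fromBlocks A B C D :=
    ⟨_, _, _, _, g.fromBlocks_toBlocks.symm⟩
  simp only [J, Matrix.fromBlocks_conjTranspose, Matrix.fromBlocks_multiply,
    Matrix.fromBlocks_inj, mul_zero, mul_one, mul_neg, zero_add, add_zero] at key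
  simp only [moebius, Matrix.fromBlocks_conjTranspose, Matrix.fromBlocks_transpose,
    Matrix.toBlocks_fromBlocks₁₁, Matrix.toBlocks_fromBlocks₁₂, Matrix.toBlocks_fromBlocks₂₁,
    Matrix.toBlocks_fromBlocks₂₂] at hu hv ⊢
  have kt : ∀ X Y : Matrix (Fin 2) (Fin 2) ℂ, X = Y → Xᵀ = Yᵀ := fun _ _ h => by rw [h]
  obtain ⟨h1, h2, h3, h4⟩ := key
  replace h1 := kt _ _ h1
  replace h2 := kt _ _ h2
  replace h3 := kt _ _ h3
  replace h4 := kt _ _ h4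
  simp only [Matrix.transpose_add, Matrix.transpose_neg, Matrix.transpose_mul, neg_mul,
    Matrix.transpose_zero, Matrix.transpose_one] at h1 h2 h3 h4
  have e : (A * τ + B)ᵀ * (Cᴴᵀ * τᵀ + Dᴴᵀ) = (C * τ + D)ᵀ * (Aᴴᵀ * τᵀ + Bᴴᵀ) := by
    rw [← sub_eq_zero]
    simp only [Matrix.transpose_add, Matrix.transpose_mul]
    have : (τᵀ * Aᵀ + Bᵀ) * (Cᴴᵀ * τᵀ + Dᴴᵀ) - (τᵀ * Cᵀ + Dᵀ) * (Aᴴᵀ * τᵀ + Bᴴᵀ)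
        = -(τᵀ * (-(Aᵀ * Cᴴᵀ) + Cᵀ * Aᴴᵀ) * τᵀ) - (-(Bᵀ * Cᴴᵀ) + Dᵀ * Aᴴᵀ) * τᵀ
          - τᵀ * (-(Aᵀ * Dᴴᵀ) + Cᵀ * Bᴴᵀ) - (-(Bᵀ * Dᴴᵀ) + Dᵀ * Bᴴᵀ) := by
      noncomm_ring
    rw [this, h1, h2, h3, h4]
    simp
  set S := C * τ + D
  set S' := Cᴴᵀ * τᵀ + Dᴴᵀ
  have hdt : IsUnit Sᵀ.det := by
    rw [Matrix.det_transpose]; exact (Matrix.isUnit_iff_isUnit_det S).mp hu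
  have hd' : IsUnit S'.det := (Matrix.isUnit_iff_isUnit_det S').mp hv
  rw [Matrix.transpose_mul, Matrix.transpose_nonsing_inv]
  calc (Sᵀ)⁻¹ * (A * τ + B)ᵀ = (Sᵀ)⁻¹ * ((A * τ + B)ᵀ * S') * S'⁻¹ := by
        rw [Matrix.mul_assoc, Matrix.mul_assoc, Matrix.mul_nonsing_inv S' hd', Matrix.mul_one]
    _ = (Aᴴᵀ * τᵀ + Bᴴᵀ) * S'⁻¹ := by
        rw [e, ← Matrix.mul_assoc, Matrix.nonsing_inv_mul Sᵀ hdt, Matrix.one_mul]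

theorem T_actHG02 (g : HG02) : actHG02 (barAut g) = T * actHG02 g * T⁻¹ := by
  rw [eq_mul_inv_iff_mul_eq]
  ext1 τ
  exact Subtype.ext (T_moebius g.2 τ).symm

/-- Complex conjugation on `HΓ₀(2) / {±1, ±ω, ±ω²}`: this is conjugation by `T`. -/
def barPHG02 : MulAut PHG02 :=
  QuotientGroup.congr _ _ barAut (by
    ext g
    rw [Subgroup.mem_map]
    constructor
    · rintro ⟨h, hh, rfl⟩
      exact bar_mem_mu6 hh
    · intro hg
      exact ⟨barAut g, bar_mem_mu6 hg, Subtype.ext (bar_bar g.1)⟩)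

theorem barPHG02_mul_self : barPHG02 * barPHG02 = 1 := by
  ext1 x
  obtain ⟨g, rfl⟩ := QuotientGroup.mk_surjective x
  exact congrArg QuotientGroup.mk (Subtype.ext (bar_bar g.1))

/-- `HΓ₀(2) / {±1, ±ω, ±ω²} ⋊ ⟨T⟩`. -/
abbrev PHG02T : Type := SemiC2 barPHG02 barPHG02_mul_self

/-- The action of `HΓ₀(2) / {±1, ±ω, ±ω²} ⋊ ⟨T⟩` on the Hermitian upper half space. -/
def actPHG02T : PHG02T →* Equiv.Perm H2 :=
  liftC2 _ _ actPHG02 T T_mul_T (by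
    intro x
    obtain ⟨g, rfl⟩ := QuotientGroup.mk_surjective x
    exact T_actHG02 g)

/-- The matrix `W = [0 -I; 2I 0]` as an element of `GL₄(ℂ)`. -/
def W : GL4 where
  val := Matrix.fromBlocks 0 (-1) ((2 : ℂ) • 1) 0
  inv := Matrix.fromBlocks 0 ((1 / 2 : ℂ) • 1) (-1) 0
  val_inv := by
    rw [Matrix.fromBlocks_multiply, ← Matrix.fromBlocks_one]
    simp [smul_smul]
  inv_val := by
    rw [Matrix.fromBlocks_multiply, ← Matrix.fromBlocks_one]
    simp [smul_smul]

theorem W_val : W.1 = Matrix.fromBlocks 0 (-1) ((2 : ℂ) • 1) 0 := rfl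

theorem W_inv_val : (W⁻¹).1 = Matrix.fromBlocks 0 ((1 / 2 : ℂ) • 1) (-1) 0 := rfl

theorem W_mem : W ∈ GU := by
  refine ⟨2, two_pos, ?_⟩
  rw [W_val, J, Matrix.fromBlocks_conjTranspose, Matrix.fromBlocks_multiply,
    Matrix.fromBlocks_multiply, Matrix.fromBlocks_smul, Matrix.fromBlocks_inj]
  simp

theorem W_mul_W : W * W = Matrix.GeneralLinearGroup.scalar _ (Units.mk0 (-2 : ℂ) (by norm_num)) := by
  apply Units.ext
  rw [Units.val_mul, W_val, Matrix.fromBlocks_multiply, Matrix.GeneralLinearGroup.coe_scalar]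
  ext i j
  rcases i with i | i <;> rcases j with j | j <;>
    simp [Matrix.scalar_apply, Matrix.diagonal_apply, Matrix.one_apply] <;> split_ifs <;> simp

/-- The involution `W : τ ↦ -(1/2)τ⁻¹` of the Hermitian upper half space. -/
def Wperm : Equiv.Perm H2 := actGU ⟨W, W_mem⟩

theorem Wperm_mul_self : Wperm * Wperm = 1 := by
  rw [Wperm, ← map_mul]
  ext1 τ
  apply Subtype.ext
  rw [actGU_apply]
  change moebius (W * W).1 τ.1 = τ.1
  rw [W_mul_W, Matrix.GeneralLinearGroup.coe_scalar]
  exact moebius_scalar _ (by norm_num) _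

theorem Wperm_apply (τ : H2) : (Wperm τ).1 = (-(1 / 2) : ℂ) • τ.1⁻¹ := by
  change moebius W.1 τ.1 = _
  have hu := denom_isUnit W_mem τ.2
  simp only [moebius, W_val, Matrix.toBlocks_fromBlocks₁₁, Matrix.toBlocks_fromBlocks₁₂,
    Matrix.toBlocks_fromBlocks₂₁, Matrix.toBlocks_fromBlocks₂₂, zero_mul, zero_add, add_zero,
    Matrix.smul_mul, one_mul] at hu ⊢
  have hd : IsUnit τ.1.det := by
    have := (Matrix.isUnit_iff_isUnit_det _).mp hu
    rw [Matrix.det_smul] at this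
    exact isUnit_of_mul_isUnit_right this
  have : ((2 : ℂ) • τ.1)⁻¹ = (1 / 2 : ℂ) • τ.1⁻¹ := by
    apply Matrix.inv_eq_left_inv
    rw [Matrix.smul_mul, Matrix.mul_smul, Matrix.nonsing_inv_mul _ hd, smul_smul]
    norm_num
  rw [this]
  simp

theorem W_conj_val (g : GL4) : (W * g * W⁻¹).1 = Matrix.fromBlocks g.1.toBlocks₂₂
    ((-(1 / 2) : ℂ) • g.1.toBlocks₂₁) ((-2 : ℂ) • g.1.toBlocks₁₂) g.1.toBlocks₁₁ := by
  rw [Units.val_mul, Units.val_mul, W_val, W_inv_val]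
  conv_lhs => rw [← Matrix.fromBlocks_toBlocks g.1]
  rw [Matrix.fromBlocks_multiply, Matrix.fromBlocks_multiply, Matrix.fromBlocks_inj]
  simp [smul_smul]

theorem W_conj_entries {g : GL4} (hg : g ∈ HG02) (i j) : (W * g * W⁻¹).1 i j ∈ Eis := by
  rw [W_conj_val]
  rcases i with i | i <;> rcases j with j | j
  · exact (hg.1.1 _ _).1
  · obtain ⟨c, hc, ec⟩ := hg.2 i j
    have : (Matrix.fromBlocks g.1.toBlocks₂₂ ((-(1 / 2) : ℂ) • g.1.toBlocks₂₁)
        ((-2 : ℂ) • g.1.toBlocks₁₂) g.1.toBlocks₁₁) (.inl i) (.inr j) = -c := by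
      simp [Matrix.toBlocks₂₁, ec]
    rw [this]
    exact neg_mem hc
  · have : (Matrix.fromBlocks g.1.toBlocks₂₂ ((-(1 / 2) : ℂ) • g.1.toBlocks₂₁)
        ((-2 : ℂ) • g.1.toBlocks₁₂) g.1.toBlocks₁₁) (.inr i) (.inl j)
        = -(g.1 (.inl i) (.inr j) + g.1 (.inl i) (.inr j)) := by
      simp [Matrix.toBlocks₁₂]; ring
    rw [this]
    exact neg_mem (add_mem (hg.1.1 _ _).1 (hg.1.1 _ _).1)
  · exact (hg.1.1 _ _).1

theorem W_conj_mem {g : GL4} (hg : g ∈ HG02) : W * g * W⁻¹ ∈ HG02 := by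
  refine ⟨⟨fun i j => ⟨W_conj_entries hg i j, ?_⟩, ?_⟩, fun i j => ?_⟩
  · have : (W * g * W⁻¹)⁻¹ = W * g⁻¹ * W⁻¹ := by group
    rw [this]
    exact W_conj_entries (inv_mem hg) i j
  · have key := hg.1.2
    rw [W_conj_val]
    generalize g.1 = g at *
    obtain ⟨A, B, C, D, rfl⟩ : ∃ A B C D, g = Matrix.fromBlocks A B C D :=
      ⟨_, _, _, _, g.fromBlocks_toBlocks.symm⟩
    simp only [J, Matrix.fromBlocks_conjTranspose, Matrix.fromBlocks_multiply,
      Matrix.toBlocks_fromBlocks₁₁, Matrix.toBlocks_fromBlocks₁₂, Matrix.toBlocks_fromBlocks₂₁,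
      Matrix.toBlocks_fromBlocks₂₂,
      Matrix.fromBlocks_inj, mul_zero, mul_one, mul_neg, zero_add, add_zero] at key ⊢
    obtain ⟨h1, h2, h3, h4⟩ := key
    refine ⟨?_, ?_, ?_, ?_⟩
    · rw [Matrix.conjTranspose_smul, neg_mul, Matrix.smul_mul, Matrix.mul_smul]
      rw [neg_mul, neg_add_eq_zero] at h4
      rw [h4]
      simp
    · rw [Matrix.conjTranspose_smul]
      rw [← neg_eq_iff_eq_neg.mpr h3]
      simp only [neg_mul, Matrix.smul_mul, Matrix.mul_smul, smul_smul]
      simp [add_comm]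
    · rw [Matrix.conjTranspose_smul]
      rw [← h2]
      simp only [neg_mul, Matrix.smul_mul, Matrix.mul_smul, smul_smul]
      simp [add_comm]
    · rw [Matrix.conjTranspose_smul, Matrix.smul_mul, neg_mul, Matrix.mul_smul]
      rw [neg_mul, neg_add_eq_zero] at h1
      rw [h1]
      simp
  · refine ⟨-g.1 (.inl i) (.inr j), neg_mem (hg.1.1 _ _).1, ?_⟩
    rw [W_conj_val]
    simp [Matrix.toBlocks₁₂]

theorem W_conj_conj (g : GL4) : W * (W * g * W⁻¹) * W⁻¹ = g := by
  have : W * (W * g * W⁻¹) * W⁻¹ = (W * W) * g * (W * W)⁻¹ := by group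
  rw [this, W_mul_W, Matrix.GeneralLinearGroup.scalar_commute, mul_inv_cancel_right]

/-- Conjugation by `W` as an automorphism of `HΓ₀(2)`. -/
def conjW : MulAut HG02 where
  toFun g := ⟨W * g.1 * W⁻¹, W_conj_mem g.2⟩
  invFun g := ⟨W * g.1 * W⁻¹, W_conj_mem g.2⟩
  left_inv g := Subtype.ext (W_conj_conj g.1)
  right_inv g := Subtype.ext (W_conj_conj g.1)
  map_mul' g h := Subtype.ext (by
    change W * (g.1 * h.1) * W⁻¹ = (W * g.1 * W⁻¹) * (W * h.1 * W⁻¹)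
    group)

theorem conjW_mul_self : conjW * conjW = 1 := by
  ext1 g
  exact Subtype.ext (W_conj_conj g.1)

/-- The group `HΓ₀*(2) = HΓ₀(2) ⋊ ⟨W⟩`, where the involution `W` acts by conjugation with the
matrix `W` (whose square is scalar). -/
abbrev HG02star : Type := SemiC2 conjW conjW_mul_self

theorem W_actHG02 (g : HG02) : actHG02 (conjW g) = Wperm * actHG02 g * Wperm⁻¹ := by
  rw [actHG02, Wperm, MonoidHom.comp_apply, MonoidHom.comp_apply, ← map_mul, ← map_inv, ← map_mul]
  rfl

/-- The action of `HΓ₀*(2)` on the Hermitian upper half space. -/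
def actHG02star : HG02star →* Equiv.Perm H2 :=
  liftC2 _ _ actHG02 Wperm Wperm_mul_self W_actHG02

/-- The subgroup `{±1, ±ω, ±ω²}` of scalar matrices in `HΓ₀(2) ⊆ HΓ₀*(2)`. -/
def mu6star : Subgroup HG02star := (mu6.subgroupOf HG02).map SemidirectProduct.inl

theorem conjW_mu6 {s : HG02} (hs : s ∈ mu6.subgroupOf HG02) : conjW s = s := by
  apply Subtype.ext
  change W * s.1 * W⁻¹ = s.1
  have h : W * s.1 = s.1 * W := mu6_comm hs W
  rw [h, mul_inv_cancel_right]

instance : mu6star.Normal where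
  conj_mem := by
    rintro _ ⟨s, hs, rfl⟩ x
    have hc : (c2Hom conjW conjW_mul_self x.right) s = s := by
      rcases C2_cases x.right with h | h
      · rw [h]; simp
      · rw [h]; exact conjW_mu6 hs
    have hx : x * SemidirectProduct.inl s = SemidirectProduct.inl s * x := by
      ext1
      · simp only [SemidirectProduct.mul_left, SemidirectProduct.left_inl,
          SemidirectProduct.right_inl, map_one, MulAut.one_apply]
        rw [hc]
        exact Subtype.ext (mu6_comm hs x.left.1)
      · simp
    rw [hx, mul_inv_cancel_right]
    exact ⟨s, hs, rfl⟩

/-- `HΓ₀*(2) / {±1, ±ω, ±ω²}`. -/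
abbrev PHG02star : Type := HG02star ⧸ mu6star

/-- The induced action of `HΓ₀*(2) / {±1, ±ω, ±ω²}` on the Hermitian upper half space. -/
def actPHG02star : PHG02star →* Equiv.Perm H2 :=
  QuotientGroup.lift _ actHG02star (by
    rintro _ ⟨s, hs, rfl⟩
    rw [MonoidHom.mem_ker]
    have h : actHG02star (SemidirectProduct.inl s) = actHG02 s := by
      simp [actHG02star, liftC2]
    exact h.trans (mu6_le_ker hs))

theorem bar_W : bar W = W := by
  apply Units.ext
  rw [bar_val, W_val, Matrix.fromBlocks_conjTranspose, Matrix.fromBlocks_transpose]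
  simp

theorem bar_conjW (g : HG02) : barAut (conjW g) = conjW (barAut g) := by
  apply Subtype.ext
  change bar (W * g.1 * W⁻¹) = W * bar g.1 * W⁻¹
  rw [map_mul, map_mul, map_inv, bar_W]

/-- The automorphism of `HΓ₀*(2) = HΓ₀(2) ⋊ ⟨W⟩` given by complex conjugation on `HΓ₀(2)` and
fixing `W`. -/
def barStar : MulAut HG02star :=
  SemidirectProduct.congr barAut (MulEquiv.refl C2) (by
    intro x
    rcases C2_cases x with rfl | rfl
    · ext1 g; simp
    · ext1 g; exact bar_conjW g)

theorem barStar_barStar (x : HG02star) : barStar (barStar x) = x := by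
  ext1
  · exact Subtype.ext (bar_bar x.left.1)
  · rfl

theorem barStar_inl (g : HG02) :
    barStar (SemidirectProduct.inl g) = SemidirectProduct.inl (barAut g) := rfl

/-- The automorphism of `HΓ₀*(2) / {±1, ±ω, ±ω²}` given by complex conjugation on `HΓ₀(2)` and
fixing `W`: this is conjugation by `T`. -/
def barPHG02star : MulAut PHG02star :=
  QuotientGroup.congr _ _ barStar (by
    ext x
    constructor
    · rintro ⟨_, ⟨s, hs, rfl⟩, rfl⟩
      exact ⟨barAut s, bar_mem_mu6 hs, rfl⟩
    · rintro ⟨s, hs, rfl⟩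
      exact ⟨SemidirectProduct.inl (barAut s), ⟨barAut s, bar_mem_mu6 hs, rfl⟩,
        barStar_barStar (SemidirectProduct.inl s)⟩)

theorem barPHG02star_mul_self : barPHG02star * barPHG02star = 1 := by
  ext1 x
  obtain ⟨g, rfl⟩ := QuotientGroup.mk_surjective x
  exact congrArg QuotientGroup.mk (barStar_barStar g)

/-- `HΓ₀*(2) / {±1, ±ω, ±ω²} ⋊ ⟨T⟩`. -/
abbrev PHG02starT : Type := SemiC2 barPHG02star barPHG02star_mul_self

theorem T_Wperm : T * Wperm = Wperm * T := by
  ext1 τ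
  apply Subtype.ext
  change (Wperm τ).1ᵀ = (Wperm (T τ)).1
  rw [Wperm_apply, Wperm_apply, Matrix.transpose_smul, Matrix.transpose_nonsing_inv]
  rfl

theorem T_actHG02star (x : HG02star) : actHG02star (barStar x) = T * actHG02star x * T⁻¹ := by
  have h : ∀ y : HG02star,
      actHG02star y = actHG02 y.left * c2Hom Wperm Wperm_mul_self y.right := fun _ => rfl
  have h2 : T * c2Hom Wperm Wperm_mul_self x.right = c2Hom Wperm Wperm_mul_self x.right * T := by
    rcases C2_cases x.right with h | h
    · rw [h]; simp
    · rw [h]; exact T_Wperm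
  rw [h, h]
  change actHG02 (barAut x.left) * c2Hom Wperm Wperm_mul_self x.right = _
  rw [T_actHG02, eq_mul_inv_iff_mul_eq, mul_assoc, ← h2]
  group

/-- The action of `HΓ₀*(2) / {±1, ±ω, ±ω²} ⋊ ⟨T⟩` on the Hermitian upper half space. -/
def actPHG02starT : PHG02starT →* Equiv.Perm H2 :=
  liftC2 _ _ actPHG02star T T_mul_T (by
    intro x
    obtain ⟨g, rfl⟩ := QuotientGroup.mk_surjective x
    exact T_actHG02star g)

/-! ### The isomorphism `Ψ` between the period domain and the Hermitian upper half space -/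

theorem posDef_fin_two {A : Matrix (Fin 2) (Fin 2) ℂ} (hA : A.IsHermitian) :
    A.PosDef ↔ 0 < (A 0 0).re ∧ 0 < (A 0 0).re * (A 1 1).re - Complex.normSq (A 0 1) := by
  have h00 : (A 0 0).im = 0 := by
    have := congrArg Complex.im (hA.apply 0 0); simp at this; linarith
  have h11 : (A 1 1).im = 0 := by
    have := congrArg Complex.im (hA.apply 1 1); simp at this; linarith
  have h10r : (A 1 0).re = (A 0 1).re := by
    have := congrArg Complex.re (hA.apply 0 1); simpa using this
  have h10i : (A 1 0).im = -(A 0 1).im := by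
    have := congrArg Complex.im (hA.apply 0 1); simp at this; linarith
  constructor
  · intro h
    have d := h.det_pos
    rw [Matrix.det_fin_two] at d
    have d' := (Complex.lt_def.mp d).1
    have e := (Complex.lt_def.mp (h.diag_pos (i := 0))).1
    simp [h00, h11, h10r, h10i] at d' e
    refine ⟨e, ?_⟩
    rw [Complex.normSq_apply]
    linarith
  · rintro ⟨h1, h2⟩
    refine Matrix.PosDef.of_dotProduct_mulVec_pos hA fun x hx => ?_
    rw [Complex.lt_def]
    rw [Complex.normSq_apply] at h2
    simp only [dotProduct, Matrix.mulVec, Fin.sum_univ_two, Pi.star_apply]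
    simp [h00, h11, h10r, h10i]
    set a := (A 0 0).re
    set d := (A 1 1).re
    set b := (A 0 1).re
    set c := (A 0 1).im
    constructor
    · have hx' : 0 < (x 0).re ^ 2 + (x 0).im ^ 2 + (x 1).re ^ 2 + (x 1).im ^ 2 := by
        by_contra hcon
        apply hx
        have k0 := sq_nonneg (x 0).re
        have k1 := sq_nonneg (x 0).im
        have k2 := sq_nonneg (x 1).re
        have k3 := sq_nonneg (x 1).im
        have l0 : (x 0).re = 0 := by nlinarith
        have l1 : (x 0).im = 0 := by nlinarith
        have l2 : (x 1).re = 0 := by nlinarith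
        have l3 : (x 1).im = 0 := by nlinarith
        ext i
        fin_cases i
        · exact Complex.ext l0 l1
        · exact Complex.ext l2 l3
      set p := (x 0).re
      set q := (x 0).im
      set u := (x 1).re
      set v := (x 1).im
      refine pos_of_mul_pos_right (a := a) ?_ h1.le
      have key : ∀ E : ℝ, a * E = (a * p + b * u - c * v) ^ 2 + (a * q + b * v + c * u) ^ 2
          + (a * d - (b * b + c * c)) * (u ^ 2 + v ^ 2) → 0 < a * E := by
        intro E hE
        rw [hE]
        by_cases huv : u ^ 2 + v ^ 2 = 0
        · have hu : u = 0 := by nlinarith [sq_nonneg u, sq_nonneg v]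
          have hv : v = 0 := by nlinarith [sq_nonneg u, sq_nonneg v]
          rw [hu, hv] at hx' ⊢
          have : 0 < a ^ 2 * (p ^ 2 + q ^ 2) := by
            apply mul_pos (by positivity)
            linarith
          linarith
        · have : 0 < u ^ 2 + v ^ 2 := lt_of_le_of_ne (by positivity) (Ne.symm huv)
          positivity
      apply key
      ring
    · ring

/-- The defining conditions of `D_M⁺` on a representative vector. -/
def InD (v : Fin 6 → ℂ) : Prop :=
  v ⬝ᵥ QC *ᵥ v = 0 ∧ 0 < (v ⬝ᵥ QC *ᵥ star v).re ∧ 0 < (v 2 / v 0).im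

theorem InD_smul {v : Fin 6 → ℂ} (h : InD v) {a : ℂ} (ha : a ≠ 0) : InD (a • v) := by
  obtain ⟨h1, h2, h3⟩ := h
  refine ⟨?_, ?_, ?_⟩
  · rw [Matrix.mulVec_smul, smul_dotProduct, dotProduct_smul, h1]; simp
  · rw [star_smul, Matrix.mulVec_smul, smul_dotProduct, dotProduct_smul, smul_eq_mul, smul_eq_mul,
      ← mul_assoc]
    have : a * star a = ((Complex.normSq a : ℝ) : ℂ) := Complex.mul_conj a
    rw [this, Complex.re_ofReal_mul]
    exact mul_pos (Complex.normSq_pos.mpr ha) h2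
  · simp only [Pi.smul_apply, smul_eq_mul]
    rwa [mul_div_mul_left _ _ ha]

theorem mem_DMplus_iff (z : PM) : z ∈ DMplus ↔ InD z.rep := by
  simp only [DMplus, DM, InD, Set.mem_ofPred_eq, and_assoc]

theorem exists_rep_mk (v : Fin 6 → ℂ) (hv : v ≠ 0) :
    ∃ a : ℂ, a ≠ 0 ∧ (Projectivization.mk ℂ v hv).rep = a • v := by
  obtain ⟨a, ha⟩ := Projectivization.exists_smul_eq_mk_rep ℂ v hv
  exact ⟨a.1, a.ne_zero, ha.symm⟩

theorem mk_mem_DMplus (v : Fin 6 → ℂ) (hv : v ≠ 0) (h : InD v) :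
    Projectivization.mk ℂ v hv ∈ DMplus := by
  obtain ⟨a, ha, e⟩ := exists_rep_mk v hv
  rw [mem_DMplus_iff, e]
  exact InD_smul h ha

theorem InD.ne_zero {v : Fin 6 → ℂ} (h : InD v) : v 0 ≠ 0 := by
  intro h0
  have := h.2.2
  rw [h0] at this
  simp at this

/-- The matrix `[z₃, z₅ + ω z₆; z₅ + ω² z₆, z₄]` of the point `[v] = [1 : z₂ : ⋯ : z₆]`. -/
def psiMat (v : Fin 6 → ℂ) : Matrix (Fin 2) (Fin 2) ℂ :=
  !![v 2 / v 0, v 4 / v 0 + ω * (v 5 / v 0); v 4 / v 0 + ω ^ 2 * (v 5 / v 0), v 3 / v 0]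

theorem psiMat_smul (v : Fin 6 → ℂ) {a : ℂ} (ha : a ≠ 0) : psiMat (a • v) = psiMat v := by
  simp only [psiMat, Pi.smul_apply, smul_eq_mul, mul_div_mul_left _ _ ha]

theorem imPart_isHermitian (τ : Matrix (Fin 2) (Fin 2) ℂ) :
    ((1 / (2 * Complex.I)) • (τ - τᴴ)).IsHermitian := by
  rw [Matrix.IsHermitian, Matrix.conjTranspose_smul, Matrix.conjTranspose_sub,
    Matrix.conjTranspose_conjTranspose, ← neg_sub τ, smul_neg, ← neg_smul]
  congr 1
  simp

/-- The vector `(1, z₂, ⋯, z₆)` with `z₂ = -2 det` of the matrix. -/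
def vec (x y z w : ℂ) : Fin 6 → ℂ := ![1, -2 * (x * y - z ^ 2 + z * w - w ^ 2), x, y, z, w]

theorem mem_H2_iff (x y z w : ℂ) :
    !![x, z + ω * w; z + ω ^ 2 * w, y] ∈ H2 ↔
      0 < x.im ∧ 0 < x.im * y.im - z.im ^ 2 + z.im * w.im - w.im ^ 2 := by
  change Matrix.PosDef _ ↔ _
  rw [posDef_fin_two (imPart_isHermitian _)]
  have hI : (1 / (2 * Complex.I) : ℂ) = -(1 / 2 : ℝ) * Complex.I := by
    rw [div_eq_iff (by simp)]
    push_cast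
    linear_combination (1 : ℂ) * Complex.I_mul_I
  have e : ω ^ 2 = -1 - ω := by linear_combination ω_quad
  rw [hI, e]
  have h3 := sq_sqrt_three
  simp [Complex.normSq_apply, ω_re, ω_im]
  ring_nf
  rw [show √3 ^ 2 = 3 by rw [pow_two, h3]]
  ring_nf
  intro _
  constructor <;> intro h <;> linarith

theorem InD_vec_iff (x y z w : ℂ) : InD (vec x y z w) ↔
      0 < x.im ∧ 0 < x.im * y.im - z.im ^ 2 + z.im * w.im - w.im ^ 2 := by
  have e1 : vec x y z w ⬝ᵥ QC *ᵥ vec x y z w = 0 := by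
    simp [QC, Q, vec, dotProduct, Matrix.mulVec, Fin.sum_univ_six]
    ring
  have e2 : (vec x y z w ⬝ᵥ QC *ᵥ star (vec x y z w)).re
      = 8 * (x.im * y.im - z.im ^ 2 + z.im * w.im - w.im ^ 2) := by
    simp [QC, Q, vec, dotProduct, Matrix.mulVec, Fin.sum_univ_six, pow_two]
    ring
  rw [InD, e1, e2]
  simp [vec, and_comm]

theorem InD.eq_smul_vec {v : Fin 6 → ℂ} (h : InD v) :
    v = v 0 • vec (v 2 / v 0) (v 3 / v 0) (v 4 / v 0) (v 5 / v 0) := by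
  have h0 := h.ne_zero
  have h1 := h.1
  simp [QC, Q, dotProduct, Matrix.mulVec, Fin.sum_univ_six] at h1
  ext i
  fin_cases i
  · simp [vec]
  · simp [vec]
    field_simp
    linear_combination (1 / 2 : ℂ) * h1
  all_goals simp [vec]; field_simp

theorem psiMat_mem {v : Fin 6 → ℂ} (h : InD v) : psiMat v ∈ H2 := by
  have h' := InD_smul h (inv_ne_zero h.ne_zero)
  rw [h.eq_smul_vec, smul_smul] at h'
  simp only [Pi.smul_apply, smul_eq_mul] at h'
  have e : (v 0 * vec (v 2 / v 0) (v 3 / v 0) (v 4 / v 0) (v 5 / v 0) 0) = v 0 := by simp [vec]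
  rw [e, inv_mul_cancel₀ h.ne_zero, one_smul, InD_vec_iff] at h'
  exact (mem_H2_iff _ _ _ _).mpr h'

theorem vec_ne_zero (x y z w : ℂ) : vec x y z w ≠ 0 := fun h => by
  have := congrFun h 0
  simp [vec] at this

theorem ω_sub_ne : ω - ω ^ 2 ≠ 0 := by
  intro h
  have := congrArg Complex.im h
  simp [pow_two, ω_re, ω_im] at this
  have h3 : (0 : ℝ) < √3 := by positivity
  linarith

/-- The coordinate `z₆` of a matrix in the Hermitian upper half space. -/
def coord6 (τ : Matrix (Fin 2) (Fin 2) ℂ) : ℂ := (τ 0 1 - τ 1 0) / (ω - ω ^ 2)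

theorem matrix_eq (τ : Matrix (Fin 2) (Fin 2) ℂ) :
    τ = !![τ 0 0, (τ 0 1 - ω * coord6 τ) + ω * coord6 τ;
      (τ 0 1 - ω * coord6 τ) + ω ^ 2 * coord6 τ, τ 1 1] := by
  have h := ω_sub_ne
  ext i j
  have hc : coord6 τ * (ω - ω ^ 2) = τ 0 1 - τ 1 0 := div_mul_cancel₀ _ h
  fin_cases i <;> fin_cases j <;> simp
  linear_combination hc

/-- The isomorphism `Ψ : D_M⁺ → ℍ₂`,
`[1 : z₂ : ⋯ : z₆] ↦ [z₃, z₅ + ω z₆; z₅ + ω² z₆, z₄]`. -/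
def Psi : DMplus ≃ H2 where
  toFun z := ⟨psiMat z.1.rep, psiMat_mem ((mem_DMplus_iff z.1).mp z.2)⟩
  invFun τ := ⟨.mk ℂ (vec (τ.1 0 0) (τ.1 1 1) (τ.1 0 1 - ω * coord6 τ.1) (coord6 τ.1))
      (vec_ne_zero _ _ _ _), mk_mem_DMplus _ _ (by
        rw [InD_vec_iff, ← mem_H2_iff, ← matrix_eq]
        exact τ.2)⟩
  left_inv z := by
    apply Subtype.ext
    have h := (mem_DMplus_iff z.1).mp z.2
    have h0 := h.ne_zero
    have hω := ω_sub_ne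
    have hc : coord6 (psiMat z.1.rep) = z.1.rep 5 / z.1.rep 0 := by
      simp only [coord6, psiMat, Matrix.of_apply, Matrix.cons_val', Matrix.cons_val_zero,
        Matrix.cons_val_one, Matrix.cons_val_fin_one]
      rw [div_eq_iff hω]
      ring
    change Projectivization.mk ℂ _ _ = z.1
    conv_rhs => rw [← z.1.mk_rep]
    rw [Projectivization.mk_eq_mk_iff']
    refine ⟨(z.1.rep 0)⁻¹, ?_⟩
    simp only
    rw [hc]
    have hv : (z.1.rep 0)⁻¹ • z.1.rep = vec (z.1.rep 2 / z.1.rep 0) (z.1.rep 3 / z.1.rep 0)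
        (z.1.rep 4 / z.1.rep 0) (z.1.rep 5 / z.1.rep 0) := by
      rw [inv_smul_eq_iff₀ h0]
      exact h.eq_smul_vec
    rw [hv]
    simp [psiMat]
  right_inv τ := by
    apply Subtype.ext
    obtain ⟨a, ha, e⟩ := exists_rep_mk
      (vec (τ.1 0 0) (τ.1 1 1) (τ.1 0 1 - ω * coord6 τ.1) (coord6 τ.1)) (vec_ne_zero _ _ _ _)
    change psiMat (Projectivization.mk ℂ _ _).rep = τ.1
    rw [e, psiMat_smul _ ha]
    conv_rhs => rw [matrix_eq τ.1]
    simp [psiMat, vec]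

/-- Let a group `G` act on a set `D` by `ρ`, a group `H` act on a set `X` by `σ`, and let
`Ψ : D ≃ X`. Then `G` and `H` are *isomorphic as groups of automorphisms of `D ≅ X`* if both
actions are faithful and there is an isomorphism `φ : G ≅ H` with `Ψ(g · z) = φ(g) · Ψ(z)`. -/
def IsomorphicAsAutomorphisms {G H D X : Type*} [Group G] [Group H] (Ψ : D ≃ X)
    (ρ : G →* Equiv.Perm D) (σ : H →* Equiv.Perm X) : Prop :=
  Function.Injective ρ ∧ Function.Injective σ ∧
    ∃ φ : G ≃* H, ∀ (g : G) (z : D), Ψ (ρ g z) = σ (φ g) (Ψ z)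

end HessianK3

end

noncomputable section

namespace HessianK3

/-! ### Eisenstein integers -/

/-! The theorem is an integral form of the exceptional isogeny from SU(2,2) to SO(2,4). A matrix h
in GL₄ acts on the six-dimensional space of alternating 4 × 4 matrices by X ↦ h X ᵗh and multiplies
the Pfaffian by det h (`pf_congrCoord`). Complex conjugation, combined with J and the duality of
alternating matrices, is a real structure, and a J-unitary h commutes with it up to a determinant
(`conjCoord_congrCoord`). Hence an element of HΓ of determinant 1 acts on the real points with
Eisenstein coordinates, which form the lattice L = U ⊕ U ⊕ A₂ with quadratic form `qL`. The 4 × 2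
matrix (τ; 1) has Plücker vector `vecL τ`, and h(τ; 1) = (hτ; 1)(Cτ + D), so the linear action
covers the fractional linear one (`congrCoord_vecL`). Determinants in HΓ are cube roots of unity
(`HG_det`), and the scalar ω has determinant ω, so determinant 1 can be arranged without changing
the action.

Conversely, an isometry of L which preserves the half space comes from HΓ, possibly after
composition with the transposition (`mem_realised_or`). Translations, the inversion and certain maps
τ ↦ UτU* come from HΓ. With these, the Euclidean algorithm in ℤ and ℤ[ω] moves every isotropic
vector to a multiple of one basis vector. So the basis vectors can be fixed one after another, until
only the identity and the transposition remain.

To pass to M, `dM` embeds L, with its form doubled, as the sublattice of vectors with even second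
coordinate. Modulo 2, the upper left block of an isometry of M preserves the form xy on 𝔽₂², so it
is the identity or the swap. In the first case the isometry restricts to L, and the parity of its
first row says, through 2 × 2 minors, that C ≡ 0 mod 2 (`mem_HG02_of_row`); conversely elements of
HΓ₀(2) give isometries which extend to M (`HG02_realised`). The swap is represented by `invGL`,
which induces W; `transpGL` has determinant -1 and induces T.

Thus in each of the four cases both groups have the same image in the permutations of the half
space. Only ±1, respectively the sixth roots of unity, act trivially, and W and T lie outside the
images which they extend. Two faithful actions with the same image are isomorphic. -/

theorem ω_sq : ω ^ 2 = -1 - ω := by linear_combination ω_quad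

theorem mem_Eis_iff {x : ℂ} : x ∈ Eis ↔ ∃ a b : ℤ, x = a + b * ω := by
  constructor
  · intro hx
    induction hx using Subring.closure_induction with
    | mem x hx => exact ⟨0, 1, by rw [Set.mem_singleton_iff.mp hx]; simp⟩
    | zero => exact ⟨0, 0, by simp⟩
    | one => exact ⟨1, 0, by simp⟩
    | add x y _ _ hx hy =>
      obtain ⟨a, b, rfl⟩ := hx
      obtain ⟨c, d, rfl⟩ := hy
      exact ⟨a + c, b + d, by push_cast; ring⟩
    | neg x _ hx =>
      obtain ⟨a, b, rfl⟩ := hx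
      exact ⟨-a, -b, by push_cast; ring⟩
    | mul x y _ _ hx hy =>
      obtain ⟨a, b, rfl⟩ := hx
      obtain ⟨c, d, rfl⟩ := hy
      refine ⟨a * c - b * d, a * d + b * c - b * d, ?_⟩
      push_cast
      linear_combination (b * d : ℂ) * ω_quad
  · rintro ⟨a, b, rfl⟩
    exact add_mem (intCast_mem _ _) (mul_mem (intCast_mem _ _) ω_mem_Eis)

theorem intCast_mem_Eis (a : ℤ) : (a : ℂ) ∈ Eis := intCast_mem _ _

theorem Eis_ext {a b c d : ℤ} : (a + b * ω : ℂ) = c + d * ω ↔ a = c ∧ b = d := by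
  constructor
  · intro h
    have h3 : √3 ≠ 0 := by positivity
    have h1 := congrArg Complex.im h
    have h2 := congrArg Complex.re h
    simp [ω_re, ω_im, h3] at h1 h2
    subst h1
    simp at h2
    exact ⟨h2, rfl⟩
  · rintro ⟨rfl, rfl⟩; rfl

theorem star_Eis (a b : ℤ) : star (a + b * ω : ℂ) = ((a - b : ℤ) : ℂ) + ((-b : ℤ) : ℂ) * ω := by
  rw [star_add, star_mul, star_ω]
  simp
  linear_combination (b : ℂ) * ω_quad

theorem exists_int_of_star_eq {x : ℂ} (hx : x ∈ Eis) (h : star x = x) : ∃ a : ℤ, x = a := by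
  obtain ⟨a, b, rfl⟩ := mem_Eis_iff.mp hx
  rw [star_Eis, Eis_ext] at h
  have : b = 0 := by omega
  exact ⟨a, by simp [this]⟩

/-- Here `1 + 2 * ω` is √-3, the generator of the purely imaginary Eisenstein integers. -/
theorem exists_int_of_star_eq_neg {x : ℂ} (hx : x ∈ Eis) (h : star x = -x) :
    ∃ a : ℤ, x = a * (1 + 2 * ω) := by
  obtain ⟨a, b, rfl⟩ := mem_Eis_iff.mp hx
  have e : -(a + b * ω : ℂ) = ((-a : ℤ) : ℂ) + ((-b : ℤ) : ℂ) * ω := by push_cast; ring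
  rw [star_Eis, e, Eis_ext] at h
  have : b = 2 * a := by omega
  exact ⟨a, by rw [this]; push_cast; ring⟩

theorem norm_Eis (a b : ℤ) :
    (a + b * ω : ℂ) * star (a + b * ω : ℂ) = ((a ^ 2 - a * b + b ^ 2 : ℤ) : ℂ) := by
  rw [star_Eis]
  push_cast
  linear_combination (-b ^ 2 : ℂ) * ω_quad

theorem int_norm_eq_one {a b : ℤ} (h : a ^ 2 - a * b + b ^ 2 = 1) :
    (a = 1 ∧ b = 0) ∨ (a = 1 ∧ b = 1) ∨ (a = 0 ∧ b = 1) ∨ (a = -1 ∧ b = 0) ∨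
      (a = -1 ∧ b = -1) ∨ (a = 0 ∧ b = -1) := by
  -- Since 4(a² - ab + b²) = (a - 2b)² + 3a², norm one forces 3a² ≤ 4; the same holds for b.
  have h1 : -1 ≤ a := by nlinarith [sq_nonneg (a - 2 * b)]
  have h2 : a ≤ 1 := by nlinarith [sq_nonneg (a - 2 * b)]
  have h3 : -1 ≤ b := by nlinarith [sq_nonneg (b - 2 * a)]
  have h4 : b ≤ 1 := by nlinarith [sq_nonneg (b - 2 * a)]
  interval_cases a <;> interval_cases b <;> simp_all

theorem unit_Eis {x : ℂ} (hx : x ∈ Eis) (h : x * star x = 1) :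
    ∃ s k : ℂ, (s = 1 ∨ s = -1) ∧ (k = 1 ∨ k = ω ∨ k = ω ^ 2) ∧ x = s * k := by
  obtain ⟨a, b, rfl⟩ := mem_Eis_iff.mp hx
  rw [norm_Eis] at h
  have h' : a ^ 2 - a * b + b ^ 2 = 1 := by exact_mod_cast h
  rcases int_norm_eq_one h' with ⟨rfl, rfl⟩ | ⟨rfl, rfl⟩ | ⟨rfl, rfl⟩ | ⟨rfl, rfl⟩ | ⟨rfl, rfl⟩ |
    ⟨rfl, rfl⟩
  · exact ⟨1, 1, by simp⟩
  · exact ⟨-1, ω ^ 2, by simp, by simp, by rw [ω_sq]; push_cast; ring⟩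
  · exact ⟨1, ω, by simp⟩
  · exact ⟨-1, 1, by simp⟩
  · exact ⟨1, ω ^ 2, by simp, by simp, by rw [ω_sq]; push_cast; ring⟩
  · exact ⟨-1, ω, by simp⟩

theorem pow_six_of_unit {x : ℂ} (hx : x ∈ Eis) (h : x * star x = 1) : x ^ 6 = 1 := by
  obtain ⟨s, k, hs, hk, rfl⟩ := unit_Eis hx h
  have hs6 : s ^ 6 = 1 := by rcases hs with rfl | rfl <;> norm_num
  have hk6 : k ^ 6 = 1 := by
    rcases hk with rfl | rfl | rfl
    · simp
    · rw [show 6 = 3 * 2 by norm_num, pow_mul, ω_pow_three, one_pow]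
    · rw [← pow_mul, show 2 * 6 = 3 * 4 by norm_num, pow_mul, ω_pow_three, one_pow]
  rw [mul_pow, hs6, hk6, one_mul]

theorem int_dvd_of_Eis {a n : ℤ} {c : ℂ} (hc : c ∈ Eis) (h : (a : ℂ) = n * c) : n ∣ a := by
  obtain ⟨x, y, rfl⟩ := mem_Eis_iff.mp hc
  have e : ((a : ℤ) : ℂ) + ((0 : ℤ) : ℂ) * ω = ((n * x : ℤ) : ℂ) + ((n * y : ℤ) : ℂ) * ω := by
    push_cast; rw [h]; ring
  exact ⟨x, (Eis_ext.mp e).1⟩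

/-! ### Alternating `4 × 4` matrices -/

/-- The alternating matrix with blocks `-p₁ E`, `S E`, `E ᵗS`, `p₀ E`, where
`S = [p₂ p₄; p₅ p₃]` and `E = [0 1; -1 0]`. -/
def skew (p : Fin 6 → ℂ) : Mat4 :=
  Matrix.fromBlocks !![0, -p 1; p 1, 0] !![-p 4, p 2; -p 3, p 5] !![p 4, p 3; -p 2, -p 5]
    !![0, p 0; -p 0, 0]

/-- The coordinates of an alternating matrix. -/
def skewCoord (M : Mat4) : Fin 6 → ℂ :=
  ![M (.inr 0) (.inr 1), -M (.inl 0) (.inl 1), M (.inl 0) (.inr 1), -M (.inl 1) (.inr 0),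
    -M (.inl 0) (.inr 0), M (.inl 1) (.inr 1)]

theorem skewCoord_skew (p : Fin 6 → ℂ) : skewCoord (skew p) = p := by
  ext i
  fin_cases i <;> simp [skewCoord, skew]

theorem skew_injective : Function.Injective skew := Function.LeftInverse.injective skewCoord_skew

theorem skew_skewCoord {M : Mat4} (h : Mᵀ = -M) : skew (skewCoord M) = M := by
  have e : ∀ i j, M j i = -M i j := fun i j => congrFun (congrFun h i) j
  have d : ∀ i, M i i = 0 := fun i => self_eq_neg.mp (e i i)
  ext i j
  rcases i with i | i <;> rcases j with j | j <;> fin_cases i <;> fin_cases j <;>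
    simp [skew, skewCoord, d, e (.inl 0) (.inl 1), e (.inr 0) (.inr 1), e (.inl 0) (.inr 0),
      e (.inl 0) (.inr 1), e (.inl 1) (.inr 0), e (.inl 1) (.inr 1)]

theorem skew_transpose (p : Fin 6 → ℂ) : (skew p)ᵀ = -skew p := by
  ext i j
  rcases i with i | i <;> rcases j with j | j <;> fin_cases i <;> fin_cases j <;> simp [skew]

theorem skew_add (p r : Fin 6 → ℂ) : skew (p + r) = skew p + skew r := by
  ext i j
  rcases i with i | i <;> rcases j with j | j <;> fin_cases i <;> fin_cases j <;>
    simp [skew] <;> ring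

theorem skew_smul (c : ℂ) (p : Fin 6 → ℂ) : skew (c • p) = c • skew p := by
  ext i j
  rcases i with i | i <;> rcases j with j | j <;> fin_cases i <;> fin_cases j <;> simp [skew]

/-- The coordinates of the dual of an alternating matrix. -/
def dualCoord (p : Fin 6 → ℂ) : Fin 6 → ℂ := ![-p 1, -p 0, -p 3, -p 2, p 5, p 4]

/-- The negative of the Pfaffian of `skew p`. -/
def pf (p : Fin 6 → ℂ) : ℂ := p 0 * p 1 + p 2 * p 3 - p 4 * p 5

/-- This is the Pfaffian analogue of the adjugate identity. -/
theorem skew_mul_dual (p : Fin 6 → ℂ) : skew p * skew (dualCoord p) = pf p • 1 := by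
  rw [← Matrix.fromBlocks_one, Matrix.fromBlocks_smul, skew, skew, Matrix.fromBlocks_multiply,
    Matrix.fromBlocks_inj]
  refine ⟨?_, ?_, ?_, ?_⟩ <;> ext i j <;> fin_cases i <;> fin_cases j <;>
    simp [dualCoord, pf] <;> ring

theorem congr_transpose (h : Mat4) (p : Fin 6 → ℂ) :
    (h * skew p * hᵀ)ᵀ = -(h * skew p * hᵀ) := by
  rw [Matrix.transpose_mul, Matrix.transpose_mul, Matrix.transpose_transpose, skew_transpose]
  simp [Matrix.mul_assoc]

/-- The action of a `4 × 4` matrix on coordinates of alternating matrices. -/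
def congrCoord (h : Mat4) (p : Fin 6 → ℂ) : Fin 6 → ℂ := skewCoord (h * skew p * hᵀ)

theorem skew_congrCoord (h : Mat4) (p : Fin 6 → ℂ) :
    skew (congrCoord h p) = h * skew p * hᵀ := skew_skewCoord (congr_transpose h p)

theorem det_four (M : Mat4) : M.det =
    Matrix.det !![M (.inl 0) (.inl 0), M (.inl 0) (.inl 1), M (.inl 0) (.inr 0), M (.inl 0) (.inr 1);
      M (.inl 1) (.inl 0), M (.inl 1) (.inl 1), M (.inl 1) (.inr 0), M (.inl 1) (.inr 1);
      M (.inr 0) (.inl 0), M (.inr 0) (.inl 1), M (.inr 0) (.inr 0), M (.inr 0) (.inr 1);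
      M (.inr 1) (.inl 0), M (.inr 1) (.inl 1), M (.inr 1) (.inr 0), M (.inr 1) (.inr 1)] := by
  rw [← Matrix.det_submatrix_equiv_self (finSumFinEquiv (m := 2) (n := 2)).symm M]
  congr 1
  ext i j
  fin_cases i <;> fin_cases j <;> rfl

/-- The alternating bilinear form with matrix `skew p`. -/
def skewForm (p : Fin 6 → ℂ) (x y : Fin 2 ⊕ Fin 2 → ℂ) : ℂ :=
  p 0 * (x (.inr 0) * y (.inr 1) - x (.inr 1) * y (.inr 0))
    - p 1 * (x (.inl 0) * y (.inl 1) - x (.inl 1) * y (.inl 0))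
    + p 2 * (x (.inl 0) * y (.inr 1) - x (.inr 1) * y (.inl 0))
    - p 3 * (x (.inl 1) * y (.inr 0) - x (.inr 0) * y (.inl 1))
    - p 4 * (x (.inl 0) * y (.inr 0) - x (.inr 0) * y (.inl 0))
    + p 5 * (x (.inl 1) * y (.inr 1) - x (.inr 1) * y (.inl 1))

theorem congr_apply (h : Mat4) (p : Fin 6 → ℂ) (i j) :
    (h * skew p * hᵀ) i j = skewForm p (h i) (h j) := by
  simp [skewForm, skew, Matrix.mul_apply, Fin.sum_univ_two]
  ring

theorem congrCoord_eq (h : Mat4) (p : Fin 6 → ℂ) : congrCoord h p =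
    ![skewForm p (h (.inr 0)) (h (.inr 1)), -skewForm p (h (.inl 0)) (h (.inl 1)),
      skewForm p (h (.inl 0)) (h (.inr 1)), -skewForm p (h (.inl 1)) (h (.inr 0)),
      -skewForm p (h (.inl 0)) (h (.inr 0)), skewForm p (h (.inl 1)) (h (.inr 1))] := by
  simp only [congrCoord, skewCoord, congr_apply]

theorem det_four_expand (M : Mat4) : M.det =
    skewForm ![M (.inr 0) (.inl 0) * M (.inr 1) (.inl 1) - M (.inr 0) (.inl 1) * M (.inr 1) (.inl 0),
      -(M (.inr 0) (.inr 0) * M (.inr 1) (.inr 1) - M (.inr 0) (.inr 1) * M (.inr 1) (.inr 0)),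
      M (.inr 0) (.inl 1) * M (.inr 1) (.inr 0) - M (.inr 0) (.inr 0) * M (.inr 1) (.inl 1),
      -(M (.inr 0) (.inl 0) * M (.inr 1) (.inr 1) - M (.inr 0) (.inr 1) * M (.inr 1) (.inl 0)),
      M (.inr 0) (.inl 1) * M (.inr 1) (.inr 1) - M (.inr 0) (.inr 1) * M (.inr 1) (.inl 1),
      -(M (.inr 0) (.inl 0) * M (.inr 1) (.inr 0) - M (.inr 0) (.inr 0) * M (.inr 1) (.inl 0))]
      (M (.inl 0)) (M (.inl 1)) := by
  rw [det_four]
  simp [Matrix.det_succ_row_zero, Fin.sum_univ_succ, Fin.succAbove, skewForm]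
  ring

/-- Duality turns the action of h into the contragredient one, up to the factor det h. When h and X
are invertible this follows by inverting h X ᵗh; in general it is a polynomial identity in the
entries, and it is checked as such. -/
theorem dual_congrCoord (h : Mat4) (p : Fin 6 → ℂ) :
    hᵀ * skew (dualCoord (congrCoord h p)) * h = h.det • skew (dualCoord p) := by
  have e1 : hᵀ * skew (dualCoord (congrCoord h p)) * h
      = skew (congrCoord hᵀ (dualCoord (congrCoord h p))) := by
    rw [skew_congrCoord, Matrix.transpose_transpose]
  rw [e1, ← skew_smul]
  congr 1
  rw [congrCoord_eq hᵀ, congrCoord_eq, det_four_expand]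
  simp only [skewForm, dualCoord, Matrix.transpose_apply, Matrix.cons_val]
  generalize h (.inl 0) (.inl 0) = h00
  generalize h (.inl 0) (.inl 1) = h01
  generalize h (.inl 0) (.inr 0) = h02
  generalize h (.inl 0) (.inr 1) = h03
  generalize h (.inl 1) (.inl 0) = h10
  generalize h (.inl 1) (.inl 1) = h11
  generalize h (.inl 1) (.inr 0) = h12
  generalize h (.inl 1) (.inr 1) = h13
  generalize h (.inr 0) (.inl 0) = h20
  generalize h (.inr 0) (.inl 1) = h21
  generalize h (.inr 0) (.inr 0) = h22
  generalize h (.inr 0) (.inr 1) = h23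
  generalize h (.inr 1) (.inl 0) = h30
  generalize h (.inr 1) (.inl 1) = h31
  generalize h (.inr 1) (.inr 0) = h32
  generalize h (.inr 1) (.inr 1) = h33
  generalize p 0 = p0
  generalize p 1 = p1
  generalize p 2 = p2
  generalize p 3 = p3
  generalize p 4 = p4
  generalize p 5 = p5
  ext i
  fin_cases i <;> simp only [Pi.smul_apply, smul_eq_mul, Fin.zero_eta, Fin.mk_one, Fin.reduceFinMk,
    Matrix.cons_val] <;> ring

theorem J_mul_J : J * J = -1 := by
  rw [J, Matrix.fromBlocks_multiply, ← Matrix.fromBlocks_one, Matrix.fromBlocks_neg]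
  simp

theorem J_transpose : Jᵀ = -J := by
  rw [J, Matrix.fromBlocks_transpose, Matrix.fromBlocks_neg]
  simp

/-- The hypothesis makes -J h* J a left inverse of h, hence also a right inverse. -/
theorem mul_J_mul_conjTranspose {h : Mat4} (hh : hᴴ * J * h = J) : h * J * hᴴ = J := by
  have e : (-J * hᴴ * J) * h = 1 := by
    have : (-J * hᴴ * J) * h = -J * (hᴴ * J * h) := by noncomm_ring
    rw [this, hh, neg_mul, J_mul_J, neg_neg]
  have e' : h * (-J * hᴴ * J) = 1 := mul_eq_one_comm.mp e
  calc h * J * hᴴ = (h * (-J * hᴴ * J)) * J - h * J * hᴴ * (-1 - J * J) := by noncomm_ring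
    _ = J := by rw [e', J_mul_J]; simp

/-- Complex conjugation of alternating matrices, relative to the real form attached to `J`. -/
def conjCoord (p : Fin 6 → ℂ) : Fin 6 → ℂ :=
  ![star (p 0), star (p 1), star (p 2), star (p 3), star (p 5), star (p 4)]

/-- So `conjCoord` is defined intrinsically from J. Its fixed points have p₀, …, p₃ real and p₅ the
conjugate of p₄, and there `pf` becomes p₀p₁ + p₂p₃ - |p₄|², of signature (2,4). -/
theorem J_dual_J (p : Fin 6 → ℂ) :
    (J * skew (dualCoord p) * Jᵀ)ᴴᵀ = skew (conjCoord p) := by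
  simp only [J, skew, Matrix.fromBlocks_transpose, Matrix.fromBlocks_multiply,
    Matrix.fromBlocks_conjTranspose, Matrix.fromBlocks_inj]
  refine ⟨?_, ?_, ?_, ?_⟩ <;> ext i j <;> fin_cases i <;> fin_cases j <;>
    simp [dualCoord, conjCoord]

/-- Duality replaces h by its contragredient, J-unitarity turns the contragredient into the
entrywise conjugate, and conjugation brings h back. For det h = 1 the action therefore preserves the
real form. -/
theorem conjCoord_congrCoord {h : Mat4} (hh : hᴴ * J * h = J) (p : Fin 6 → ℂ) :
    conjCoord (congrCoord h p) = star h.det • congrCoord h (conjCoord p) := by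
  apply skew_injective
  have h1 := mul_J_mul_conjTranspose hh
  have h2 : hᴴᵀ * J * hᵀ = J := by
    have := congrArg (fun X : Mat4 => Xᴴᵀ) h1
    simp only [Matrix.conjTranspose_mul, Matrix.transpose_mul, J_conj,
      Matrix.conjTranspose_conjTranspose] at this
    exact this
  have h3 : h * Jᵀ * hᴴ = Jᵀ := by
    rw [J_transpose]
    simp [h1]
  have key : J * skew (dualCoord (congrCoord h p)) * Jᵀ
      = h.det • (hᴴᵀ * (J * skew (dualCoord p) * Jᵀ) * hᴴ) := by
    have : h.det • (hᴴᵀ * (J * skew (dualCoord p) * Jᵀ) * hᴴ)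
        = hᴴᵀ * J * (h.det • skew (dualCoord p)) * Jᵀ * hᴴ := by
      simp only [Matrix.mul_smul, Matrix.smul_mul, Matrix.mul_assoc]
    rw [this, ← dual_congrCoord]
    calc J * skew (dualCoord (congrCoord h p)) * Jᵀ
        = (hᴴᵀ * J * hᵀ) * skew (dualCoord (congrCoord h p)) * (h * Jᵀ * hᴴ) := by rw [h2, h3]
      _ = _ := by simp only [Matrix.mul_assoc]
  rw [← J_dual_J, key, skew_smul, skew_congrCoord, ← J_dual_J]
  simp only [Matrix.conjTranspose_smul, Matrix.transpose_smul, Matrix.conjTranspose_mul,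
    Matrix.transpose_mul, Matrix.conjTranspose_conjTranspose, Matrix.mul_assoc]
  congr 2
  ext i j
  simp

/-- The product of a matrix with its dual is `pf` times the identity, and `dual_congrCoord` computes
that product after the action of h; cancelling h leaves the determinant. -/
theorem pf_congrCoord {h : Mat4} (hh : IsUnit h) (p : Fin 6 → ℂ) :
    pf (congrCoord h p) = h.det * pf p := by
  have e1 := skew_mul_dual (congrCoord h p)
  have e2 : pf (congrCoord h p) • h = (h.det * pf p) • h := by
    calc pf (congrCoord h p) • h = (pf (congrCoord h p) • (1 : Mat4)) * h := by simp
      _ = h * skew p * (hᵀ * skew (dualCoord (congrCoord h p)) * h) := by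
        rw [← e1, skew_congrCoord]; simp only [Matrix.mul_assoc]
      _ = (h.det * pf p) • h := by
        rw [dual_congrCoord, Matrix.mul_smul, Matrix.mul_assoc, skew_mul_dual]
        simp [smul_smul]
  have e3 := congrArg (· * h⁻¹) e2
  simp only [Matrix.smul_mul, Matrix.mul_nonsing_inv h ((Matrix.isUnit_iff_isUnit_det h).mp hh)]
    at e3
  have := congrFun (congrFun e3 (.inl 0)) (.inl 0)
  simpa using this

theorem congrCoord_smul (h : Mat4) (c : ℂ) (p : Fin 6 → ℂ) :
    congrCoord h (c • p) = c • congrCoord h p := by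
  apply skew_injective
  rw [skew_congrCoord, skew_smul, skew_smul, skew_congrCoord]
  simp

theorem congrCoord_add (h : Mat4) (p r : Fin 6 → ℂ) :
    congrCoord h (p + r) = congrCoord h p + congrCoord h r := by
  apply skew_injective
  rw [skew_congrCoord, skew_add, skew_add, skew_congrCoord, skew_congrCoord]
  noncomm_ring

theorem congrCoord_mul (h k : Mat4) (p : Fin 6 → ℂ) :
    congrCoord (h * k) p = congrCoord h (congrCoord k p) := by
  apply skew_injective
  rw [skew_congrCoord, skew_congrCoord, skew_congrCoord, Matrix.transpose_mul]
  simp only [Matrix.mul_assoc]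

theorem congrCoord_one (p : Fin 6 → ℂ) : congrCoord 1 p = p := by
  apply skew_injective
  rw [skew_congrCoord]
  simp

theorem congrCoord_mem_Eis {h : Mat4} (hh : ∀ i j, h i j ∈ Eis) {p : Fin 6 → ℂ}
    (hp : ∀ i, p i ∈ Eis) (i : Fin 6) : congrCoord h p i ∈ Eis := by
  have hf : ∀ i j, skewForm p (h i) (h j) ∈ Eis := by
    intro i j
    have : ∀ k l, h i k * h j l - h i l * h j k ∈ Eis := fun k l =>
      sub_mem (mul_mem (hh _ _) (hh _ _)) (mul_mem (hh _ _) (hh _ _))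
    unfold skewForm
    exact add_mem (sub_mem (sub_mem (add_mem (sub_mem (mul_mem (hp _) (this _ _))
      (mul_mem (hp _) (this _ _))) (mul_mem (hp _) (this _ _))) (mul_mem (hp _) (this _ _)))
      (mul_mem (hp _) (this _ _))) (mul_mem (hp _) (this _ _))
  rw [congrCoord_eq]
  fin_cases i
  exacts [hf _ _, neg_mem (hf _ _), hf _ _, neg_mem (hf _ _), neg_mem (hf _ _), hf _ _]

theorem det_mem_Eis {h : Mat4} (hh : ∀ i j, h i j ∈ Eis) : h.det ∈ Eis := by
  rw [Matrix.det_apply]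
  refine sum_mem fun σ _ => ?_
  rw [Units.smul_def]
  exact zsmul_mem (prod_mem fun i _ => hh _ _) _

theorem det_mul_star {h : Mat4} (hh : hᴴ * J * h = J) : h.det * star h.det = 1 := by
  have e := congrArg Matrix.det hh
  have hJ : J.det ≠ 0 := by
    intro h0
    have := congrArg Matrix.det J_mul_J
    rw [Matrix.det_mul, h0] at this
    norm_num [Matrix.det_neg] at this
  rw [Matrix.det_mul, Matrix.det_mul, Matrix.det_conjTranspose] at e
  have : (h.det * star h.det - 1) * J.det = 0 := by linear_combination e
  exact sub_eq_zero.mp ((mul_eq_zero.mp this).resolve_right hJ)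

/-- The determinant is an Eisenstein unit ±k with k³ = 1. If it were -k, then k times the image of a
real vector of Pfaffian 1 would be an anti-real integral vector of Pfaffian -1. Its first four
coordinates are multiples of √-3, so the remaining one has norm ≡ 2 mod 3, whereas a² - ab + b² ≡ (a
+ b)² mod 3 is a square. -/
theorem HG_det {h : GL4} (hh : h ∈ HG) : h.1.det = 1 ∨ h.1.det = ω ∨ h.1.det = ω ^ 2 := by
  have hE : ∀ i j, h.1 i j ∈ Eis := fun i j => (hh.1 i j).1
  obtain ⟨s, k, hs, hk, e⟩ := unit_Eis (det_mem_Eis hE) (det_mul_star hh.2)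
  rcases hs with rfl | rfl
  · rw [e, one_mul]; exact hk
  exfalso
  have hkE : k ∈ Eis := by
    rcases hk with rfl | rfl | rfl
    exacts [one_mem _, ω_mem_Eis, pow_mem ω_mem_Eis 2]
  have hk3 : k ^ 3 = 1 := by
    rcases hk with rfl | rfl | rfl
    · simp
    · exact ω_pow_three
    · rw [← pow_mul, mul_comm, pow_mul, ω_pow_three, one_pow]
  have hks : k * star k = 1 := by
    have := det_mul_star hh.2
    rw [e] at this
    simpa using this
  have hks' : star k = k ^ 2 := by
    have : k ^ 3 * star k = k ^ 2 * (k * star k) := by ring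
    rwa [hk3, one_mul, hks, mul_one] at this
  set p : Fin 6 → ℂ := ![1, 1, 0, 0, 0, 0] with hp
  -- The factor k absorbs the cube root of unity: conjugation now acts on r by -1, and the Pfaffian
  -- becomes k² · (-k) = -1.
  set r := k • congrCoord h.1 p with hr
  have hrE : ∀ i, r i ∈ Eis := fun i => mul_mem hkE (congrCoord_mem_Eis hE (by
    intro i
    fin_cases i
    exacts [one_mem _, one_mem _, zero_mem _, zero_mem _, zero_mem _, zero_mem _]) i)
  have hpc : conjCoord p = p := by
    ext i; fin_cases i <;> simp [conjCoord, p]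
  have hrc : conjCoord r = -r := by
    have h1 : conjCoord r = star k • conjCoord (congrCoord h.1 p) := by
      ext i; fin_cases i <;> simp [conjCoord, hr]
    rw [h1, conjCoord_congrCoord hh.2, hpc, e, hr, smul_smul, ← neg_smul]
    congr 1
    rw [star_mul, hks']
    simp only [star_neg, star_one]
    linear_combination (-k) * hk3
  have hpf : pf r = -1 := by
    have h1 : pf r = k ^ 2 * pf (congrCoord h.1 p) := by
      simp only [pf, hr, Pi.smul_apply, smul_eq_mul]; ring
    rw [h1, pf_congrCoord h.isUnit, e]
    have : pf p = 1 := by simp [pf, p]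
    rw [this]
    linear_combination -hk3
  have c := fun i => congrFun hrc i
  obtain ⟨a0, e0⟩ := exists_int_of_star_eq_neg (hrE 0) (c 0)
  obtain ⟨a1, e1⟩ := exists_int_of_star_eq_neg (hrE 1) (c 1)
  obtain ⟨a2, e2⟩ := exists_int_of_star_eq_neg (hrE 2) (c 2)
  obtain ⟨a3, e3⟩ := exists_int_of_star_eq_neg (hrE 3) (c 3)
  obtain ⟨x, y, e4⟩ := mem_Eis_iff.mp (hrE 4)
  have e5 : r 5 = -star (r 4) := by
    have := c 5
    simp [conjCoord] at this
    rw [eq_neg_iff_add_eq_zero, add_comm, ← eq_neg_iff_add_eq_zero]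
    exact this
  have hn := norm_Eis x y
  rw [← e4] at hn
  rw [pf, e5, e0, e1, e2, e3] at hpf
  have hω : (1 + 2 * ω) ^ 2 = -3 := by linear_combination 4 * ω_quad
  have fin : (((-3) * (a0 * a1 + a2 * a3) + (x ^ 2 - x * y + y ^ 2) : ℤ) : ℂ) = ((-1 : ℤ) : ℂ) := by
    push_cast at hn ⊢
    linear_combination hpf - (a0 * a1 + a2 * a3 : ℂ) * hω - hn
  have fin' : (-3) * (a0 * a1 + a2 * a3) + (x ^ 2 - x * y + y ^ 2) = -1 := by exact_mod_cast fin
  have m : (x + y) ^ 2 % 3 = 2 := by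
    have : (x + y) ^ 2 = 3 * (a0 * a1 + a2 * a3 + x * y - 1) + 2 := by linear_combination fin'
    omega
  have : (x + y) % 3 = 0 ∨ (x + y) % 3 = 1 ∨ (x + y) % 3 = 2 := by omega
  rw [pow_two, Int.mul_emod] at m
  rcases this with h | h | h <;> rw [h] at m <;> norm_num at m

/-! ### The lattice `U ⊕ U ⊕ A₂` -/

/-- The alternating coordinates of a vector of the lattice `U ⊕ U ⊕ A₂` (over `ℂ`). -/
def latCoord (w : Fin 6 → ℂ) : Fin 6 → ℂ :=
  ![w 0, w 1, w 2, w 3, w 4 + ω * w 5, w 4 + ω ^ 2 * w 5]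

theorem latCoord_injective : Function.Injective latCoord := by
  intro v w h
  have c := fun i => congrFun h i
  have c4 := c 4
  have c5 := c 5
  simp [latCoord] at c4 c5
  have h5 : v 5 = w 5 := by
    have : (ω - ω ^ 2) * (v 5 - w 5) = 0 := by linear_combination c4 - c5
    exact sub_eq_zero.mp ((mul_eq_zero.mp this).resolve_left ω_sub_ne)
  rw [h5] at c4
  ext i
  fin_cases i
  exacts [c 0, c 1, c 2, c 3, add_right_cancel c4, h5]

theorem latCoord_smul (c : ℂ) (w : Fin 6 → ℂ) : latCoord (c • w) = c • latCoord w := by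
  ext i; fin_cases i <;> simp [latCoord] <;> ring

theorem latCoord_add (v w : Fin 6 → ℂ) : latCoord (v + w) = latCoord v + latCoord w := by
  ext i; fin_cases i <;> simp [latCoord] <;> ring

/-- The quadratic form of `U ⊕ U ⊕ A₂`. -/
def qL {A : Type*} [CommRing A] (v : Fin 6 → A) : A :=
  v 0 * v 1 + v 2 * v 3 - (v 4 ^ 2 - v 4 * v 5 + v 5 ^ 2)

theorem pf_latCoord (w : Fin 6 → ℂ) : pf (latCoord w) = qL w := by
  simp [pf, latCoord, qL]
  linear_combination (w 4 * w 5) * ω_quad + w 5 ^ 2 * ω_pow_three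

/-- An integral matrix with complex entries. -/
def toC (g : Matrix (Fin 6) (Fin 6) ℤ) : Matrix (Fin 6) (Fin 6) ℂ := g.map (Int.castRingHom ℂ)

theorem toC_mul (g k : Matrix (Fin 6) (Fin 6) ℤ) : toC (g * k) = toC g * toC k := Matrix.map_mul

theorem toC_one : toC 1 = 1 := by simp [toC]

theorem toC_mulVec (g : Matrix (Fin 6) (Fin 6) ℤ) (v : Fin 6 → ℤ) :
    toC g *ᵥ (fun i => (v i : ℂ)) = fun i => ((g *ᵥ v) i : ℂ) := by
  ext i
  simp [toC, Matrix.mulVec, dotProduct]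

theorem toC_injective : Function.Injective toC :=
  Matrix.map_injective (fun _ _ h => Int.cast_injective h)

/-- The action of `h` on alternating matrices is `c` times the action of the integral matrix `g`
on the lattice. -/
def Realises (h : Mat4) (g : Matrix (Fin 6) (Fin 6) ℤ) (c : ℂ) : Prop :=
  ∀ w : Fin 6 → ℂ, congrCoord h (latCoord w) = c • latCoord (toC g *ᵥ w)

theorem Realises.mul {h k : Mat4} {g l : Matrix (Fin 6) (Fin 6) ℤ} {c d : ℂ}
    (H : Realises h g c) (K : Realises k l d) : Realises (h * k) (g * l) (c * d) := by
  intro w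
  rw [congrCoord_mul, K, congrCoord_smul, H, toC_mul, Matrix.mulVec_mulVec, smul_smul, mul_comm]

theorem realises_one : Realises 1 1 1 := by
  intro w
  rw [congrCoord_one, toC_one]
  simp

/-- The image has Eisenstein coordinates and is fixed by `conjCoord` because det h = 1; the vectors
with both properties are the lattice points. -/
theorem exists_int_congrCoord {h : GL4} (hh : h ∈ HG) (hd : h.1.det = 1) (v : Fin 6 → ℤ) :
    ∃ u : Fin 6 → ℤ, congrCoord h.1 (latCoord fun i => (v i : ℂ)) = latCoord fun i => (u i : ℂ) := by
  set p := latCoord fun i => (v i : ℂ) with hp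
  have hpE : ∀ i, p i ∈ Eis := by
    intro i
    fin_cases i
    · exact intCast_mem_Eis _
    · exact intCast_mem_Eis _
    · exact intCast_mem_Eis _
    · exact intCast_mem_Eis _
    · exact add_mem (intCast_mem_Eis _) (mul_mem ω_mem_Eis (intCast_mem_Eis _))
    · exact add_mem (intCast_mem_Eis _) (mul_mem (pow_mem ω_mem_Eis 2) (intCast_mem_Eis _))
  have hpc : conjCoord p = p := by
    have h2 : star (ω ^ 2) = ω := by rw [← star_ω, star_star]
    have h1 := star_ω
    simp only [RCLike.star_def] at h1 h2
    ext i
    fin_cases i <;> simp [conjCoord, p, latCoord]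
    · left; rw [← map_pow]; exact h2
    · left; exact h1
  set r := congrCoord h.1 p with hr
  have hrE : ∀ i, r i ∈ Eis := congrCoord_mem_Eis (fun i j => (hh.1 i j).1) hpE
  have hrc : conjCoord r = r := by
    rw [hr, conjCoord_congrCoord hh.2, hpc, hd]; simp
  have c := fun i => congrFun hrc i
  obtain ⟨a0, e0⟩ := exists_int_of_star_eq (hrE 0) (c 0)
  obtain ⟨a1, e1⟩ := exists_int_of_star_eq (hrE 1) (c 1)
  obtain ⟨a2, e2⟩ := exists_int_of_star_eq (hrE 2) (c 2)
  obtain ⟨a3, e3⟩ := exists_int_of_star_eq (hrE 3) (c 3)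
  obtain ⟨x, y, e4⟩ := mem_Eis_iff.mp (hrE 4)
  have e5 : r 5 = star (r 4) := (c 5).symm
  refine ⟨![a0, a1, a2, a3, x, y], ?_⟩
  ext i
  fin_cases i <;> simp [latCoord]
  · exact e0
  · exact e1
  · exact e2
  · exact e3
  · rw [e4]; ring
  · rw [e5, e4, star_Eis]; push_cast; linear_combination (-y : ℂ) * ω_quad

theorem exists_realises {h : GL4} (hh : h ∈ HG) (hd : h.1.det = 1) :
    ∃ g : Matrix (Fin 6) (Fin 6) ℤ, Realises h.1 g 1 := by
  choose u hu using fun j => exists_int_congrCoord hh hd (Pi.single j 1)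
  refine ⟨Matrix.of fun i j => u j i, fun w => ?_⟩
  have hs : ∀ j : Fin 6, (fun i => ((Pi.single j 1 : Fin 6 → ℤ) i : ℂ)) = Pi.single j 1 := by
    intro j; ext i; simp [Pi.single_apply]
  simp only [hs] at hu
  let φ : (Fin 6 → ℂ) →ₗ[ℂ] (Fin 6 → ℂ) :=
    { toFun := fun w => congrCoord h.1 (latCoord w)
      map_add' := fun v w => by rw [latCoord_add, congrCoord_add]
      map_smul' := fun c w => by rw [latCoord_smul, congrCoord_smul]; rfl }
  let ψ : (Fin 6 → ℂ) →ₗ[ℂ] (Fin 6 → ℂ) :=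
    { toFun := fun w => latCoord (toC (Matrix.of fun i j => u j i) *ᵥ w)
      map_add' := fun v w => by rw [Matrix.mulVec_add, latCoord_add]
      map_smul' := fun c w => by rw [Matrix.mulVec_smul, latCoord_smul]; rfl }
  have : φ = ψ := by
    refine LinearMap.pi_ext' fun j => LinearMap.ext_ring ?_
    change congrCoord h.1 (latCoord (Pi.single j 1)) = latCoord (_ *ᵥ Pi.single j 1)
    rw [hu, Matrix.mulVec_single_one]
    rfl
  rw [one_smul]
  exact LinearMap.congr_fun this w

theorem Realises.unique {h : Mat4} {g l : Matrix (Fin 6) (Fin 6) ℤ} {c : ℂ} (hc : c ≠ 0)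
    (H : Realises h g c) (K : Realises h l c) : g = l := by
  apply toC_injective
  rw [← Matrix.mulVec_injective.eq_iff]
  ext1 w
  apply latCoord_injective
  exact smul_right_injective _ hc ((H w).symm.trans (K w))

/-- The inverse of h also gives an integral matrix, and uniqueness of the matrix realised shows that
the two are inverse to each other. -/
theorem exists_GL_realises {h : GL4} (hh : h ∈ HG) (hd : h.1.det = 1) :
    ∃ g : GL (Fin 6) ℤ, Realises h.1 g.1 1 := by
  obtain ⟨g, hg⟩ := exists_realises hh hd
  have hd' : (h⁻¹).1.det = 1 := by
    have := congrArg Matrix.det h.inv_val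
    rwa [Matrix.det_mul, hd, mul_one, Matrix.det_one] at this
  obtain ⟨k, hk⟩ := exists_realises (inv_mem hh) hd'
  have h1 := hg.mul hk
  have h2 := hk.mul hg
  rw [← Units.val_mul, one_mul] at h1 h2
  rw [mul_inv_cancel, Units.val_one] at h1
  rw [inv_mul_cancel, Units.val_one] at h2
  exact ⟨⟨g, k, h1.unique one_ne_zero realises_one, h2.unique one_ne_zero realises_one⟩, hg⟩

theorem Realises.qL_eq {h : GL4} {g : Matrix (Fin 6) (Fin 6) ℤ} {c : ℂ}
    (H : Realises h.1 g c) (w : Fin 6 → ℂ) : c ^ 2 * qL (toC g *ᵥ w) = h.1.det * qL w := by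
  have := pf_congrCoord h.isUnit (latCoord w)
  rw [H, pf_latCoord] at this
  rw [← this, ← pf_latCoord]
  simp only [pf, Pi.smul_apply, smul_eq_mul]
  ring

/-! ### Integral matrices realised by the Hermitian modular group -/

/-- The inverse is -J M* J, which is again integral. -/
theorem exists_HG_of_entries {M : Mat4} (hM : ∀ i j, M i j ∈ Eis) (hJ : Mᴴ * J * M = J) :
    ∃ h ∈ HG, h.1 = M := by
  have e : (-J * Mᴴ * J) * M = 1 := by
    have : (-J * Mᴴ * J) * M = -J * (Mᴴ * J * M) := by noncomm_ring
    rw [this, hJ, neg_mul, J_mul_J, neg_neg]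
  have hJE : ∀ i j, J i j ∈ Eis := by
    intro i j
    rcases i with i | i <;> rcases j with j | j <;> fin_cases i <;> fin_cases j <;>
      simp [J, one_mem, zero_mem]
  have hJM : ∀ i j, (J * Mᴴ) i j ∈ Eis := fun i j => by
    rw [Matrix.mul_apply]
    exact sum_mem fun k _ => mul_mem (hJE _ _) (star_mem_Eis (hM _ _))
  refine ⟨⟨M, -J * Mᴴ * J, mul_eq_one_comm.mp e, e⟩, ⟨fun i j => ⟨hM i j, ?_⟩, hJ⟩, rfl⟩
  change (-J * Mᴴ * J) i j ∈ Eis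
  rw [neg_mul, neg_mul, Matrix.neg_apply, Matrix.mul_apply]
  exact neg_mem (sum_mem fun k _ => mul_mem (hJM _ _) (hJE _ _))

theorem Realises.inv {h : GL4} {g : GL (Fin 6) ℤ} {c : ℂ} (hc : c = 1 ∨ c = -1)
    (H : Realises h.1 g.1 c) : Realises (h⁻¹).1 (g⁻¹).1 c := by
  intro w
  have e1 := H (toC (g⁻¹).1 *ᵥ w)
  rw [Matrix.mulVec_mulVec, ← toC_mul, ← Units.val_mul, mul_inv_cancel, Units.val_one, toC_one,
    Matrix.one_mulVec] at e1
  have e2 := congrArg (congrCoord (h⁻¹).1) e1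
  rw [← congrCoord_mul, ← Units.val_mul, inv_mul_cancel, Units.val_one, congrCoord_one,
    congrCoord_smul] at e2
  rw [e2, smul_smul]
  rcases hc with rfl | rfl <;> simp

/-- The matrices in `SL₆(ℤ)` which describe, up to sign, the action of an element of the Hermitian
modular group on alternating matrices. -/
def realised : Subgroup (GL (Fin 6) ℤ) where
  carrier := {g | g.1.det = 1 ∧ ∃ h ∈ HG, ∃ c : ℂ, (c = 1 ∨ c = -1) ∧ Realises h.1 g.1 c}
  one_mem' := ⟨by simp, 1, one_mem _, 1, Or.inl rfl, realises_one⟩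
  mul_mem' := by
    rintro g k ⟨hg, h, hh, c, hc, H⟩ ⟨hk, l, hl, d, hd, K⟩
    refine ⟨by rw [Units.val_mul, Matrix.det_mul, hg, hk, one_mul], h * l, mul_mem hh hl, c * d,
      ?_, H.mul K⟩
    rcases hc with rfl | rfl <;> rcases hd with rfl | rfl <;> simp
  inv_mem' := by
    rintro g ⟨hg, h, hh, c, hc, H⟩
    refine ⟨?_, h⁻¹, inv_mem hh, c, hc, H.inv hc⟩
    have := congrArg Matrix.det g.inv_val
    rwa [Matrix.det_mul, hg, mul_one, Matrix.det_one] at this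

theorem exists_realised {M : Mat4} {A : Matrix (Fin 6) (Fin 6) ℤ} {c : ℂ}
    (hM : ∀ i j, M i j ∈ Eis) (hJ : Mᴴ * J * M = J) (hA : A.det = 1) (hc : c = 1 ∨ c = -1)
    (H : Realises M A c) : ∃ g ∈ realised, g.1 = A := by
  obtain ⟨h, hh, rfl⟩ := exists_HG_of_entries hM hJ
  exact ⟨Matrix.GeneralLinearGroup.mk'' A (by rw [hA]; exact isUnit_one), ⟨hA, h, hh, c, hc, H⟩, rfl⟩

/-! ### Generators realised by the Hermitian modular group -/

/-- The translation `τ ↦ τ + S` with `S = [p, a + bω; a + bω², q]`. -/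
def transMat (p q a b : ℤ) : Matrix (Fin 6) (Fin 6) ℤ :=
  !![1, 0, 0, 0, 0, 0;
     -(p * q - (a ^ 2 - a * b + b ^ 2)), 1, -q, -p, 2 * a - b, 2 * b - a;
     p, 0, 1, 0, 0, 0;
     q, 0, 0, 1, 0, 0;
     a, 0, 0, 0, 1, 0;
     b, 0, 0, 0, 0, 1]

/-- The inversion `τ ↦ -τ⁻¹`. -/
def invMat : Matrix (Fin 6) (Fin 6) ℤ :=
  !![0, 1, 0, 0, 0, 0;
     1, 0, 0, 0, 0, 0;
     0, 0, 0, 1, 0, 0;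
     0, 0, 1, 0, 0, 0;
     0, 0, 0, 0, -1, 0;
     0, 0, 0, 0, 0, -1]

/-- The map `τ ↦ U τ U*` with `U = [1, 0; a + bω², 1]`. -/
def shearMat (a b : ℤ) : Matrix (Fin 6) (Fin 6) ℤ :=
  !![1, 0, 0, 0, 0, 0;
     0, 1, 0, 0, 0, 0;
     0, 0, 1, 0, 0, 0;
     0, 0, a ^ 2 - a * b + b ^ 2, 1, 2 * a - b, 2 * b - a;
     0, 0, a, 0, 1, 0;
     0, 0, b, 0, 0, 1]

/-- The map `τ ↦ U τ U*` with `U = [0, 1; -1, 0]`. -/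
def swapMat : Matrix (Fin 6) (Fin 6) ℤ :=
  !![1, 0, 0, 0, 0, 0;
     0, 1, 0, 0, 0, 0;
     0, 0, 0, 1, 0, 0;
     0, 0, 1, 0, 0, 0;
     0, 0, 0, 0, -1, 1;
     0, 0, 0, 0, 0, 1]

/-- The map `τ ↦ U τ U*` with `U = [-ω², 0; 0, 1]`. -/
def rotMat : Matrix (Fin 6) (Fin 6) ℤ :=
  !![1, 0, 0, 0, 0, 0;
     0, 1, 0, 0, 0, 0;
     0, 0, 1, 0, 0, 0;
     0, 0, 0, 1, 0, 0;
     0, 0, 0, 0, 1, -1;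
     0, 0, 0, 0, 1, 0]

theorem Eis_a_bω (a b : ℤ) : (a + b * ω : ℂ) ∈ Eis :=
  add_mem (intCast_mem_Eis _) (mul_mem (intCast_mem_Eis _) ω_mem_Eis)

theorem Eis_a_bω_sq (a b : ℤ) : (a + b * ω ^ 2 : ℂ) ∈ Eis :=
  add_mem (intCast_mem_Eis _) (mul_mem (intCast_mem_Eis _) (pow_mem ω_mem_Eis 2))

theorem conj_ω : (starRingEnd ℂ) ω = ω ^ 2 := star_ω

theorem exists_transMat (p q a b : ℤ) : ∃ g ∈ realised, g.1 = transMat p q a b := by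
  apply exists_realised (M := Matrix.fromBlocks 1 !![(p : ℂ), a + b * ω; a + b * ω ^ 2, q] 0 1)
    (c := 1)
  · intro i j
    rcases i with i | i <;> rcases j with j | j <;> fin_cases i <;> fin_cases j <;>
      simp [one_mem, zero_mem, Eis_a_bω, Eis_a_bω_sq]
  · simp only [J, Matrix.fromBlocks_conjTranspose, Matrix.fromBlocks_multiply,
      Matrix.fromBlocks_inj]
    refine ⟨by simp, by simp, by simp, ?_⟩
    have h1 := conj_ω
    ext i j; fin_cases i <;> fin_cases j <;> simp [h1] <;> grind [ω_quad]
  · simp [transMat, Matrix.det_succ_row_zero, Fin.sum_univ_succ, Fin.succAbove]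
  · simp
  · intro w
    rw [congrCoord_eq]
    ext i
    fin_cases i <;> simp [skewForm, latCoord, toC, transMat, Matrix.mulVec, dotProduct,
      Fin.sum_univ_six] <;> grind [ω_quad]

theorem exists_invMat : ∃ g ∈ realised, g.1 = invMat := by
  -- J acts on alternating coordinates as the negative of `invMat`; the sign is absorbed by c.
  apply exists_realised (M := J) (c := -1)
  · intro i j
    rcases i with i | i <;> rcases j with j | j <;> fin_cases i <;> fin_cases j <;>
      simp [J, one_mem, zero_mem]
  · simp [J, Matrix.fromBlocks_conjTranspose, Matrix.fromBlocks_multiply]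
  · simp [invMat, Matrix.det_succ_row_zero, Fin.sum_univ_succ, Fin.succAbove]
  · simp
  · intro w
    rw [congrCoord_eq]
    ext i
    fin_cases i <;> simp [skewForm, latCoord, toC, invMat, Matrix.mulVec, dotProduct, J,
      Fin.sum_univ_six] <;> grind [ω_quad]

theorem exists_shearMat (a b : ℤ) : ∃ g ∈ realised, g.1 = shearMat a b := by
  apply exists_realised (M := Matrix.fromBlocks !![1, 0; a + b * ω ^ 2, 1] 0 0
    !![1, -(a + b * ω); 0, 1]) (c := 1)
  · intro i j
    rcases i with i | i <;> rcases j with j | j <;> fin_cases i <;> fin_cases j <;>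
      simp [one_mem, zero_mem, Eis_a_bω, Eis_a_bω_sq, -neg_add_rev]
  · simp only [J, Matrix.fromBlocks_conjTranspose, Matrix.fromBlocks_multiply,
      Matrix.fromBlocks_inj]
    have h1 := conj_ω
    refine ⟨by simp, ?_, ?_, by simp⟩ <;> ext i j <;> fin_cases i <;> fin_cases j <;>
      simp [h1, Matrix.mul_apply, Fin.sum_univ_two] <;> grind [ω_quad]
  · simp [shearMat, Matrix.det_succ_row_zero, Fin.sum_univ_succ, Fin.succAbove]
  · simp
  · intro w
    rw [congrCoord_eq]
    ext i
    fin_cases i <;> simp [skewForm, latCoord, toC, shearMat, Matrix.mulVec, dotProduct,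
      Fin.sum_univ_six] <;> grind [ω_quad]

theorem exists_swapMat : ∃ g ∈ realised, g.1 = swapMat := by
  apply exists_realised (M := Matrix.fromBlocks !![0, 1; -1, 0] 0 0 !![0, 1; -1, 0]) (c := 1)
  · intro i j
    rcases i with i | i <;> rcases j with j | j <;> fin_cases i <;> fin_cases j <;>
      simp [one_mem, zero_mem]
  · simp only [J, Matrix.fromBlocks_conjTranspose, Matrix.fromBlocks_multiply,
      Matrix.fromBlocks_inj]
    refine ⟨by simp, ?_, ?_, by simp⟩ <;> ext i j <;> fin_cases i <;> fin_cases j <;>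
      simp [Matrix.mul_apply, Fin.sum_univ_two]
  · simp [swapMat, Matrix.det_succ_row_zero, Fin.sum_univ_succ, Fin.succAbove]
  · simp
  · intro w
    rw [congrCoord_eq]
    ext i
    fin_cases i <;> simp [skewForm, latCoord, toC, swapMat, Matrix.mulVec, dotProduct,
      Fin.sum_univ_six] <;> grind [ω_quad]

theorem exists_rotMat : ∃ g ∈ realised, g.1 = rotMat := by
  -- The obvious choice U = diag(-ω², 1) gives determinant ω. Scaling by the unit -ω² corrects it to
  -- 1 and does not change τ ↦ UτU*.
  apply exists_realised (M := Matrix.fromBlocks !![ω, 0; 0, -ω ^ 2] 0 0 !![ω, 0; 0, -ω ^ 2])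
    (c := -1)
  · intro i j
    rcases i with i | i <;> rcases j with j | j <;> fin_cases i <;> fin_cases j <;>
      simp [zero_mem, ω_mem_Eis, pow_mem]
  · simp only [J, Matrix.fromBlocks_conjTranspose, Matrix.fromBlocks_multiply,
      Matrix.fromBlocks_inj]
    have h1 := conj_ω
    refine ⟨by simp, ?_, ?_, by simp⟩ <;> ext i j <;> fin_cases i <;> fin_cases j <;>
      simp [h1, Matrix.mul_apply, Fin.sum_univ_two] <;> grind [ω_quad]
  · simp [rotMat, Matrix.det_succ_row_zero, Fin.sum_univ_succ, Fin.succAbove]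
  · simp
  · intro w
    rw [congrCoord_eq]
    ext i
    fin_cases i <;> simp [skewForm, latCoord, toC, rotMat, Matrix.mulVec, dotProduct,
      Fin.sum_univ_six] <;> grind [ω_quad]

/-! ### Plücker vectors of points of the half space -/

/-- The standard alternating `2 × 2` matrix. -/
def E2 : Matrix (Fin 2) (Fin 2) ℂ := !![0, 1; -1, 0]

/-- The `4 × 2` matrix with blocks `τ` and `1`. -/
def colMat (τ : Matrix (Fin 2) (Fin 2) ℂ) : Matrix (Fin 2 ⊕ Fin 2) (Fin 2) ℂ :=
  Matrix.fromRows τ 1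

/-- The coordinates are the Plücker coordinates of the plane spanned by the columns of (τ; 1), so
the matrix is decomposable. -/
theorem skew_of_rows (τ : Matrix (Fin 2) (Fin 2) ℂ) :
    skew ![1, -τ.det, τ 0 0, τ 1 1, τ 0 1, τ 1 0] =
      colMat τ * E2 * (colMat τ)ᵀ := by
  ext i j
  rw [Matrix.det_fin_two]
  rcases i with i | i <;> rcases j with j | j <;> fin_cases i <;> fin_cases j <;>
    simp [skew, colMat, E2, Matrix.mul_apply, Fin.sum_univ_two, Matrix.one_apply] <;> ring

/-- The vector of `(U ⊕ U ⊕ A₂) ⊗ ℂ` attached to a matrix. -/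
def vecL (τ : Matrix (Fin 2) (Fin 2) ℂ) : Fin 6 → ℂ :=
  ![1, -τ.det, τ 0 0, τ 1 1, τ 0 1 - ω * coord6 τ, coord6 τ]

theorem latCoord_vecL (τ : Matrix (Fin 2) (Fin 2) ℂ) :
    latCoord (vecL τ) = ![1, -τ.det, τ 0 0, τ 1 1, τ 0 1, τ 1 0] := by
  have hc : coord6 τ * (ω - ω ^ 2) = τ 0 1 - τ 1 0 := div_mul_cancel₀ _ ω_sub_ne
  ext i
  fin_cases i <;> simp [latCoord, vecL]
  linear_combination -hc

/-- From h(τ; 1) = (hτ; 1)(Cτ + D), passing to Plücker vectors turns the right factor into its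
determinant. The automorphy factor is thus the scalar by which the linear action differs from the
normalised vector. -/
theorem congrCoord_vecL {h : Mat4} {τ : Matrix (Fin 2) (Fin 2) ℂ}
    (hu : IsUnit (h.toBlocks₂₁ * τ + h.toBlocks₂₂)) :
    congrCoord h (latCoord (vecL τ)) =
      (h.toBlocks₂₁ * τ + h.toBlocks₂₂).det • latCoord (vecL (moebius h τ)) := by
  apply skew_injective
  rw [skew_congrCoord, skew_smul, latCoord_vecL, latCoord_vecL, skew_of_rows, skew_of_rows]
  have hd := (Matrix.isUnit_iff_isUnit_det _).mp hu
  set S := h.toBlocks₂₁ * τ + h.toBlocks₂₂ with hS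
  have e : h * colMat τ = colMat (moebius h τ) * S := by
    conv_lhs => rw [← Matrix.fromBlocks_toBlocks h]
    rw [colMat, colMat, Matrix.fromBlocks_mul_fromRows, Matrix.fromRows_mul, moebius, ← hS, Matrix.mul_assoc,
      Matrix.nonsing_inv_mul _ hd]
    simp [hS]
  have e2 : S * E2 * Sᵀ = S.det • E2 := by
    rw [Matrix.det_fin_two]
    ext i j
    fin_cases i <;> fin_cases j <;> simp [E2, Matrix.mul_apply, Fin.sum_univ_two] <;> ring
  calc h * (colMat τ * E2 * (colMat τ)ᵀ) * hᵀ
      = (h * colMat τ) * E2 * (h * colMat τ)ᵀ := by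
        rw [Matrix.transpose_mul]; simp only [Matrix.mul_assoc]
    _ = colMat (moebius h τ) * (S * E2 * Sᵀ)
          * (colMat (moebius h τ))ᵀ := by
        rw [e, Matrix.transpose_mul]; simp only [Matrix.mul_assoc]
    _ = _ := by rw [e2, Matrix.mul_smul, Matrix.smul_mul]

theorem Realises.vecL_eq {h : Mat4} {g : Matrix (Fin 6) (Fin 6) ℤ} {c : ℂ} (H : Realises h g c)
    {τ : Matrix (Fin 2) (Fin 2) ℂ} (hu : IsUnit (h.toBlocks₂₁ * τ + h.toBlocks₂₂)) :
    c • (toC g *ᵥ vecL τ) =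
      (h.toBlocks₂₁ * τ + h.toBlocks₂₂).det • vecL (moebius h τ) := by
  apply latCoord_injective
  rw [latCoord_smul, latCoord_smul, ← H, congrCoord_vecL hu]

/-! ### Isometries preserving the half space -/

/-- The integral matrix `g` preserves the cone over the Hermitian upper half space. -/
def PreservesCone (g : Matrix (Fin 6) (Fin 6) ℤ) : Prop :=
  ∀ τ ∈ H2, ∃ c : ℂ, c ≠ 0 ∧ ∃ τ' ∈ H2, toC g *ᵥ vecL τ = c • vecL τ'

theorem PreservesCone.mul {g k : Matrix (Fin 6) (Fin 6) ℤ} (hg : PreservesCone g)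
    (hk : PreservesCone k) : PreservesCone (g * k) := by
  intro τ hτ
  obtain ⟨c, hc, τ', hτ', e⟩ := hk τ hτ
  obtain ⟨d, hd, τ'', hτ'', e'⟩ := hg τ' hτ'
  refine ⟨c * d, mul_ne_zero hc hd, τ'', hτ'', ?_⟩
  rw [toC_mul, ← Matrix.mulVec_mulVec, e, Matrix.mulVec_smul, e', smul_smul]

theorem Realises.preservesCone {h : GL4} {g : Matrix (Fin 6) (Fin 6) ℤ} {c : ℂ} (hh : h ∈ HG)
    (hc : c ≠ 0) (H : Realises h.1 g c) : PreservesCone g := by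
  intro τ hτ
  have hu := denom_isUnit (HG_le hh) hτ
  have hd := ((Matrix.isUnit_iff_isUnit_det _).mp hu).ne_zero
  refine ⟨_, mul_ne_zero (inv_ne_zero hc) hd, _, moebius_mem (HG_le hh) hτ, ?_⟩
  rw [← smul_smul, ← H.vecL_eq hu, smul_smul, inv_mul_cancel₀ hc, one_smul]

/-- The polar form of `qL`. -/
def bL (v w : Fin 6 → ℤ) : ℤ :=
  v 0 * w 1 + v 1 * w 0 + v 2 * w 3 + v 3 * w 2
    - (2 * v 4 * w 4 - v 4 * w 5 - v 5 * w 4 + 2 * v 5 * w 5)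

theorem bL_eq (v w : Fin 6 → ℤ) : bL v w = qL (v + w) - qL v - qL w := by
  simp only [bL, qL, Pi.add_apply]; ring

/-- The integral matrix `g` preserves the quadratic form `qL`. -/
def Isometry6 (g : Matrix (Fin 6) (Fin 6) ℤ) : Prop := ∀ v : Fin 6 → ℤ, qL (g *ᵥ v) = qL v

theorem Isometry6.mul {g k : Matrix (Fin 6) (Fin 6) ℤ} (hg : Isometry6 g) (hk : Isometry6 k) :
    Isometry6 (g * k) := fun v => by rw [← Matrix.mulVec_mulVec, hg, hk]

theorem Isometry6.bL_eq {g : Matrix (Fin 6) (Fin 6) ℤ} (hg : Isometry6 g) (v w : Fin 6 → ℤ) :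
    bL (g *ᵥ v) (g *ᵥ w) = bL v w := by
  rw [HessianK3.bL_eq, ← Matrix.mulVec_add, hg, hg, hg, HessianK3.bL_eq]

theorem qL_cast (v : Fin 6 → ℤ) : qL (fun i => (v i : ℂ)) = ((qL v : ℤ) : ℂ) := by
  simp [qL]

/-- Since c² = 1, the form is multiplied by det h. On a vector of norm 1 this must give an integer,
and 1 is the only integer among 1, ω, ω². -/
theorem Realises.isometry {h : GL4} {g : Matrix (Fin 6) (Fin 6) ℤ} {c : ℂ} (hh : h ∈ HG)
    (hc : c = 1 ∨ c = -1) (H : Realises h.1 g c) : Isometry6 g := by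
  have hc2 : c ^ 2 = 1 := by rcases hc with rfl | rfl <;> norm_num
  have key : ∀ v : Fin 6 → ℤ, ((qL (g *ᵥ v) : ℤ) : ℂ) = h.1.det * ((qL v : ℤ) : ℂ) := by
    intro v
    have := H.qL_eq (fun i => (v i : ℂ))
    rwa [hc2, one_mul, toC_mulVec, qL_cast, qL_cast] at this
  have hd : h.1.det = 1 := by
    have := key ![1, 1, 0, 0, 0, 0]
    generalize qL (g *ᵥ ![1, 1, 0, 0, 0, 0]) = n at this
    have e : qL (![1, 1, 0, 0, 0, 0] : Fin 6 → ℤ) = 1 := by simp [qL]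
    rw [e] at this
    rcases HG_det hh with hd | hd | hd
    · exact hd
    · rw [hd] at this
      have : ((n : ℤ) : ℂ) + ((0 : ℤ) : ℂ) * ω = ((0 : ℤ) : ℂ) + ((1 : ℤ) : ℂ) * ω := by
        push_cast at this ⊢; linear_combination this
      exact absurd (Eis_ext.mp this).2 (by norm_num)
    · rw [hd] at this
      have : ((n : ℤ) : ℂ) + ((0 : ℤ) : ℂ) * ω = ((-1 : ℤ) : ℂ) + ((-1 : ℤ) : ℂ) * ω := by
        push_cast at this ⊢; linear_combination this + ω_quad
      exact absurd (Eis_ext.mp this).2 (by norm_num)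
  intro v
  have := key v
  rw [hd, one_mul] at this
  exact_mod_cast this

theorem realised_isometry {g : GL (Fin 6) ℤ} (hg : g ∈ realised) : Isometry6 g.1 := by
  obtain ⟨-, h, hh, c, hc, H⟩ := hg
  exact H.isometry hh hc

theorem realised_preservesCone {g : GL (Fin 6) ℤ} (hg : g ∈ realised) : PreservesCone g.1 := by
  obtain ⟨-, h, hh, c, hc, H⟩ := hg
  exact H.preservesCone hh (by rcases hc with rfl | rfl <;> norm_num)

/-- The identity of HΓ realises -1 with c = -1. This is the reason for admitting both signs: signs
of basis vectors can be corrected inside `realised`. -/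
theorem neg_one_mem_realised : (-1 : GL (Fin 6) ℤ) ∈ realised := by
  refine ⟨by simp [Matrix.det_neg], 1, one_mem _, -1, Or.inr rfl, fun w => ?_⟩
  have : toC (-1 : GL (Fin 6) ℤ).1 = -1 := by
    ext i j
    by_cases hij : i = j <;> simp [toC, hij]
  rw [this, Units.val_one, congrCoord_one, Matrix.neg_mulVec, Matrix.one_mulVec, ← neg_one_smul ℂ w,
    latCoord_smul, smul_smul]
  simp

/-! ### Reduction of isotropic vectors -/

theorem transMat_mulVec (p q a b : ℤ) (v : Fin 6 → ℤ) : transMat p q a b *ᵥ v =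
    ![v 0, -(p * q - (a ^ 2 - a * b + b ^ 2)) * v 0 + v 1 - q * v 2 - p * v 3 + (2 * a - b) * v 4
      + (2 * b - a) * v 5, p * v 0 + v 2, q * v 0 + v 3, a * v 0 + v 4, b * v 0 + v 5] := by
  ext i
  fin_cases i <;> simp [transMat, Matrix.mulVec, dotProduct, Fin.sum_univ_six]
  ring

theorem invMat_mulVec (v : Fin 6 → ℤ) :
    invMat *ᵥ v = ![v 1, v 0, v 3, v 2, -v 4, -v 5] := by
  ext i
  fin_cases i <;> simp [invMat, Matrix.mulVec, dotProduct, Fin.sum_univ_six]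

theorem shearMat_mulVec (a b : ℤ) (v : Fin 6 → ℤ) : shearMat a b *ᵥ v =
    ![v 0, v 1, v 2, (a ^ 2 - a * b + b ^ 2) * v 2 + v 3 + (2 * a - b) * v 4
      + (2 * b - a) * v 5, a * v 2 + v 4, b * v 2 + v 5] := by
  ext i
  fin_cases i <;> simp [shearMat, Matrix.mulVec, dotProduct, Fin.sum_univ_six]

theorem swapMat_mulVec (v : Fin 6 → ℤ) :
    swapMat *ᵥ v = ![v 0, v 1, v 3, v 2, -v 4 + v 5, v 5] := by
  ext i
  fin_cases i <;> simp [swapMat, Matrix.mulVec, dotProduct, Fin.sum_univ_six]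

theorem rotMat_mulVec (v : Fin 6 → ℤ) :
    rotMat *ᵥ v = ![v 0, v 1, v 2, v 3, v 4 - v 5, v 4] := by
  ext i
  fin_cases i <;> simp [rotMat, Matrix.mulVec, dotProduct, Fin.sum_univ_six]
  ring

theorem exists_near_multiple (x : ℤ) {m : ℤ} (hm : m ≠ 0) : ∃ a : ℤ, 2 * |a * m + x| ≤ |m| := by
  have h1 := Int.emod_nonneg x hm
  have h2 := Int.emod_lt_abs x hm
  have h3 := Int.mul_ediv_add_emod x m
  by_cases h : 2 * (x % m) ≤ |m|
  · refine ⟨-(x / m), ?_⟩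
    have : -(x / m) * m + x = x % m := by linarith
    rw [this, abs_of_nonneg h1]
    exact h
  · rcases abs_cases m with ⟨h4, h5⟩ | ⟨h4, h5⟩
    · refine ⟨-(x / m) - 1, ?_⟩
      have : (-(x / m) - 1) * m + x = x % m - m := by linarith
      rw [this, abs_of_nonpos (by linarith)]
      linarith
    · refine ⟨-(x / m) + 1, ?_⟩
      have : (-(x / m) + 1) * m + x = x % m + m := by linarith
      rw [this, abs_of_nonpos (by linarith)]
      linarith

/-- This is Euclidean division in ℤ[ω]. For X and Y the reduced coordinates, first |2Y| ≤ |m| and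
then |2X - Y| ≤ |m| are arranged; 4(X² - XY + Y²) = (2X - Y)² + 3Y² ≤ (1 + 3/4) m² yields 7/16. -/
theorem exists_near_Eis (x y : ℤ) {m : ℤ} (hm : m ≠ 0) : ∃ a b : ℤ,
    16 * ((a * m + x) ^ 2 - (a * m + x) * (b * m + y) + (b * m + y) ^ 2) ≤ 7 * m ^ 2 := by
  obtain ⟨b, hb⟩ := exists_near_multiple y hm
  obtain ⟨a, ha⟩ := exists_near_multiple (2 * x - (b * m + y)) (m := 2 * m) (by simpa using hm)
  refine ⟨a, b, ?_⟩
  set Y := b * m + y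
  have e : a * (2 * m) + (2 * x - Y) = 2 * (a * m + x) - Y := by ring
  rw [e, abs_mul 2 m] at ha
  norm_num at ha
  have h1 : (2 * (a * m + x) - Y) ^ 2 ≤ m ^ 2 := sq_le_sq.mpr ha
  have h2 : (2 * Y) ^ 2 ≤ m ^ 2 := sq_le_sq.mpr (by rw [abs_mul]; simpa using hb)
  nlinarith

/-- Descent on |v₀|: a translation reduces v₂, v₃ and the Eisenstein coordinate modulo v₀, isotropy
then makes v₁ smaller than v₀ in absolute value, and the inversion exchanges the two. -/
theorem exists_realised_apply_zero (n : ℕ) : ∀ v : Fin 6 → ℤ, qL v = 0 → (v 0).natAbs ≤ n →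
    ∃ r ∈ realised, (r.1 *ᵥ v) 0 = 0 := by
  induction n with
  | zero =>
    intro v _ h
    exact ⟨1, one_mem _, by simpa using h⟩
  | succ n ih =>
    intro v hv hn
    by_cases h0 : v 0 = 0
    · exact ⟨1, one_mem _, by simpa using h0⟩
    obtain ⟨p, hp⟩ := exists_near_multiple (v 2) h0
    obtain ⟨q, hq⟩ := exists_near_multiple (v 3) h0
    obtain ⟨a, b, hab⟩ := exists_near_Eis (v 4) (v 5) h0
    obtain ⟨t, ht, et⟩ := exists_transMat p q a b
    obtain ⟨j, hj, ej⟩ := exists_invMat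
    have hq' : qL (t.1 *ᵥ v) = 0 := (realised_isometry ht v).trans hv
    have hu : qL ((j * t).1 *ᵥ v) = 0 := (realised_isometry (mul_mem hj ht) v).trans hv
    obtain ⟨r, hr, er⟩ := ih ((j * t).1 *ᵥ v) hu (by
      rw [Units.val_mul, ← Matrix.mulVec_mulVec, ej, invMat_mulVec]
      simp only [Matrix.cons_val_zero]
      rw [et, transMat_mulVec] at hq' ⊢
      simp only [qL, Matrix.cons_val] at hq' ⊢
      generalize -(p * q - (a ^ 2 - a * b + b ^ 2)) * v 0 + v 1 - q * v 2 - p * v 3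
        + (2 * a - b) * v 4 + (2 * b - a) * v 5 = y at *
      have h3 : 4 * |(p * v 0 + v 2) * (q * v 0 + v 3)| ≤ v 0 ^ 2 := by
        have := mul_le_mul hp hq (by positivity) (by positivity)
        rw [abs_mul, ← sq_abs]
        nlinarith
      -- By isotropy v₀y is the reduced norm minus the product of the reduced v₂ and v₃. It is
      -- bounded by (7/16 + 1/4) v₀².
      have h4 : |v 0 * y| < v 0 ^ 2 := by
        have e : v 0 * y = ((a * v 0 + v 4) ^ 2 - (a * v 0 + v 4) * (b * v 0 + v 5)
          + (b * v 0 + v 5) ^ 2) - (p * v 0 + v 2) * (q * v 0 + v 3) := by linarith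
        have hpos : 0 < v 0 ^ 2 := by positivity
        have hN : 0 ≤ (a * v 0 + v 4) ^ 2 - (a * v 0 + v 4) * (b * v 0 + v 5)
          + (b * v 0 + v 5) ^ 2 := by
          nlinarith [sq_nonneg (a * v 0 + v 4 - (b * v 0 + v 5)), sq_nonneg (a * v 0 + v 4),
            sq_nonneg (b * v 0 + v 5)]
        rw [e, abs_lt]
        have := abs_le.mp (le_refl |(p * v 0 + v 2) * (q * v 0 + v 3)|)
        constructor <;> linarith
      have h5 : |y| < |v 0| := by
        rw [abs_mul, ← sq_abs, pow_two] at h4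
        exact lt_of_mul_lt_mul_left h4 (abs_nonneg _)
      rw [Int.abs_eq_natAbs, Int.abs_eq_natAbs] at h5
      omega)
    refine ⟨r * (j * t), mul_mem hr (mul_mem hj ht), ?_⟩
    rw [Units.val_mul, ← Matrix.mulVec_mulVec, er]

/-- The standard basis of `ℤ⁶`. -/
abbrev e6 (k : Fin 6) : Fin 6 → ℤ := Pi.single k 1

theorem eq_zero_of_norm_eq_zero {x y : ℤ} (h : x ^ 2 - x * y + y ^ 2 = 0) : x = 0 ∧ y = 0 := by
  have h1 : x ^ 2 = 0 := by nlinarith [sq_nonneg (x - 2 * y), sq_nonneg x]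
  have h2 : y ^ 2 = 0 := by nlinarith [sq_nonneg (2 * x - y), sq_nonneg y]
  exact ⟨pow_eq_zero_iff two_ne_zero |>.mp h1, pow_eq_zero_iff two_ne_zero |>.mp h2⟩

/-- The elements of `realised` which fix the first two basis vectors. -/
def realisedFix : Subgroup (GL (Fin 6) ℤ) where
  carrier := {g | g ∈ realised ∧ g.1 *ᵥ e6 0 = e6 0 ∧ g.1 *ᵥ e6 1 = e6 1}
  one_mem' := ⟨one_mem _, Matrix.one_mulVec _, Matrix.one_mulVec _⟩
  mul_mem' := by
    rintro g k ⟨hg, h0, h1⟩ ⟨hk, k0, k1⟩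
    refine ⟨mul_mem hg hk, ?_, ?_⟩
    · rw [Units.val_mul, ← Matrix.mulVec_mulVec, k0, h0]
    · rw [Units.val_mul, ← Matrix.mulVec_mulVec, k1, h1]
  inv_mem' := by
    rintro g ⟨hg, h0, h1⟩
    have e : ∀ v : Fin 6 → ℤ, g.1 *ᵥ v = v → (g⁻¹).1 *ᵥ v = v := fun v hv => by
      conv_lhs => rw [← hv]
      rw [Matrix.mulVec_mulVec, ← Units.val_mul, inv_mul_cancel]
      simp
    exact ⟨inv_mem hg, e _ h0, e _ h1⟩

theorem exists_shearMat_fix (a b : ℤ) : ∃ g ∈ realisedFix, g.1 = shearMat a b := by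
  obtain ⟨g, hg, e⟩ := exists_shearMat a b
  refine ⟨g, ⟨hg, ?_, ?_⟩, e⟩ <;> rw [e, shearMat_mulVec] <;> ext i <;> fin_cases i <;> simp

theorem exists_swapMat_fix : ∃ g ∈ realisedFix, g.1 = swapMat := by
  obtain ⟨g, hg, e⟩ := exists_swapMat
  refine ⟨g, ⟨hg, ?_, ?_⟩, e⟩ <;> rw [e, swapMat_mulVec] <;> ext i <;> fin_cases i <;> simp

theorem exists_rotMat_fix : ∃ g ∈ realisedFix, g.1 = rotMat := by
  obtain ⟨g, hg, e⟩ := exists_rotMat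
  refine ⟨g, ⟨hg, ?_, ?_⟩, e⟩ <;> rw [e, rotMat_mulVec] <;> ext i <;> fin_cases i <;> simp

/-- A Hermitian matrix of rank at most one can be diagonalised. -/
theorem exists_realisedFix_diag (n : ℕ) : ∀ v : Fin 6 → ℤ, qL v = 0 → v 0 = 0 →
    (v 2).natAbs ≤ n → ∃ r ∈ realisedFix, ∃ a, r.1 *ᵥ v = ![0, v 1, 0, a, 0, 0] := by
  have base : ∀ v : Fin 6 → ℤ, qL v = 0 → v 0 = 0 → v 2 = 0 →
      ∃ r ∈ realisedFix, ∃ a, r.1 *ᵥ v = ![0, v 1, 0, a, 0, 0] := by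
    intro v hv h0 h2
    -- The vanishing of one diagonal entry of a Hermitian matrix of determinant zero kills the
    -- off-diagonal entry, as the norm is anisotropic.
    have hN : v 4 ^ 2 - v 4 * v 5 + v 5 ^ 2 = 0 := by
      simp only [qL, h0, h2] at hv
      linarith
    obtain ⟨h4, h5⟩ := eq_zero_of_norm_eq_zero hN
    refine ⟨1, one_mem _, v 3, ?_⟩
    rw [Units.val_one, Matrix.one_mulVec]
    ext i
    fin_cases i <;> simp [h0, h2, h4, h5]
  induction n with
  | zero =>
    intro v hv h0 h
    exact base v hv h0 (by omega)
  | succ n ih =>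
    intro v hv h0 hn
    by_cases h2 : v 2 = 0
    · exact base v hv h0 h2
    obtain ⟨a, b, hab⟩ := exists_near_Eis (v 4) (v 5) h2
    obtain ⟨t, ht, et⟩ := exists_shearMat_fix a b
    obtain ⟨s, hs, es⟩ := exists_swapMat_fix
    have hq' : qL (t.1 *ᵥ v) = 0 := (realised_isometry ht.1 v).trans hv
    have hu : qL ((s * t).1 *ᵥ v) = 0 := (realised_isometry (mul_mem hs ht).1 v).trans hv
    have key : (s * t).1 *ᵥ v = swapMat *ᵥ (shearMat a b *ᵥ v) := by
      rw [Units.val_mul, ← Matrix.mulVec_mulVec, es, et]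
    obtain ⟨r, hr, x, er⟩ := ih ((s * t).1 *ᵥ v) hu
      (by rw [key, swapMat_mulVec, shearMat_mulVec]; simpa using h0) (by
      rw [key, swapMat_mulVec]
      simp only [Matrix.cons_val]
      rw [et, shearMat_mulVec] at hq'
      rw [shearMat_mulVec]
      simp only [qL, Matrix.cons_val] at hq' ⊢
      generalize (a ^ 2 - a * b + b ^ 2) * v 2 + v 3 + (2 * a - b) * v 4 + (2 * b - a) * v 5 = y
        at *
      -- With v₀ = 0 isotropy says that v₂y is the norm of the reduced off-diagonal entry, at most
      -- 7/16 of v₂². The swap then puts y in the place of v₂.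
      have e : v 2 * y = (a * v 2 + v 4) ^ 2 - (a * v 2 + v 4) * (b * v 2 + v 5)
          + (b * v 2 + v 5) ^ 2 := by rw [h0] at hq'; linarith
      have hpos : 0 < v 2 ^ 2 := by positivity
      have hN : 0 ≤ v 2 * y := by
        rw [e]
        nlinarith [sq_nonneg (a * v 2 + v 4 - (b * v 2 + v 5)), sq_nonneg (a * v 2 + v 4),
          sq_nonneg (b * v 2 + v 5)]
      have h4 : |v 2 * y| < v 2 ^ 2 := by
        rw [abs_of_nonneg hN]
        linarith
      have h5 : |y| < |v 2| := by
        rw [abs_mul, ← sq_abs, pow_two] at h4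
        exact lt_of_mul_lt_mul_left h4 (abs_nonneg _)
      rw [Int.abs_eq_natAbs, Int.abs_eq_natAbs] at h5
      omega)
    refine ⟨r * (s * t), mul_mem hr (mul_mem hs ht), x, ?_⟩
    rw [Units.val_mul, ← Matrix.mulVec_mulVec, er, key, swapMat_mulVec, shearMat_mulVec]
    simp

theorem exists_add_left (s a b : ℤ) : ∃ r ∈ realised,
    r.1 *ᵥ ![0, b, 0, a, 0, 0] = ![0, b + s * a, 0, a, 0, 0] := by
  obtain ⟨t, ht, et⟩ := exists_transMat (-s) 0 0 0
  refine ⟨t, ht, ?_⟩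
  rw [et, transMat_mulVec]
  ext i
  fin_cases i <;> simp

theorem exists_add_right (s a b : ℤ) : ∃ r ∈ realised,
    r.1 *ᵥ ![0, b, 0, a, 0, 0] = ![0, b, 0, a + s * b, 0, 0] := by
  obtain ⟨t, ht, et⟩ := exists_transMat s 0 0 0
  obtain ⟨j, hj, ej⟩ := exists_invMat
  refine ⟨j * t * j, mul_mem (mul_mem hj ht) hj, ?_⟩
  rw [Units.val_mul, Units.val_mul, ← Matrix.mulVec_mulVec, ← Matrix.mulVec_mulVec, et, ej,
    invMat_mulVec, transMat_mulVec, invMat_mulVec]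
  ext i
  fin_cases i <;> simp [add_comm]

/-- This is the Euclidean algorithm on the pair (a, b): translations add multiples of a to b, and
their conjugates by the inversion add multiples of b to a. -/
theorem exists_realised_gcd (n : ℕ) : ∀ a b : ℤ, a.natAbs ≤ n → ∃ r ∈ realised, ∃ d : ℤ,
    r.1 *ᵥ ![0, b, 0, a, 0, 0] = ![0, d, 0, 0, 0, 0] := by
  induction n with
  | zero =>
    intro a b h
    have : a = 0 := by omega
    exact ⟨1, one_mem _, b, by simp [this]⟩
  | succ n ih =>
    intro a b h
    by_cases ha : a = 0
    · exact ⟨1, one_mem _, b, by simp [ha]⟩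
    -- Taking the remainder of b - 1 and adding 1 puts the new b in the interval from 1 to |a|. It
    -- is nonzero, so a can be reduced modulo it, and the result is strictly smaller than |a|.
    obtain ⟨s, h1, h2⟩ : ∃ s : ℤ, 0 < b + s * a ∧ b + s * a ≤ |a| := by
      have h1 := Int.emod_nonneg (b - 1) ha
      have h2 := Int.emod_lt_abs (b - 1) ha
      have h3 := Int.mul_ediv_add_emod (b - 1) a
      refine ⟨-((b - 1) / a), ?_, ?_⟩ <;> linarith
    obtain ⟨r, hr, er⟩ := exists_add_left s a b
    set b' := b + s * a
    obtain ⟨u, hu, eu⟩ := exists_add_right (-(a / b')) a b'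
    have e1 := Int.emod_nonneg a h1.ne'
    have e2 := Int.emod_lt_of_pos a h1
    have e3 := Int.mul_ediv_add_emod a b'
    have e4 : a + -(a / b') * b' = a % b' := by linarith
    rw [e4] at eu
    obtain ⟨w, hw, d, ew⟩ := ih (a % b') b' (by rw [Int.abs_eq_natAbs] at h2; omega)
    refine ⟨w * (u * r), mul_mem hw (mul_mem hu hr), d, ?_⟩
    rw [Units.val_mul, Units.val_mul, ← Matrix.mulVec_mulVec, ← Matrix.mulVec_mulVec, er, eu, ew]

/-- `realised` is transitive on pairs of opposite primitive isotropic vectors. -/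
theorem exists_realised_isotropic (v : Fin 6 → ℤ) (hv : qL v = 0) :
    ∃ r ∈ realised, ∃ d : ℤ, r.1 *ᵥ v = ![0, d, 0, 0, 0, 0] := by
  obtain ⟨r, hr, er⟩ := exists_realised_apply_zero _ v hv le_rfl
  obtain ⟨s, hs, a, es⟩ := exists_realisedFix_diag _ (r.1 *ᵥ v)
    ((realised_isometry hr v).trans hv) er le_rfl
  obtain ⟨t, ht, d, et⟩ := exists_realised_gcd _ a ((r.1 *ᵥ v) 1) le_rfl
  refine ⟨t * (s * r), mul_mem ht (mul_mem hs.1 hr), d, ?_⟩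
  rw [Units.val_mul, Units.val_mul, ← Matrix.mulVec_mulVec, ← Matrix.mulVec_mulVec, es, et]

/-! ### Cone isometries are realised up to transposition -/

theorem isUnit_of_mulVec {g : GL (Fin 6) ℤ} {k : Fin 6} {d : ℤ} {w : Fin 6 → ℤ}
    (h : g.1 *ᵥ e6 k = d • w) : d = 1 ∨ d = -1 := by
  have h1 := congrArg (fun x => ((g⁻¹).1 *ᵥ x) k) h
  simp only [Matrix.mulVec_mulVec, ← Units.val_mul, inv_mul_cancel, Units.val_one,
    Matrix.one_mulVec, Matrix.mulVec_smul, Pi.smul_apply, Pi.single_eq_same, smul_eq_mul] at h1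
  exact Int.isUnit_iff.mp (IsUnit.of_mul_eq_one _ h1.symm)

theorem bL_e6 (v : Fin 6 → ℤ) : bL v (e6 0) = v 1 ∧ bL v (e6 1) = v 0 ∧ bL v (e6 2) = v 3 ∧
    bL v (e6 3) = v 2 ∧ bL v (e6 4) = v 5 - 2 * v 4 := by
  refine ⟨?_, ?_, ?_, ?_, ?_⟩ <;> simp [bL]

/-- An isometry which preserves the cone over the Hermitian upper half space. -/
def IsConeIsometry (g : GL (Fin 6) ℤ) : Prop := Isometry6 g.1 ∧ PreservesCone g.1

theorem IsConeIsometry.realised_mul {r g : GL (Fin 6) ℤ} (hr : r ∈ realised)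
    (hg : IsConeIsometry g) : IsConeIsometry (r * g) :=
  ⟨(realised_isometry hr).mul hg.1, (realised_preservesCone hr).mul hg.2⟩

/-- The image of a basis vector is isotropic, hence can be moved to a multiple of the same basis
vector. It is primitive, so the multiple is ±1, and -1 lies in `realised`. -/
theorem exists_realised_fix_one {g : GL (Fin 6) ℤ} (hg : IsConeIsometry g) :
    ∃ r ∈ realised, (r * g).1 *ᵥ e6 1 = e6 1 := by
  obtain ⟨r, hr, d, e⟩ := exists_realised_isotropic (g.1 *ᵥ e6 1) (by rw [hg.1]; simp [qL])
  rw [Matrix.mulVec_mulVec, ← Units.val_mul] at e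
  have e' : (r * g).1 *ᵥ e6 1 = d • e6 1 := by
    rw [e]; ext i; fin_cases i <;> simp
  rcases isUnit_of_mulVec e' with rfl | rfl
  · exact ⟨r, hr, by rw [e', one_smul]⟩
  · refine ⟨-1 * r, mul_mem neg_one_mem_realised hr, ?_⟩
    rw [mul_assoc, Units.val_mul, ← Matrix.mulVec_mulVec, e', Units.val_neg, Units.val_one,
      Matrix.neg_mulVec, Matrix.one_mulVec, neg_smul, one_smul, neg_neg]

/-- Pairing with the fixed vector `e6 1` shows that the image of `e6 0` has first coordinate 1, so
it is the image of `e6 0` under a translation; isotropy determines its second coordinate. -/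
theorem exists_realised_fix_zero {g : GL (Fin 6) ℤ} (hg : IsConeIsometry g)
    (h1 : g.1 *ᵥ e6 1 = e6 1) :
    ∃ r ∈ realised, (r * g).1 *ᵥ e6 0 = e6 0 ∧ (r * g).1 *ᵥ e6 1 = e6 1 := by
  set v := g.1 *ᵥ e6 0 with hv
  have v0 : v 0 = 1 := by
    have := hg.1.bL_eq (e6 0) (e6 1)
    rw [h1, ← hv, (bL_e6 _).2.1, (bL_e6 _).2.1] at this
    simpa using this
  have hq : qL v = 0 := by rw [hv, hg.1]; simp [qL]
  simp only [qL, v0] at hq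
  obtain ⟨t, ht, et⟩ := exists_transMat (-v 2) (-v 3) (-v 4) (-v 5)
  refine ⟨t, ht, ?_, ?_⟩
  · rw [Units.val_mul, ← Matrix.mulVec_mulVec, et, ← hv, transMat_mulVec, v0]
    ext i
    fin_cases i <;> simp
    linarith
  · rw [Units.val_mul, ← Matrix.mulVec_mulVec, et, h1, transMat_mulVec]
    ext i
    fin_cases i <;> simp

theorem fix_first {g : Matrix (Fin 6) (Fin 6) ℤ} (hg : Isometry6 g) (h0 : g *ᵥ e6 0 = e6 0)
    (h1 : g *ᵥ e6 1 = e6 1) (v : Fin 6 → ℤ) : (g *ᵥ v) 0 = v 0 ∧ (g *ᵥ v) 1 = v 1 := by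
  have k0 := hg.bL_eq v (e6 0)
  have k1 := hg.bL_eq v (e6 1)
  rw [h0, (bL_e6 _).1, (bL_e6 _).1] at k0
  rw [h1, (bL_e6 _).2.1, (bL_e6 _).2.1] at k1
  exact ⟨k1, k0⟩

theorem I_smul_one_mem_H2 : (Complex.I • 1 : Matrix (Fin 2) (Fin 2) ℂ) ∈ H2 := by
  have : (Complex.I • 1 : Matrix (Fin 2) (Fin 2) ℂ)
      = !![Complex.I, 0 + ω * 0; 0 + ω ^ 2 * 0, Complex.I] := by
    ext i j; fin_cases i <;> fin_cases j <;> simp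
  rw [this, mem_H2_iff]
  simp

theorem H2_im_pos {τ : Matrix (Fin 2) (Fin 2) ℂ} (h : τ ∈ H2) : 0 < (τ 0 0).im := by
  rw [matrix_eq τ, mem_H2_iff] at h
  exact h.1

/-- The orthogonal complement of the first two basis vectors is the lattice of Hermitian matrices,
where `exists_realisedFix_diag` applies. The sign can no longer be corrected by -1; it is excluded
by the half space, since the wrong sign would send τ₀₀ to -τ₀₀. -/
theorem exists_realised_fix_three {g : GL (Fin 6) ℤ} (hg : IsConeIsometry g)
    (h0 : g.1 *ᵥ e6 0 = e6 0) (h1 : g.1 *ᵥ e6 1 = e6 1) :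
    ∃ r ∈ realisedFix, (r * g).1 *ᵥ e6 3 = e6 3 := by
  obtain ⟨k0, k1⟩ := fix_first hg.1 h0 h1 (e6 3)
  obtain ⟨r, hr, d, e⟩ := exists_realisedFix_diag _ (g.1 *ᵥ e6 3) (by rw [hg.1]; simp [qL])
    (by rw [k0]; simp) le_rfl
  refine ⟨r, hr, ?_⟩
  rw [k1, Matrix.mulVec_mulVec, ← Units.val_mul] at e
  have e' : (r * g).1 *ᵥ e6 3 = d • e6 3 := by
    rw [e]; ext i; fin_cases i <;> simp
  rcases isUnit_of_mulVec e' with rfl | rfl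
  · rw [e', one_smul]
  exfalso
  have hrg := hg.realised_mul hr.1
  have f0 : (r * g).1 *ᵥ e6 0 = e6 0 := by
    rw [Units.val_mul, ← Matrix.mulVec_mulVec, h0, hr.2.1]
  have f1 : (r * g).1 *ᵥ e6 1 = e6 1 := by
    rw [Units.val_mul, ← Matrix.mulVec_mulVec, h1, hr.2.2]
  have row0 : ∀ j, (r * g).1 0 j = e6 j 0 := fun j => by
    rw [← (fix_first hrg.1 f0 f1 (e6 j)).1, Matrix.mulVec_single_one]; rfl
  have row2 : ∀ j, (r * g).1 2 j = -e6 j 2 := fun j => by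
    have := hrg.1.bL_eq (e6 j) (e6 3)
    rw [e', (bL_e6 _).2.2.2.1, Matrix.mulVec_single_one, bL] at this
    simp at this
    rw [← this]
    simp
  -- Test point τ = i: row 0 forces the scalar c to be 1, and row 2 then gives τ₀₀ the value -i.
  obtain ⟨c, hc, τ, hτ, eτ⟩ := hrg.2 _ I_smul_one_mem_H2
  generalize (r * g).1 = A at row0 row2 eτ
  have c0 := congrFun eτ 0
  have c2 := congrFun eτ 2
  simp [toC, Matrix.mulVec, dotProduct, Fin.sum_univ_six, row0, row2, vecL] at c0 c2
  rw [← c0, one_mul] at c2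
  have := H2_im_pos hτ
  rw [← c2] at this
  simp at this
  linarith

theorem exists_realised_fix_two {g : GL (Fin 6) ℤ} (hg : IsConeIsometry g)
    (h0 : g.1 *ᵥ e6 0 = e6 0) (h1 : g.1 *ᵥ e6 1 = e6 1) (h3 : g.1 *ᵥ e6 3 = e6 3) :
    ∃ r ∈ realisedFix, (r * g).1 *ᵥ e6 3 = e6 3 ∧ (r * g).1 *ᵥ e6 2 = e6 2 := by
  obtain ⟨k0, k1⟩ := fix_first hg.1 h0 h1 (e6 2)
  set v := g.1 *ᵥ e6 2 with hv
  have v2 : v 2 = 1 := by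
    have := hg.1.bL_eq (e6 2) (e6 3)
    rw [h3, ← hv, (bL_e6 _).2.2.2.1, (bL_e6 _).2.2.2.1] at this
    simpa using this
  have v0 : v 0 = 0 := by rw [k0]; simp
  have v1 : v 1 = 0 := by rw [k1]; simp
  have hq : qL v = 0 := by rw [hv, hg.1]; simp [qL]
  simp only [qL, v2, v0] at hq
  obtain ⟨t, ht, et⟩ := exists_shearMat_fix (-v 4) (-v 5)
  refine ⟨t, ht, ?_, ?_⟩
  · rw [Units.val_mul, ← Matrix.mulVec_mulVec, et, h3, shearMat_mulVec]
    ext i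
    fin_cases i <;> simp
  · rw [Units.val_mul, ← Matrix.mulVec_mulVec, et, ← hv, shearMat_mulVec, v0, v1, v2]
    ext i
    fin_cases i <;> simp
    linarith

/-- The transposition `τ ↦ ᵗτ`. -/
def transpMat : Matrix (Fin 6) (Fin 6) ℤ :=
  !![1, 0, 0, 0, 0, 0;
     0, 1, 0, 0, 0, 0;
     0, 0, 1, 0, 0, 0;
     0, 0, 0, 1, 0, 0;
     0, 0, 0, 0, 1, -1;
     0, 0, 0, 0, 0, -1]

theorem toC_transpMat_mulVec (v : Fin 6 → ℂ) :
    toC transpMat *ᵥ v = ![v 0, v 1, v 2, v 3, v 4 - v 5, -v 5] := by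
  ext i
  fin_cases i <;> simp [toC, transpMat, Matrix.mulVec, dotProduct, Fin.sum_univ_six]
  ring

theorem transpMat_mul_self : transpMat * transpMat = 1 := by decide

/-- The transposition `τ ↦ ᵗτ` as an element of `GL₆(ℤ)`. -/
def transpGL : GL (Fin 6) ℤ := ⟨transpMat, transpMat, transpMat_mul_self, transpMat_mul_self⟩

theorem exists_rot_pow (k : ℕ) : ∃ r ∈ realisedFix, r.1 = rotMat ^ k := by
  obtain ⟨r, hr, e⟩ := exists_rotMat_fix
  exact ⟨r ^ k, pow_mem hr k, by rw [Units.val_pow_eq_pow_val, e]⟩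

/-- On a + bω, `rotMat` is multiplication by -ω², a unit of order six, so its powers are transitive
on the six units. -/
theorem exists_rot_norm_one {a b : ℤ} (h : a ^ 2 - a * b + b ^ 2 = 1) :
    ∃ k : ℕ, rotMat ^ k *ᵥ e6 2 = e6 2 ∧ rotMat ^ k *ᵥ e6 3 = e6 3 ∧
      rotMat ^ k *ᵥ ![0, 0, 0, 0, a, b] = e6 4 := by
  rcases int_norm_eq_one h with ⟨rfl, rfl⟩ | ⟨rfl, rfl⟩ | ⟨rfl, rfl⟩ | ⟨rfl, rfl⟩ | ⟨rfl, rfl⟩ |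
    ⟨rfl, rfl⟩
  exacts [⟨0, by decide⟩, ⟨5, by decide⟩, ⟨4, by decide⟩, ⟨3, by decide⟩, ⟨2, by decide⟩,
    ⟨1, by decide⟩]

/-- The image of the last basis vector is determined, up to one coordinate, by its pairings with the
fixed vectors. Its norm leaves a quadratic equation t(t + 1) = 0: the two roots of A₂ making the
given angle with the fixed root. -/
theorem eq_one_or_transp {g : GL (Fin 6) ℤ} (hg : Isometry6 g.1)
    (h : ∀ k : Fin 6, k < 5 → g.1 *ᵥ e6 k = e6 k) : g = 1 ∨ g = transpGL := by
  have b := fun k (hk : k < 5) => (h k hk) ▸ hg.bL_eq (e6 5) (e6 k)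
  set t := g.1 *ᵥ e6 5 with ht
  have t1 : t 1 = 0 := by have := b 0 (by decide); rw [(bL_e6 _).1, (bL_e6 _).1] at this; simpa using this
  have t0 : t 0 = 0 := by
    have := b 1 (by decide); rw [(bL_e6 _).2.1, (bL_e6 _).2.1] at this; simpa using this
  have t3 : t 3 = 0 := by
    have := b 2 (by decide); rw [(bL_e6 _).2.2.1, (bL_e6 _).2.2.1] at this; simpa using this
  have t2 : t 2 = 0 := by
    have := b 3 (by decide); rw [(bL_e6 _).2.2.2.1, (bL_e6 _).2.2.2.1] at this; simpa using this
  have t4 : t 5 = 2 * t 4 + 1 := by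
    have := b 4 (by decide); rw [(bL_e6 _).2.2.2.2, (bL_e6 _).2.2.2.2] at this
    simp at this; linarith
  have hq : qL t = -1 := by rw [ht, hg]; simp [qL]
  simp only [qL, t0, t2, t4] at hq
  have h4 : t 4 = 0 ∨ t 4 = -1 := by
    have : t 4 * (t 4 + 1) = 0 := by linarith
    rcases mul_eq_zero.mp this with h | h
    · exact Or.inl h
    · exact Or.inr (by linarith)
  have col : ∀ (A : GL (Fin 6) ℤ), (∀ k : Fin 6, k < 5 → A.1 *ᵥ e6 k = e6 k) →
      A.1 *ᵥ e6 5 = t → g = A := by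
    intro A hA hA5
    apply Units.ext
    refine Matrix.ext_of_mulVec_single fun k => ?_
    by_cases hk : k < 5
    · exact (h k hk).trans (hA k hk).symm
    · have : k = 5 := by omega
      rw [this]
      exact ht.symm.trans hA5.symm
  rcases h4 with h4 | h4
  · left
    refine col 1 (fun _ _ => Matrix.one_mulVec _) ?_
    rw [Units.val_one, Matrix.one_mulVec]
    ext i
    fin_cases i <;> simp [t0, t1, t2, t3, t4, h4]
  · right
    refine col transpGL (by decide) ?_
    have : transpGL.1 *ᵥ e6 5 = ![0, 0, 0, 0, -1, -1] := by decide
    rw [this]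
    ext i
    fin_cases i <;> simp [t0, t1, t2, t3, t4, h4]

/-- Left multiplication by realised matrices successively fixes `e6 1`, `e6 0`, `e6 3`, `e6 2` and
finally, by a unit rotation, `e6 4`. Only the identity and the transposition fix all five. -/
theorem mem_realised_or {g : GL (Fin 6) ℤ} (hg : IsConeIsometry g) :
    g ∈ realised ∨ g * transpGL ∈ realised := by
  obtain ⟨r1, hr1, e1⟩ := exists_realised_fix_one hg
  obtain ⟨r2, hr2, e2⟩ := exists_realised_fix_zero (hg.realised_mul hr1) e1
  have H2 := (hg.realised_mul hr1).realised_mul hr2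
  obtain ⟨r3, hr3, e3⟩ := exists_realised_fix_three H2 e2.1 e2.2
  have H3 := H2.realised_mul hr3.1
  have fix : ∀ {r k : GL (Fin 6) ℤ}, r ∈ realisedFix → k.1 *ᵥ e6 0 = e6 0 ∧ k.1 *ᵥ e6 1 = e6 1 →
      (r * k).1 *ᵥ e6 0 = e6 0 ∧ (r * k).1 *ᵥ e6 1 = e6 1 := by
    rintro r k ⟨-, h0, h1⟩ ⟨k0, k1⟩
    rw [Units.val_mul, ← Matrix.mulVec_mulVec, ← Matrix.mulVec_mulVec, k0, k1, h0, h1]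
    exact ⟨rfl, rfl⟩
  have f3 := fix hr3 e2
  obtain ⟨r4, hr4, e4⟩ := exists_realised_fix_two H3 f3.1 f3.2 e3
  have H4 := H3.realised_mul hr4.1
  have f4 := fix hr4 f3
  set k := r4 * (r3 * (r2 * (r1 * g))) with hk
  have key : ∃ r ∈ realised, r * k = 1 ∨ r * k = transpGL := by
    have b := fun l (h : k.1 *ᵥ e6 l = e6 l) => h ▸ H4.1.bL_eq (e6 4) (e6 l)
    set u := k.1 *ᵥ e6 4 with hu
    have u1 : u 1 = 0 := by
      have := b 0 f4.1; rw [(bL_e6 _).1, (bL_e6 _).1] at this; simpa using this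
    have u0 : u 0 = 0 := by
      have := b 1 f4.2; rw [(bL_e6 _).2.1, (bL_e6 _).2.1] at this; simpa using this
    have u3 : u 3 = 0 := by
      have := b 2 e4.2; rw [(bL_e6 _).2.2.1, (bL_e6 _).2.2.1] at this; simpa using this
    have u2 : u 2 = 0 := by
      have := b 3 e4.1; rw [(bL_e6 _).2.2.2.1, (bL_e6 _).2.2.2.1] at this; simpa using this
    have hq : qL u = -1 := by rw [hu, H4.1]; simp [qL]
    simp only [qL, u0, u2] at hq
    obtain ⟨n, n2, n3, n4⟩ := exists_rot_norm_one (a := u 4) (b := u 5) (by linarith)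
    obtain ⟨r, hr, er⟩ := exists_rot_pow n
    rw [← er] at n2 n3 n4
    have hu' : u = ![0, 0, 0, 0, u 4, u 5] := by
      ext i; fin_cases i <;> simp [u0, u1, u2, u3]
    refine ⟨r, hr.1, eq_one_or_transp (H4.realised_mul hr.1).1 fun l hl => ?_⟩
    rw [Units.val_mul, ← Matrix.mulVec_mulVec]
    have : l = 0 ∨ l = 1 ∨ l = 2 ∨ l = 3 ∨ l = 4 := by omega
    rcases this with rfl | rfl | rfl | rfl | rfl
    · rw [f4.1, hr.2.1]
    · rw [f4.2, hr.2.2]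
    · rw [e4.2, n2]
    · rw [e4.1, n3]
    · rw [← hu, hu', n4]
  obtain ⟨r, hr, e⟩ := key
  have hR : r * r4 * r3 * r2 * r1 ∈ realised :=
    mul_mem (mul_mem (mul_mem (mul_mem hr hr4.1) hr3.1) hr2) hr1
  have eg : r * k = (r * r4 * r3 * r2 * r1) * g := by rw [hk]; group
  rw [eg] at e
  rcases e with e | e
  · left
    rw [eq_inv_of_mul_eq_one_right e]
    exact inv_mem hR
  · right
    have t2 : transpGL * transpGL = 1 := Units.ext transpMat_mul_self
    rw [eq_inv_mul_of_mul_eq e, mul_assoc, t2, mul_one]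
    exact inv_mem hR

/-! ### The transposition is not realised -/

theorem latCoord_surjective (p : Fin 6 → ℂ) : ∃ w, latCoord w = p := by
  have h := ω_sub_ne
  refine ⟨![p 0, p 1, p 2, p 3, p 4 - ω * ((p 4 - p 5) / (ω - ω ^ 2)), (p 4 - p 5) / (ω - ω ^ 2)],
    ?_⟩
  have hc : (p 4 - p 5) / (ω - ω ^ 2) * (ω - ω ^ 2) = p 4 - p 5 := div_mul_cancel₀ _ h
  ext i
  fin_cases i <;> simp [latCoord]
  linear_combination -hc

/-- No matrix realises the transposition `τ ↦ ᵗτ`. -/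
theorem not_realises_transp {k : Mat4} {c : ℂ} (hc : c ≠ 0) : ¬ Realises k transpMat c := by
  intro H
  -- The transposition swaps p₄ and p₅. Conceptually it has determinant -1 on the six-dimensional
  -- space, while congruence by k has determinant (det k)³ and scales `pf` by det k = c²; comparing
  -- gives -c⁶ = c⁶. The proof below uses minors instead.
  have key : ∀ p : Fin 6 → ℂ, congrCoord k p = c • ![p 0, p 1, p 2, p 3, p 5, p 4] := by
    intro p
    obtain ⟨w, rfl⟩ := latCoord_surjective p
    have e : latCoord ![w 0, w 1, w 2, w 3, w 4 - w 5, -w 5] = ![latCoord w 0, latCoord w 1,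
        latCoord w 2, latCoord w 3, latCoord w 5, latCoord w 4] := by
      ext i
      fin_cases i <;> simp [latCoord]
      · linear_combination (-w 5) * ω_quad
      · linear_combination (-w 5) * ω_quad
    rw [H w, toC_transpMat_mulVec, e]
  have k1 := key ![0, 1, 0, 0, 0, 0]
  have k2 := key ![0, 0, 1, 0, 0, 0]
  have k4 := key ![0, 0, 0, 0, 1, 0]
  rw [congrCoord_eq] at k1 k2 k4
  have a1 := congrFun k1 1
  have a2 := congrFun k1 2
  have a3 := congrFun k1 3
  have a4 := congrFun k1 4
  have a5 := congrFun k1 5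
  have b2 := congrFun k2 2
  have b5 := congrFun k2 5
  have d5 := congrFun k4 5
  simp [skewForm] at a1 a2 a3 a4 a5 b2 b5 d5
  generalize k (.inl 0) (.inl 0) = a00 at *
  generalize k (.inl 0) (.inl 1) = a01 at *
  generalize k (.inl 1) (.inl 0) = a10 at *
  generalize k (.inl 1) (.inl 1) = a11 at *
  generalize k (.inr 0) (.inl 0) = c00 at *
  generalize k (.inr 0) (.inl 1) = c01 at *
  generalize k (.inr 1) (.inl 0) = c10 at *
  generalize k (.inr 1) (.inl 1) = c11 at *
  -- The wedge of the first two columns of k is c times that of the first two coordinate vectors.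
  -- They span the first coordinate plane, so their lower entries vanish.
  have hc10 : c10 = 0 := by
    have : c * c10 = 0 := by grind
    exact (mul_eq_zero.mp this).resolve_left hc
  subst hc10
  simp at b2 b5 d5
  rcases b5 with rfl | h
  · simp at d5; exact hc d5.symm
  · rw [h] at b2; simp at b2; exact hc b2.symm

/-- Otherwise the transposition would be a product of realised matrices. What is gained over
`exists_GL_realises` is that the integral matrix has determinant 1. -/
theorem exists_realised_realises {h : GL4} (hh : h ∈ HG) (hd : h.1.det = 1) :
    ∃ g ∈ realised, Realises h.1 g.1 1 := by
  obtain ⟨g, hg⟩ := exists_GL_realises hh hd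
  refine ⟨g, ?_, hg⟩
  rcases mem_realised_or ⟨hg.isometry hh (Or.inl rfl), hg.preservesCone hh one_ne_zero⟩ with h1 | h1
  · exact h1
  · exfalso
    obtain ⟨-, k, hk, c, hc, K⟩ := h1
    have := (hg.inv (Or.inl rfl)).mul K
    rw [← Units.val_mul, ← Units.val_mul, inv_mul_cancel_left] at this
    exact not_realises_transp (by rcases hc with rfl | rfl <;> norm_num) this

/-! ### The congruence subgroup and parity of minors -/

/-- The elements of `2 ℤ[ω]`. -/
def EvenEis (x : ℂ) : Prop := ∃ c ∈ Eis, x = 2 * c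

theorem EvenEis.add {x y : ℂ} (hx : EvenEis x) (hy : EvenEis y) : EvenEis (x + y) := by
  obtain ⟨a, ha, rfl⟩ := hx
  obtain ⟨b, hb, rfl⟩ := hy
  exact ⟨a + b, add_mem ha hb, by ring⟩

theorem EvenEis.mul {x y : ℂ} (hx : x ∈ Eis) (hy : EvenEis y) : EvenEis (x * y) := by
  obtain ⟨b, hb, rfl⟩ := hy
  exact ⟨x * b, mul_mem hx hb, by ring⟩

theorem EvenEis.neg {x : ℂ} (hx : EvenEis x) : EvenEis (-x) := by
  obtain ⟨a, ha, rfl⟩ := hx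
  exact ⟨-a, neg_mem ha, by ring⟩

theorem EvenEis.sub {x y : ℂ} (hx : EvenEis x) (hy : EvenEis y) : EvenEis (x - y) := by
  rw [sub_eq_add_neg]; exact hx.add hy.neg

theorem EvenEis.two_dvd {n : ℤ} (h : EvenEis n) : 2 ∣ n := by
  obtain ⟨c, hc, e⟩ := h
  exact int_dvd_of_Eis hc (by exact_mod_cast e)

theorem evenEis_intCast {n : ℤ} (h : 2 ∣ n) : EvenEis n := by
  obtain ⟨k, rfl⟩ := h
  exact ⟨k, intCast_mem_Eis k, by push_cast; ring⟩

theorem EvenEis.two_dvd_of_add {a b : ℤ} (h : EvenEis (a + ω * b)) : 2 ∣ a ∧ 2 ∣ b := by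
  obtain ⟨c, hc, e⟩ := h
  obtain ⟨x, y, rfl⟩ := mem_Eis_iff.mp hc
  have e' : (a + b * ω : ℂ) = ((2 * x : ℤ) : ℂ) + ((2 * y : ℤ) : ℂ) * ω := by
    push_cast; linear_combination e
  obtain ⟨rfl, rfl⟩ := Eis_ext.mp e'
  exact ⟨⟨x, rfl⟩, ⟨y, rfl⟩⟩

theorem toC_mulVec_single (g : Matrix (Fin 6) (Fin 6) ℤ) (j : Fin 6) :
    toC g *ᵥ Pi.single j 1 = fun i => (g i j : ℂ) := by
  rw [Matrix.mulVec_single_one]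
  rfl

/-- If the first row of `g` is congruent to a multiple of `(1, 0, ⋯, 0)` modulo `2`, then the
matrix realising `g` lies in `HΓ₀(2)`. -/
theorem mem_HG02_of_row {h : GL4} {g : Matrix (Fin 6) (Fin 6) ℤ} {c : ℂ} (hh : h ∈ HG)
    (hc : c = 1 ∨ c = -1) (H : Realises h.1 g c) (h0 : ¬ 2 ∣ g 0 0)
    (hrow : ∀ j, j ≠ 0 → 2 ∣ g 0 j) : h ∈ HG02 := by
  have hcE : c ∈ Eis := by
    rcases hc with rfl | rfl
    exacts [one_mem _, neg_mem (one_mem _)]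
  have hc2 : c * c = 1 := by rcases hc with rfl | rfl <;> norm_num
  have hE : ∀ i j, h.1 i j ∈ Eis := fun i j => (hh.1 i j).1
  have row : ∀ j, skewForm (latCoord (Pi.single j 1)) (h.1 (.inr 0)) (h.1 (.inr 1))
      = c * g 0 j := by
    intro j
    have := congrFun (H (Pi.single j 1)) 0
    rw [congrCoord_eq, toC_mulVec_single] at this
    simpa [latCoord] using this
  have ev : ∀ j, j ≠ 0 → EvenEis (c * g 0 j) := fun j hj =>
    EvenEis.mul hcE (evenEis_intCast (hrow j hj))
  have e0 := row 0
  have e2 := ev 2 (by decide)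
  have e3 := ev 3 (by decide)
  have e4 := ev 4 (by decide)
  have e5 := ev 5 (by decide)
  rw [← row] at e2 e3 e4 e5
  simp [skewForm, latCoord] at e0 e2 e3 e4 e5
  obtain ⟨m, hm⟩ : ∃ m, g 0 0 = 2 * m + 1 := by
    refine ⟨g 0 0 / 2, ?_⟩
    omega
  -- The first row of g lists combinations of the 2 × 2 minors of (C D), and c times its first entry
  -- is det D, which is odd and can be cancelled.
  have cancel : ∀ x ∈ Eis, EvenEis (x * (c * g 0 0)) → EvenEis x := by
    intro x hx hxe
    have h1 := (EvenEis.mul hcE hxe).sub ⟨m * x, mul_mem (intCast_mem_Eis m) hx, rfl⟩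
    have : c * (x * (c * g 0 0)) - 2 * (m * x) = x := by
      rw [hm]; push_cast; linear_combination (x * (2 * m + 1)) * hc2
    rwa [this] at h1
  have hω : ω ∈ Eis := ω_mem_Eis
  have hω2 : ω ^ 2 ∈ Eis := pow_mem hω 2
  have three : ∀ x ∈ Eis, EvenEis ((-3) * x) → EvenEis x := by
    intro x hx h3
    have := h3.add ⟨2 * x, mul_mem (by simpa using intCast_mem_Eis 2) hx, rfl⟩
    have e : -3 * x + 2 * (2 * x) = x := by ring
    rwa [e] at this
  have h00 := hE (.inr 0) (.inl 0)
  have h01 := hE (.inr 0) (.inl 1)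
  have h10 := hE (.inr 1) (.inl 0)
  have h11 := hE (.inr 1) (.inl 1)
  have k00 := hE (.inr 0) (.inr 0)
  have k01 := hE (.inr 0) (.inr 1)
  have k10 := hE (.inr 1) (.inr 0)
  have k11 := hE (.inr 1) (.inr 1)
  refine ⟨hh, ?_⟩
  generalize h.1 (.inr 0) (.inr 0) = d00 at *
  generalize h.1 (.inr 0) (.inr 1) = d01 at *
  generalize h.1 (.inr 1) (.inr 0) = d10 at *
  generalize h.1 (.inr 1) (.inr 1) = d11 at *
  suffices EvenEis (h.1 (.inr 0) (.inl 0)) ∧ EvenEis (h.1 (.inr 0) (.inl 1)) ∧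
      EvenEis (h.1 (.inr 1) (.inl 0)) ∧ EvenEis (h.1 (.inr 1) (.inl 1)) by
    obtain ⟨p1, p2, p3, p4⟩ := this
    intro i j
    fin_cases i <;> fin_cases j
    exacts [p1, p2, p3, p4]
  generalize h.1 (.inr 0) (.inl 0) = c00 at *
  generalize h.1 (.inr 0) (.inl 1) = c01 at *
  generalize h.1 (.inr 1) (.inl 0) = c10 at *
  generalize h.1 (.inr 1) (.inl 1) = c11 at *
  -- The entries in columns 4 and 5 mix two minors with coefficients 1, 1 and ω, ω². Separating them
  -- costs (ω - ω²)² = -3, which is odd.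
  have m4 : EvenEis (c00 * d10 - d00 * c10) := by
    apply three _ (sub_mem (mul_mem h00 k10) (mul_mem k00 h10))
    have := EvenEis.mul (sub_mem hω hω2) ((EvenEis.mul hω2 e4).sub e5)
    convert this using 1
    grind [ω_quad]
  have m5 : EvenEis (c01 * d11 - d01 * c11) := by
    apply three _ (sub_mem (mul_mem h01 k11) (mul_mem k01 h11))
    have := EvenEis.mul (sub_mem hω hω2) ((EvenEis.mul hω e4).sub e5)
    convert this using 1
    grind [ω_quad]
  -- Cramer's rule writes each entry of C times det D as a combination of the minors with one column
  -- from C and one from D, all of which are even.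
  refine ⟨cancel _ h00 ?_, cancel _ h01 ?_, cancel _ h10 ?_, cancel _ h11 ?_⟩ <;> rw [← e0]
  · convert (EvenEis.mul k00 e2).sub (EvenEis.mul k01 m4) using 1
    ring
  · convert (EvenEis.mul k00 m5).add (EvenEis.mul k01 e3) using 1
    ring
  · convert (EvenEis.mul k10 e2).sub (EvenEis.mul k11 m4) using 1
    ring
  · convert (EvenEis.mul k10 m5).add (EvenEis.mul k11 e3) using 1
    ring

/-- The second column of g is the wedge of the first two columns of h. Its entries are the minors of
(A; C): det C up to sign, divisible by 4, the mixed minors, which are even, and det A up to sign in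
position `g 1 1`. -/
theorem HG02_realised {h : GL4} {g : Matrix (Fin 6) (Fin 6) ℤ} (hh : h ∈ HG02)
    (H : Realises h.1 g 1) : 4 ∣ g 0 1 ∧ ∀ i, i ≠ 1 → 2 ∣ g i 1 := by
  have hE : ∀ i j, h.1 i j ∈ Eis := fun i j => (hh.1.1 i j).1
  have hC : ∀ i j, EvenEis (h.1 (.inr i) (.inl j)) := fun i j => hh.2 i j
  have col := H (Pi.single 1 1)
  rw [congrCoord_eq, toC_mulVec_single, one_smul] at col
  have c0 := congrFun col 0
  have c2 := congrFun col 2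
  have c3 := congrFun col 3
  have c4 := congrFun col 4
  simp [skewForm, latCoord] at c0 c2 c3 c4
  have mixed : ∀ i j, EvenEis (h.1 (.inl i) (.inl 1) * h.1 (.inr j) (.inl 0)
      - h.1 (.inl i) (.inl 0) * h.1 (.inr j) (.inl 1)) := fun i j =>
    (EvenEis.mul (hE _ _) (hC _ _)).sub (EvenEis.mul (hE _ _) (hC _ _))
  have h4 : 4 ∣ g 0 1 := by
    obtain ⟨a, ha, ea⟩ := hC 0 0
    obtain ⟨b, hb, eb⟩ := hC 0 1
    obtain ⟨c, hc, ec⟩ := hC 1 0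
    obtain ⟨d, hd, ed⟩ := hC 1 1
    refine int_dvd_of_Eis (sub_mem (mul_mem hb hc) (mul_mem ha hd)) ?_
    rw [← c0, ea, eb, ec, ed]
    push_cast
    ring
  refine ⟨h4, ?_⟩
  have h2 : 2 ∣ g 2 1 := by
    apply EvenEis.two_dvd
    rw [← c2]
    convert mixed 0 1 using 1
  have h3 : 2 ∣ g 3 1 := by
    apply EvenEis.two_dvd
    rw [← c3]
    convert (mixed 1 0).neg using 1
    ring
  have h45 : 2 ∣ g 4 1 ∧ 2 ∣ g 5 1 := by
    apply EvenEis.two_dvd_of_add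
    rw [← c4]
    convert (mixed 0 0).neg using 1
    ring
  intro i hi
  fin_cases i
  · exact (by norm_num : (2 : ℤ) ∣ 4).trans h4
  · exact absurd rfl hi
  · exact h2
  · exact h3
  · exact h45.1
  · exact h45.2

/-! ### Comparison of the lattices `U ⊕ U ⊕ A₂` and `U ⊕ U(2) ⊕ A₂(2)` -/

/-- The embedding of `U ⊕ U ⊕ A₂`, with the form doubled, into `U ⊕ U(2) ⊕ A₂(2)`. -/
def dM : Matrix (Fin 6) (Fin 6) ℤ := Matrix.diagonal ![1, 2, 1, 1, 1, 1]

theorem dM_ne (i : Fin 6) : (![1, 2, 1, 1, 1, 1] : Fin 6 → ℤ) i ≠ 0 := by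
  fin_cases i <;> norm_num

theorem dM_mul_cancel {X Y : Matrix (Fin 6) (Fin 6) ℤ} (h : dM * X = dM * Y) : X = Y := by
  ext i j
  have := congrFun (congrFun h i) j
  rw [dM, Matrix.diagonal_mul, Matrix.diagonal_mul] at this
  exact mul_left_cancel₀ (dM_ne i) this

theorem mul_dM_cancel {X Y : Matrix (Fin 6) (Fin 6) ℤ} (h : X * dM = Y * dM) : X = Y := by
  ext i j
  have := congrFun (congrFun h i) j
  rw [dM, Matrix.mul_diagonal, Matrix.mul_diagonal] at this
  exact mul_right_cancel₀ (dM_ne j) this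

/-- The parity condition says that A preserves the sublattice where the second coordinate is even,
which is the image of `dM`. -/
theorem exists_restrict {A : Matrix (Fin 6) (Fin 6) ℤ} (h : ∀ j, j ≠ 1 → 2 ∣ A 1 j) :
    ∃ B, A * dM = dM * B := by
  refine ⟨Matrix.of fun i j => if i = 1 then (if j = 1 then A i j else A i j / 2)
    else A i j * (![1, 2, 1, 1, 1, 1] : Fin 6 → ℤ) j, ?_⟩
  ext i j
  rw [dM, Matrix.mul_diagonal, Matrix.diagonal_mul, Matrix.of_apply]
  by_cases hi : i = 1
  · subst hi
    by_cases hj : j = 1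
    · subst hj; simp [mul_comm]
    · have e : (![1, 2, 1, 1, 1, 1] : Fin 6 → ℤ) j = 1 := by
        fin_cases j <;> simp at hj ⊢
      rw [if_pos rfl, if_neg hj, e, mul_one]
      exact (Int.mul_ediv_cancel' (h j hj)).symm
  · have e : (![1, 2, 1, 1, 1, 1] : Fin 6 → ℤ) i = 1 := by
      fin_cases i <;> simp at hi ⊢
    rw [if_neg hi, e, one_mul]

theorem exists_extend {B : Matrix (Fin 6) (Fin 6) ℤ} (h : ∀ i, i ≠ 1 → 2 ∣ B i 1) :
    ∃ A, A * dM = dM * B := by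
  refine ⟨Matrix.of fun i j => if j = 1 then (if i = 1 then B i j else B i j / 2)
    else (![1, 2, 1, 1, 1, 1] : Fin 6 → ℤ) i * B i j, ?_⟩
  ext i j
  rw [dM, Matrix.mul_diagonal, Matrix.diagonal_mul, Matrix.of_apply]
  by_cases hj : j = 1
  · subst hj
    by_cases hi : i = 1
    · subst hi; simp [mul_comm]
    · have e : (![1, 2, 1, 1, 1, 1] : Fin 6 → ℤ) i = 1 := by
        fin_cases i <;> simp at hi ⊢
      rw [if_pos rfl, if_neg hi, e, one_mul]
      exact Int.ediv_mul_cancel (h i hi)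
  · have e : (![1, 2, 1, 1, 1, 1] : Fin 6 → ℤ) j = 1 := by
      fin_cases j <;> simp at hj ⊢
    rw [if_neg hj, e, mul_one]

/-- Both g and its inverse restrict to the sublattice, so the restriction is invertible over ℤ. -/
theorem exists_restrict_GL {g : GL (Fin 6) ℤ} (hg : g ∈ OMplus0) :
    ∃ k : GL (Fin 6) ℤ, g.1 * dM = dM * k.1 := by
  have ev : ∀ g : GL (Fin 6) ℤ, g ∈ OMplus0 → ∀ j, j ≠ 1 → 2 ∣ g.1 1 j := by
    intro g hg j hj
    have := rows_mod_two hg.1.1 hg.2 1 j (by decide)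
    rwa [Matrix.one_apply_ne hj.symm, sub_zero] at this
  obtain ⟨A, hA⟩ := exists_restrict (ev g hg)
  obtain ⟨B, hB⟩ := exists_restrict (ev g⁻¹ (inv_mem hg))
  refine ⟨⟨A, B, dM_mul_cancel ?_, dM_mul_cancel ?_⟩, hA⟩
  · rw [← Matrix.mul_assoc, ← hA, Matrix.mul_assoc, ← hB, ← Matrix.mul_assoc, ← Units.val_mul,
      mul_inv_cancel, Units.val_one, Matrix.one_mul, Matrix.mul_one]
  · rw [← Matrix.mul_assoc, ← hB, Matrix.mul_assoc, ← hA, ← Matrix.mul_assoc, ← Units.val_mul,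
      inv_mul_cancel, Units.val_one, Matrix.one_mul, Matrix.mul_one]

theorem exists_extend_GL {k : GL (Fin 6) ℤ} (h : ∀ i, i ≠ 1 → 2 ∣ k.1 i 1)
    (h' : ∀ i, i ≠ 1 → 2 ∣ (k⁻¹).1 i 1) : ∃ g : GL (Fin 6) ℤ, g.1 * dM = dM * k.1 := by
  obtain ⟨A, hA⟩ := exists_extend h
  obtain ⟨B, hB⟩ := exists_extend h'
  refine ⟨⟨A, B, mul_dM_cancel ?_, mul_dM_cancel ?_⟩, hA⟩
  · rw [Matrix.mul_assoc, hB, ← Matrix.mul_assoc, hA, Matrix.mul_assoc, ← Units.val_mul,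
      mul_inv_cancel, Units.val_one, Matrix.one_mul, Matrix.mul_one]
  · rw [Matrix.mul_assoc, hA, ← Matrix.mul_assoc, hB, Matrix.mul_assoc, ← Units.val_mul,
      inv_mul_cancel, Units.val_one, Matrix.one_mul, Matrix.mul_one]

theorem det_eq_of_mul_dM {g k : Matrix (Fin 6) (Fin 6) ℤ} (h : g * dM = dM * k) :
    g.det = k.det := by
  have := congrArg Matrix.det h
  rw [Matrix.det_mul, Matrix.det_mul, mul_comm] at this
  refine mul_left_cancel₀ ?_ this
  rw [dM, Matrix.det_diagonal]
  exact Finset.prod_ne_zero_iff.mpr fun i _ => dM_ne i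

/-- The bilinear form of `M`. -/
def bM (v w : Fin 6 → ℤ) : ℤ := v ⬝ᵥ Q *ᵥ w

theorem bM_eq (v w : Fin 6 → ℤ) : bM v w = v 0 * w 1 + v 1 * w 0 + 2 * v 2 * w 3 + 2 * v 3 * w 2
    - 4 * v 4 * w 4 + 2 * v 4 * w 5 + 2 * v 5 * w 4 - 4 * v 5 * w 5 := by
  simp [bM, Q, dotProduct, Matrix.mulVec, Fin.sum_univ_six]
  ring

theorem bM_dM (w : Fin 6 → ℤ) : bM (dM *ᵥ w) (dM *ᵥ w) = 4 * qL w := by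
  have e : ∀ i, (dM *ᵥ w) i = (![1, 2, 1, 1, 1, 1] : Fin 6 → ℤ) i * w i := fun i => by
    rw [dM, Matrix.mulVec_diagonal]
  rw [bM_eq]
  simp only [e, qL, Matrix.cons_val]
  ring

theorem bM_mulVec (A : Matrix (Fin 6) (Fin 6) ℤ) (v w : Fin 6 → ℤ) :
    bM (A *ᵥ v) (A *ᵥ w) = v ⬝ᵥ (Aᵀ * Q * A) *ᵥ w := by
  rw [bM, ← Matrix.mulVec_mulVec, ← Matrix.mulVec_mulVec, Matrix.dotProduct_mulVec v,
    Matrix.vecMul_transpose]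

theorem isometry_of_mem_OM {g k : GL (Fin 6) ℤ} (hg : g ∈ OM) (h : g.1 * dM = dM * k.1) :
    Isometry6 k.1 := by
  intro v
  have hg' : g.1ᵀ * Q * g.1 = Q := hg
  have e := bM_mulVec g.1 (dM *ᵥ v) (dM *ᵥ v)
  rw [hg', Matrix.mulVec_mulVec, h, ← Matrix.mulVec_mulVec, bM_dM] at e
  have e2 := bM_dM v
  rw [bM] at e2
  rw [e2] at e
  linarith

/-- The image of `dM` contains 2M, so the form on M is determined by its restriction to the
sublattice. -/
theorem mem_OM_of_isometry {g k : GL (Fin 6) ℤ} (hk : Isometry6 k.1) (h : g.1 * dM = dM * k.1) :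
    g ∈ OM := by
  have two : ∀ v : Fin 6 → ℤ, ∃ w, (2 : ℤ) • v = dM *ᵥ w := by
    intro v
    refine ⟨![2 * v 0, v 1, 2 * v 2, 2 * v 3, 2 * v 4, 2 * v 5], ?_⟩
    ext i
    rw [dM, Matrix.mulVec_diagonal]
    fin_cases i <;> simp
  have sm : ∀ v : Fin 6 → ℤ, bM ((2 : ℤ) • v) ((2 : ℤ) • v) = 4 * bM v v := by
    intro v
    simp only [bM_eq, Pi.smul_apply, smul_eq_mul]; ring
  have q : ∀ v, bM (g.1 *ᵥ v) (g.1 *ᵥ v) = bM v v := by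
    intro v
    obtain ⟨w, hw⟩ := two v
    have e1 := sm (g.1 *ᵥ v)
    rw [← Matrix.mulVec_smul, hw, Matrix.mulVec_mulVec, h, ← Matrix.mulVec_mulVec, bM_dM, hk,
      ← bM_dM, ← hw, sm] at e1
    linarith
  have pol : ∀ v w, 2 * bM v w = bM (v + w) (v + w) - bM v v - bM w w := by
    intro v w
    simp only [bM_eq, Pi.add_apply]; ring
  have b : ∀ v w, bM (g.1 *ᵥ v) (g.1 *ᵥ w) = bM v w := by
    intro v w
    have e1 := pol (g.1 *ᵥ v) (g.1 *ᵥ w)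
    rw [← Matrix.mulVec_add, q, q, q, ← pol] at e1
    linarith
  change g.1ᵀ * Q * g.1 = Q
  ext i j
  have := b (Pi.single i 1) (Pi.single j 1)
  rw [bM_mulVec, bM] at this
  simpa [Matrix.mulVec_single_one] using this

theorem OM_entries {g : GL (Fin 6) ℤ} (hg : g ∈ OM) (i j : Fin 6) :
    bM (fun l => g.1 l i) (fun l => g.1 l j) = Q i j := by
  have hg' : g.1ᵀ * Q * g.1 = Q := hg
  have := bM_mulVec g.1 (Pi.single i 1) (Pi.single j 1)
  rw [hg', Matrix.mulVec_single_one, Matrix.mulVec_single_one] at this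
  refine Eq.trans this ?_
  simp [Matrix.mulVec_single_one]

/-! ### Integral matrices acting on the period domain -/

/-- The vector of `M ⊗ ℂ` attached to a matrix. -/
def vecM (τ : Matrix (Fin 2) (Fin 2) ℂ) : Fin 6 → ℂ :=
  vec (τ 0 0) (τ 1 1) (τ 0 1 - ω * coord6 τ) (coord6 τ)

theorem toC_dM_mulVec (w : Fin 6 → ℂ) (i : Fin 6) :
    (toC dM *ᵥ w) i = ((![1, 2, 1, 1, 1, 1] : Fin 6 → ℤ) i : ℂ) * w i := by
  have : toC dM = Matrix.diagonal fun i => ((![1, 2, 1, 1, 1, 1] : Fin 6 → ℤ) i : ℂ) := by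
    rw [toC, dM, Matrix.diagonal_map (map_zero _)]
    rfl
  rw [this, Matrix.mulVec_diagonal]

theorem vecM_eq (τ : Matrix (Fin 2) (Fin 2) ℂ) : vecM τ = toC dM *ᵥ vecL τ := by
  have hc : coord6 τ * (ω - ω ^ 2) = τ 0 1 - τ 1 0 := div_mul_cancel₀ _ ω_sub_ne
  ext i
  rw [toC_dM_mulVec]
  fin_cases i <;> simp [vecM, vec, vecL, Matrix.det_fin_two]
  grind [ω_quad]

theorem toC_dM_injective : Function.Injective fun w => toC dM *ᵥ w := by
  intro v w h
  ext i
  have := congrFun h i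
  simp only [toC_dM_mulVec] at this
  exact mul_left_cancel₀ (by exact_mod_cast dM_ne i) this

theorem vecM_ne_zero (τ : Matrix (Fin 2) (Fin 2) ℂ) : vecM τ ≠ 0 := vec_ne_zero _ _ _ _

theorem Psi_symm_val (τ : H2) : (Psi.symm τ).1 = .mk ℂ (vecM τ.1) (vecM_ne_zero τ.1) := rfl

theorem projPerm_vecM_iff (g : GL (Fin 6) ℤ) (τ τ' : Matrix (Fin 2) (Fin 2) ℂ) :
    projPerm g (.mk ℂ (vecM τ) (vecM_ne_zero τ)) = .mk ℂ (vecM τ') (vecM_ne_zero τ') ↔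
      ∃ c : ℂ, c ≠ 0 ∧ toC g.1 *ᵥ vecM τ = c • vecM τ' := by
  obtain ⟨h, e⟩ := projPerm_mk g _ (vecM_ne_zero τ)
  rw [e, Projectivization.mk_eq_mk_iff']
  constructor
  · rintro ⟨c, hc⟩
    refine ⟨c, ?_, hc.symm⟩
    rintro rfl
    rw [zero_smul] at hc
    exact h hc.symm
  · rintro ⟨c, -, hc⟩
    exact ⟨c, hc.symm⟩

/-- The matrix `g` induces the permutation `p` of the Hermitian upper half space. -/
def Induces (g : GL (Fin 6) ℤ) (p : Equiv.Perm H2) : Prop :=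
  ∀ τ : H2, ∃ c : ℂ, c ≠ 0 ∧ toC g.1 *ᵥ vecM τ.1 = c • vecM (p τ).1

theorem Induces.mul {g k : GL (Fin 6) ℤ} {p r : Equiv.Perm H2} (hg : Induces g p)
    (hk : Induces k r) : Induces (g * k) (p * r) := by
  intro τ
  obtain ⟨c, hc, e⟩ := hk τ
  obtain ⟨d, hd, e'⟩ := hg (r τ)
  refine ⟨c * d, mul_ne_zero hc hd, ?_⟩
  rw [Units.val_mul, toC_mul, ← Matrix.mulVec_mulVec, e, Matrix.mulVec_smul, e', smul_smul]
  rfl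

theorem Induces.inv {g : GL (Fin 6) ℤ} {p : Equiv.Perm H2} (hg : Induces g p) :
    Induces g⁻¹ p⁻¹ := by
  intro τ
  obtain ⟨c, hc, e⟩ := hg (p⁻¹ τ)
  refine ⟨c⁻¹, inv_ne_zero hc, ?_⟩
  have : p (p⁻¹ τ) = τ := p.apply_symm_apply τ
  rw [this] at e
  rw [eq_inv_smul_iff₀ hc, ← Matrix.mulVec_smul, ← e, Matrix.mulVec_mulVec, ← toC_mul,
    ← Units.val_mul, inv_mul_cancel, Units.val_one, toC_one, Matrix.one_mulVec]

theorem actK_val (K : Subgroup (GL (Fin 6) ℤ)) (hK : K ≤ OMplus) (g : K) (z : DMplus) :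
    (actK K hK g z).1 = projPerm g.1 z.1 := rfl

theorem induces_iff {K : Subgroup (GL (Fin 6) ℤ)} (hK : K ≤ OMplus) (g : K) (p : Equiv.Perm H2) :
    Induces g.1 p ↔ ∀ z, Psi (actK K hK g z) = p (Psi z) := by
  have key : ∀ τ : H2, Psi (actK K hK g (Psi.symm τ)) = p τ ↔
      ∃ c : ℂ, c ≠ 0 ∧ toC g.1.1 *ᵥ vecM τ.1 = c • vecM (p τ).1 := by
    intro τ
    rw [← projPerm_vecM_iff, ← Equiv.eq_symm_apply, Subtype.ext_iff, actK_val]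
    rfl
  constructor
  · intro h z
    have := (key (Psi z)).mpr (h _)
    rwa [Equiv.symm_apply_apply] at this
  · intro h τ
    rw [← key, h, Equiv.apply_symm_apply]

theorem exists_induces {g : GL (Fin 6) ℤ} (hg : g ∈ OMplus) : ∃ p, Induces g p := by
  refine ⟨(Psi.symm.trans (actK OMplus le_rfl ⟨g, hg⟩)).trans Psi, ?_⟩
  rw [induces_iff (K := OMplus) le_rfl ⟨g, hg⟩]
  intro z
  simp

/-- The points of `DMplus` are exactly the classes of the vectors `vecM τ`, which g permutes as p
permutes the τ. -/
theorem mem_OMplus_of_induces {g : GL (Fin 6) ℤ} (hg : g ∈ OM) {p : Equiv.Perm H2}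
    (h : Induces g p) : g ∈ OMplus := by
  refine ⟨hg, ?_⟩
  change projPerm g ∈ MulAction.stabilizer (Equiv.Perm PM) DMplus
  rw [MulAction.mem_stabilizer_iff]
  have img : ∀ τ : H2, projPerm g (Psi.symm τ).1 = (Psi.symm (p τ)).1 := fun τ => by
    rw [Psi_symm_val, Psi_symm_val, projPerm_vecM_iff]
    exact h τ
  have rep : ∀ z ∈ DMplus, ∃ τ, z = (Psi.symm τ).1 := fun z hz =>
    ⟨Psi ⟨z, hz⟩, by rw [Equiv.symm_apply_apply]⟩
  ext z
  constructor
  · rintro ⟨y, hy, rfl⟩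
    obtain ⟨τ, rfl⟩ := rep y hy
    change projPerm g _ ∈ _
    rw [img]
    exact (Psi.symm (p τ)).2
  · intro hz
    obtain ⟨τ, rfl⟩ := rep z hz
    refine ⟨(Psi.symm (p⁻¹ τ)).1, (Psi.symm (p⁻¹ τ)).2, ?_⟩
    change projPerm g _ = _
    rw [img]
    congr 2
    exact p.apply_symm_apply τ

theorem preservesCone_of_induces {g k : GL (Fin 6) ℤ} (h : g.1 * dM = dM * k.1)
    {p : Equiv.Perm H2} (hp : Induces g p) : PreservesCone k.1 := by
  intro τ hτ
  obtain ⟨c, hc, e⟩ := hp ⟨τ, hτ⟩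
  refine ⟨c, hc, (p ⟨τ, hτ⟩).1, (p ⟨τ, hτ⟩).2, toC_dM_injective ?_⟩
  simp only [vecM_eq] at e ⊢
  rw [Matrix.mulVec_smul, ← e, Matrix.mulVec_mulVec, Matrix.mulVec_mulVec, ← toC_mul, ← toC_mul, h]

theorem induces_of_realises {h : GL4} (hh : h ∈ GU) {g k : GL (Fin 6) ℤ} {c : ℂ} (hc : c ≠ 0)
    (H : Realises h.1 k.1 c) (e : g.1 * dM = dM * k.1) : Induces g (actGU ⟨h, hh⟩) := by
  intro τ
  have hu := denom_isUnit hh τ.2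
  have hd := ((Matrix.isUnit_iff_isUnit_det _).mp hu).ne_zero
  refine ⟨_, mul_ne_zero (inv_ne_zero hc) hd, ?_⟩
  rw [vecM_eq, vecM_eq, actGU_apply, Matrix.mulVec_mulVec, ← toC_mul, e, toC_mul,
    ← Matrix.mulVec_mulVec, ← Matrix.mulVec_smul, ← smul_smul, ← H.vecL_eq hu, smul_smul,
    inv_mul_cancel₀ hc, one_smul]

/-! ### Comparison of the groups -/

theorem mem_SOMplus_iff {g : GL (Fin 6) ℤ} : g ∈ SOMplus ↔ g ∈ OMplus ∧ g.1.det = 1 := by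
  rw [SOMplus, Subgroup.mem_inf, MonoidHom.mem_ker, Units.ext_iff,
    Matrix.GeneralLinearGroup.val_det_apply, Units.val_one]

theorem mem_SOMplus0_iff {g : GL (Fin 6) ℤ} : g ∈ SOMplus0 ↔ g ∈ OMplus0 ∧ g.1.det = 1 := by
  refine ⟨fun h => ⟨h.1, (mem_SOMplus_iff.mp h.2).2⟩, fun h => ⟨h.1, mem_SOMplus_iff.mpr ⟨h.1.1, h.2⟩⟩⟩

theorem transpMat_det : transpMat.det = -1 := by
  have h : transpMat.BlockTriangular id := by
    intro i j hij
    fin_cases i <;> fin_cases j <;> first | rfl | exact absurd hij (by decide)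
  rw [Matrix.det_of_isUpperTriangular h]
  decide

/-- Restriction to L yields a cone isometry, which is realised by `mem_realised_or`; the parity of
its first row places the realising matrix in HΓ₀(2). -/
theorem exists_HG02_induces {g : GL (Fin 6) ℤ} (hg : g ∈ SOMplus0) :
    ∃ h : HG02, Induces g (actHG02 h) := by
  rw [mem_SOMplus0_iff] at hg
  obtain ⟨hg0, hd⟩ := hg
  obtain ⟨k, e⟩ := exists_restrict_GL hg0
  obtain ⟨p, hp⟩ := exists_induces hg0.1
  have hkd : k.1.det = 1 := by rw [← det_eq_of_mul_dM e, hd]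
  have hk : k ∈ realised := by
    rcases mem_realised_or ⟨isometry_of_mem_OM hg0.1.1 e, preservesCone_of_induces e hp⟩ with h | h
    · exact h
    -- A product of a matrix of determinant 1 with the transposition has determinant -1 and cannot
    -- be realised.
    · have := h.1
      rw [Units.val_mul, Matrix.det_mul, hkd] at this
      change 1 * transpMat.det = 1 at this
      rw [transpMat_det] at this
      norm_num at this
  obtain ⟨-, h, hh, c, hc, H⟩ := hk
  have row : ∀ j, k.1 0 j = g.1 0 j * (![1, 2, 1, 1, 1, 1] : Fin 6 → ℤ) j := by
    intro j
    have := congrFun (congrFun e 0) j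
    rw [dM, Matrix.mul_diagonal, Matrix.diagonal_mul] at this
    simpa using this.symm
  have hr := fun j => rows_mod_two hg0.1.1 hg0.2 0 j (by decide)
  have hmem : h ∈ HG02 := by
    refine mem_HG02_of_row hh hc H ?_ fun j hj => ?_
    · rw [row]
      have := hr 0
      simp at this ⊢
      omega
    · rw [row]
      have := hr j
      rw [Matrix.one_apply_ne hj.symm, sub_zero] at this
      exact this.mul_right _
  refine ⟨⟨h, hmem⟩, ?_⟩
  have hc0 : c ≠ 0 := by rcases hc with rfl | rfl <;> norm_num
  exact induces_of_realises (HG02_le hmem) hc0 H e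

theorem ω_ne_zero : ω ≠ 0 := fun h => by simpa [h] using ω_pow_three

/-- The scalar matrix `ω`. -/
def scalarω : GL4 := Matrix.GeneralLinearGroup.scalar _ (Units.mk0 ω ω_ne_zero)

theorem scalarω_val : scalarω.1 = ω • 1 := by
  rw [scalarω, Matrix.GeneralLinearGroup.coe_scalar, Matrix.smul_one_eq_diagonal]
  rfl

theorem scalarω_mem_mu6 : scalarω ∈ mu6 := by
  refine ⟨_, (mem_rootsOfUnity _ _).mpr (Units.ext ?_), rfl⟩
  rw [Units.val_pow_eq_pow_val, Units.val_mk0, Units.val_one, show 6 = 3 * 2 from rfl, pow_mul,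
    ω_pow_three, one_pow]

theorem scalarω_mem : scalarω ∈ HG02 := by
  obtain ⟨h, hh, e⟩ := exists_HG_of_entries (M := ω • 1) (fun i j => by
    rw [Matrix.smul_apply, smul_eq_mul]
    refine mul_mem ω_mem_Eis ?_
    rw [Matrix.one_apply]
    split_ifs
    exacts [one_mem _, zero_mem _]) (by
      rw [Matrix.conjTranspose_smul, Matrix.conjTranspose_one, star_ω, Matrix.smul_mul,
        Matrix.smul_mul, Matrix.mul_smul, smul_smul, ← pow_succ, ω_pow_three]
      simp)
  have : h = scalarω := Units.ext (e.trans scalarω_val.symm)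
  subst this
  refine ⟨hh, fun i j => ⟨0, zero_mem _, ?_⟩⟩
  rw [scalarω_val]
  simp

theorem scalarω_det : scalarω.1.det = ω := by
  rw [scalarω_val, Matrix.det_smul, Matrix.det_one]
  simp
  linear_combination ω * ω_pow_three

theorem actHG02_scalarω : actHG02 ⟨scalarω, scalarω_mem⟩ = 1 :=
  mu6_le_ker (Subgroup.mem_subgroupOf.mpr scalarω_mem_mu6)

/-- The scalar ω acts trivially and has determinant ω⁴ = ω, so a suitable power cancels the
determinant. -/
theorem exists_det_one (h : HG02) : ∃ k : HG02, k.1.1.det = 1 ∧ actHG02 k = actHG02 h := by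
  have key : ∀ n : ℕ, (h * ⟨scalarω, scalarω_mem⟩ ^ n).1.1.det = h.1.1.det * ω ^ n ∧
      actHG02 (h * ⟨scalarω, scalarω_mem⟩ ^ n) = actHG02 h := by
    intro n
    constructor
    · change (h.1 * scalarω ^ n).1.det = _
      rw [Units.val_mul, Units.val_pow_eq_pow_val, Matrix.det_mul, Matrix.det_pow, scalarω_det]
    · rw [map_mul, map_pow, actHG02_scalarω, one_pow, mul_one]
  rcases HG_det h.2.1 with e | e | e
  · exact ⟨h, e, rfl⟩
  · refine ⟨_, (key 2).1.trans ?_, (key 2).2⟩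
    rw [e, ← pow_succ', ω_pow_three]
  · refine ⟨_, (key 1).1.trans ?_, (key 1).2⟩
    rw [e, ← pow_add, ω_pow_three]

/-- The quadratic form ½ᵗvQv reduces modulo 2 to v₀v₁. These are the conditions for the upper left
block to preserve xy over 𝔽₂. -/
theorem OM_zero_one {g : GL (Fin 6) ℤ} (hg : g ∈ OM) :
    2 ∣ g.1 0 0 * g.1 1 0 ∧ 2 ∣ g.1 0 1 * g.1 1 1 ∧
      2 ∣ g.1 0 0 * g.1 1 1 + g.1 1 0 * g.1 0 1 - 1 := by
  have e0 := OM_entries hg 0 0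
  have e1 := OM_entries hg 1 1
  have e2 := OM_entries hg 0 1
  simp only [bM_eq] at e0 e1 e2
  have q0 : Q 0 0 = 0 := rfl
  have q1 : Q 1 1 = 0 := rfl
  have q2 : Q 0 1 = 1 := rfl
  rw [q0] at e0
  rw [q1] at e1
  rw [q2] at e2
  refine ⟨⟨-(g.1 2 0 * g.1 3 0) + g.1 4 0 * g.1 4 0 - g.1 4 0 * g.1 5 0 + g.1 5 0 * g.1 5 0, ?_⟩,
    ⟨-(g.1 2 1 * g.1 3 1) + g.1 4 1 * g.1 4 1 - g.1 4 1 * g.1 5 1 + g.1 5 1 * g.1 5 1, ?_⟩,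
    ⟨-(g.1 2 0 * g.1 3 1) - g.1 3 0 * g.1 2 1 + 2 * g.1 4 0 * g.1 4 1 - g.1 4 0 * g.1 5 1
      - g.1 5 0 * g.1 4 1 + 2 * g.1 5 0 * g.1 5 1, ?_⟩⟩
  · linarith
  · linarith
  · linarith

/-- After normalising the determinant, the integral matrix on L and its inverse satisfy the column
condition of `HG02_realised`, so the isometry extends from L to M. -/
theorem exists_SOMplus0_induces (h : HG02) : ∃ g ∈ SOMplus0, Induces g (actHG02 h) := by
  obtain ⟨m, hm, em⟩ := exists_det_one h
  rw [← em]
  obtain ⟨k, hk, H⟩ := exists_realised_realises m.2.1 hm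
  have d1 := HG02_realised m.2 H
  have d2 := HG02_realised (inv_mem m.2) (H.inv (Or.inl rfl))
  obtain ⟨g, e⟩ := exists_extend_GL d1.2 d2.2
  have hOM : g ∈ OM := mem_OM_of_isometry (realised_isometry hk) e
  have hI : Induces g (actHG02 m) := induces_of_realises (HG02_le m.2) one_ne_zero H e
  refine ⟨g, mem_SOMplus0_iff.mpr ⟨⟨mem_OMplus_of_induces hOM hI, ?_⟩, ?_⟩, hI⟩
  · have ent := fun i j => congrFun (congrFun e i) j
    simp only [dM, Matrix.mul_diagonal, Matrix.diagonal_mul] at ent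
    have h01 := ent 0 1
    have h10 := ent 1 0
    simp at h01 h10
    obtain ⟨-, -, h2⟩ := OM_zero_one hOM
    -- Extension along `dM` halves the entry `k 0 1`, so divisibility by 4 is what makes `g 0 1`
    -- even.
    have e01 : 2 ∣ g.1 0 1 := by have := d1.1; omega
    have e10 : 2 ∣ g.1 1 0 := ⟨_, h10⟩
    have hodd : ¬ 2 ∣ g.1 0 0 * g.1 1 1 := by
      intro hcon
      have := e10.mul_right (g.1 0 1)
      omega
    rw [Int.prime_two.dvd_mul, not_or] at hodd
    intro i j hi hj
    have hi' : i = 0 ∨ i = 1 := by omega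
    have hj' : j = 0 ∨ j = 1 := by omega
    rcases hi' with rfl | rfl <;> rcases hj' with rfl | rfl <;> simp <;> omega
  · rw [det_eq_of_mul_dM e, hk.1]

/-! ### The involutions -/

theorem transpMat_isometry : transpMatᵀ * Q * transpMat = Q := by decide

theorem induces_transpGL : Induces transpGL T := by
  intro τ
  refine ⟨1, one_ne_zero, ?_⟩
  change toC transpMat *ᵥ vecM τ.1 = (1 : ℂ) • vecM τ.1ᵀ
  have hc : coord6 τ.1ᵀ = - coord6 τ.1 := by
    simp only [coord6, Matrix.transpose_apply]
    ring
  have h2 : coord6 τ.1 * (ω - ω ^ 2) = τ.1 0 1 - τ.1 1 0 := div_mul_cancel₀ _ ω_sub_ne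
  rw [toC_transpMat_mulVec, one_smul, vecM, vecM, hc]
  ext i
  fin_cases i <;> simp [vec]
  · grind [ω_quad]
  · grind [ω_quad]

theorem transpGL_mem : transpGL ∈ OMplus0 := by
  refine ⟨mem_OMplus_of_induces transpMat_isometry induces_transpGL, ?_⟩
  change ∀ i j : Fin 6, i < 2 → j < 2 → (2 : ℤ) ∣ transpMat i j - (1 : Matrix (Fin 6) (Fin 6) ℤ) i j
  decide

/-- The involution `τ ↦ -τ⁻¹ / 2` as an element of `GL₆(ℤ)`. -/
def invGL : GL (Fin 6) ℤ := ⟨invMat, invMat, by decide, by decide⟩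

theorem invMat_isometry : invMatᵀ * Q * invMat = Q := by decide

theorem invMat_det : invMat.det = 1 := by
  obtain ⟨g, hg, e⟩ := exists_invMat
  rw [← e, hg.1]

theorem toC_invMat_mulVec (v : Fin 6 → ℂ) :
    toC invMat *ᵥ v = ![v 1, v 0, v 3, v 2, -v 4, -v 5] := by
  ext i
  fin_cases i <;> simp [toC, invMat, Matrix.mulVec, dotProduct, Fin.sum_univ_six]

theorem H2_det_ne_zero (τ : H2) : τ.1.det ≠ 0 := by
  have hu := (Matrix.isUnit_iff_isUnit_det _).mp (denom_isUnit W_mem τ.2)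
  simp only [W_val, Matrix.toBlocks_fromBlocks₂₁, Matrix.toBlocks_fromBlocks₂₂, add_zero,
    Matrix.smul_mul, one_mul, Matrix.det_smul] at hu
  exact (isUnit_of_mul_isUnit_right hu).ne_zero

/-- On L the matrix `invMat` is τ ↦ -τ⁻¹. On M, where the second coordinate is twice as large, the
same matrix gives -½τ⁻¹. -/
theorem induces_invGL : Induces invGL Wperm := by
  intro τ
  have hd := H2_det_ne_zero τ
  -- The scalar is the second coordinate of `vecM τ`, which the inversion moves to the first place.
  refine ⟨-2 * τ.1.det, mul_ne_zero (by norm_num) hd, ?_⟩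
  change toC invMat *ᵥ vecM τ.1 = _
  rw [Wperm_apply, Matrix.inv_def, Matrix.adjugate_fin_two, Ring.inverse_eq_inv', toC_invMat_mulVec]
  have e : τ.1.det * τ.1.det⁻¹ = 1 := mul_inv_cancel₀ hd
  have h2 : coord6 τ.1 * (ω - ω ^ 2) = τ.1 0 1 - τ.1 1 0 := div_mul_cancel₀ _ ω_sub_ne
  set d := τ.1.det with hdd
  rw [Matrix.det_fin_two] at hdd
  have hc : coord6 ((-(1 / 2) : ℂ) • d⁻¹ • !![τ.1 1 1, -τ.1 0 1; -τ.1 1 0, τ.1 0 0])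
      = d⁻¹ / 2 * coord6 τ.1 := by
    simp [coord6]
    ring
  simp only [vecM, hc]
  generalize coord6 τ.1 = c at *
  ext i
  fin_cases i <;> simp [vec]
  all_goals grind [ω_quad]

theorem invGL_mem : invGL ∈ SOMplus :=
  mem_SOMplus_iff.mpr ⟨mem_OMplus_of_induces invMat_isometry induces_invGL, invMat_det⟩

/-- The orthogonal group of xy over 𝔽₂ consists of the identity and the swap, and `invGL` represents
the swap. -/
theorem mem_OMplus0_or {g : GL (Fin 6) ℤ} (hg : g ∈ OMplus) :
    g ∈ OMplus0 ∨ g * invGL ∈ OMplus0 := by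
  obtain ⟨h0, h1, h2⟩ := OM_zero_one hg.1
  have col : ∀ i, (g * invGL).1 i 0 = g.1 i 1 ∧ (g * invGL).1 i 1 = g.1 i 0 := by
    intro i
    have : (g * invGL).1 = g.1 * invMat := rfl
    rw [this]
    constructor <;> simp [Matrix.mul_apply, Fin.sum_univ_six, invMat]
  rw [Int.prime_two.dvd_mul] at h0 h1
  by_cases hp : 2 ∣ g.1 0 0 * g.1 1 1
  · right
    have hq : ¬ 2 ∣ g.1 1 0 * g.1 0 1 := by omega
    rw [Int.prime_two.dvd_mul, not_or] at hq
    refine ⟨mul_mem hg invGL_mem.1, fun i j hi hj => ?_⟩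
    have hi' : i = 0 ∨ i = 1 := by omega
    have hj' : j = 0 ∨ j = 1 := by omega
    rcases hj' with rfl | rfl
    · rw [(col i).1]
      rcases hi' with rfl | rfl <;> simp <;> omega
    · rw [(col i).2]
      rcases hi' with rfl | rfl <;> simp <;> omega
  · left
    rw [Int.prime_two.dvd_mul, not_or] at hp
    refine ⟨hg, fun i j hi hj => ?_⟩
    have hi' : i = 0 ∨ i = 1 := by omega
    have hj' : j = 0 ∨ j = 1 := by omega
    rcases hi' with rfl | rfl <;> rcases hj' with rfl | rfl <;> simp <;> omega

theorem det_one_or {g : GL (Fin 6) ℤ} : g.1.det = 1 ∨ (g * transpGL).1.det = 1 := by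
  have hu : IsUnit g.1.det := (Matrix.isUnit_iff_isUnit_det _).mp g.isUnit
  rcases Int.isUnit_iff.mp hu with h | h
  · exact Or.inl h
  · right
    have : (g * transpGL).1 = g.1 * transpMat := rfl
    rw [this, Matrix.det_mul, transpMat_det, h]
    norm_num

/-! ### Faithfulness -/

/-- The real part of a vector over the Hermitian upper half space. -/
def vecRe (a b z w : ℤ) : Fin 6 → ℤ := ![1, -2 * (a * b - 1 - (z ^ 2 - z * w + w ^ 2)), a, b, z, w]

/-- The imaginary part of a vector over the Hermitian upper half space. -/
def vecIm (a b : ℤ) : Fin 6 → ℤ := ![0, -2 * (a + b), 1, 1, 0, 0]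

theorem vec_eq_re_im (a b z w : ℤ) : vec (Complex.I + a) (Complex.I + b) z w
    = fun i => (((vecRe a b z w i : ℤ) : ℝ) : ℂ) + (((vecIm a b i : ℤ) : ℝ) : ℂ) * Complex.I := by
  ext i
  fin_cases i <;> simp [vec, vecRe, vecIm] <;> ring_nf
  rw [Complex.I_sq]; ring

/-- The first coordinate of the vector is 1, so c is the first coordinate of the image. Separating
real and imaginary parts leaves integer equations, linear in the entries of g. -/
theorem toC_vec_eq {g : Matrix (Fin 6) (Fin 6) ℤ} {a b z w : ℤ} {c : ℂ}
    (h : toC g *ᵥ vec (Complex.I + a) (Complex.I + b) z w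
      = c • vec (Complex.I + a) (Complex.I + b) z w) (i : Fin 6) :
    (g *ᵥ vecRe a b z w) i
        = (g *ᵥ vecRe a b z w) 0 * vecRe a b z w i - (g *ᵥ vecIm a b) 0 * vecIm a b i ∧
      (g *ᵥ vecIm a b) i
        = (g *ᵥ vecRe a b z w) 0 * vecIm a b i + (g *ᵥ vecIm a b) 0 * vecRe a b z w i := by
  have hv := vec_eq_re_im a b z w
  have row : ∀ i, (toC g *ᵥ vec (Complex.I + a) (Complex.I + b) z w) i
      = ((((g *ᵥ vecRe a b z w) i : ℤ) : ℝ) : ℂ)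
        + ((((g *ᵥ vecIm a b) i : ℤ) : ℝ) : ℂ) * Complex.I := by
    intro i
    rw [hv]
    simp [toC, Matrix.mulVec, dotProduct, Fin.sum_univ_six]
    ring
  have h0 := congrFun h 0
  have c0 : c = (c • vec (Complex.I + a) (Complex.I + b) z w) 0 := by simp [vec]
  rw [← h0, row] at c0
  have hi := congrFun h i
  rw [row, Pi.smul_apply, c0, hv] at hi
  have hr := congrArg Complex.re hi
  have hm := congrArg Complex.im hi
  simp only [smul_eq_mul, Complex.add_re, Complex.add_im, Complex.mul_re, Complex.mul_im,
    Complex.ofReal_re, Complex.ofReal_im, Complex.I_re, Complex.I_im, mul_zero, mul_one, zero_mul,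
    sub_zero, add_zero, zero_add] at hr hm
  exact ⟨by exact_mod_cast hr, by exact_mod_cast hm⟩

/-- The points i + a, i + b, z, w with integral a, b, z, w suffice: a few of them give enough linear
equations to determine g row by row, starting with rows 4 and 5, which also determine row 0. -/
theorem eq_scalar_of_toC_vec {g : Matrix (Fin 6) (Fin 6) ℤ}
    (h : ∀ a b z w : ℤ, ∃ c : ℂ, toC g *ᵥ vec (Complex.I + a) (Complex.I + b) z w
      = c • vec (Complex.I + a) (Complex.I + b) z w) : g = g 0 0 • 1 := by
  have main := fun a b z w i => toC_vec_eq (h a b z w).choose_spec i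
  simp only [Matrix.mulVec, dotProduct, Fin.sum_univ_six, vecRe, vecIm, Matrix.cons_val] at main
  have r4 := fun a b z w => main a b z w 4
  have r5 := fun a b z w => main a b z w 5
  have r3 := fun a b z w => main a b z w 3
  have r2 := fun a b z w => main a b z w 2
  have r1 := fun a b z w => main a b z w 1
  simp only [Matrix.cons_val] at r1 r2 r3 r4 r5
  have h4 : (g 4 0 = 0 ∧ g 4 1 = 0 ∧ g 4 2 = 0 ∧ g 4 3 = 0 ∧ g 4 5 = 0) ∧
      g 0 1 = 0 ∧ g 0 4 = 0 ∧ g 0 2 + g 0 3 = 0 ∧ g 4 4 = g 0 0 := by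
    have s0 := r4 0 0 0 0
    have s1 := r4 1 (-1) 0 0
    have s2 := r4 1 0 0 0
    have s3 := r4 0 0 0 1
    have s4 := r4 0 0 1 0
    have s5 := r4 0 0 2 0
    have s6 := r4 1 0 1 0
    norm_num at s0 s1 s2 s3 s4 s5 s6
    clear main r1 r2 r3 r4 r5 h
    omega
  obtain ⟨⟨g40, g41, g42, g43, g45⟩, g01, g04, g023, g44⟩ := h4
  have h5 : (g 5 0 = 0 ∧ g 5 1 = 0 ∧ g 5 2 = 0 ∧ g 5 3 = 0 ∧ g 5 4 = 0) ∧
      g 0 5 = 0 ∧ g 0 2 = 0 ∧ g 5 5 = g 0 0 := by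
    have s0 := r5 0 0 0 0
    have s1 := r5 1 (-1) 0 0
    have s2 := r5 1 0 0 0
    have s3 := r5 0 0 1 0
    have s4 := r5 0 0 0 1
    have s5 := r5 0 0 0 2
    have s6 := r5 1 0 0 1
    norm_num [g01, g04] at s0 s1 s2 s3 s4 s5 s6
    clear main r1 r2 r3 r4 r5 h
    omega
  obtain ⟨⟨g50, g51, g52, g53, g54⟩, g05, g02, g55⟩ := h5
  have g03 : g 0 3 = 0 := by omega
  simp only [g01, g02, g03, g04, g05, zero_mul, mul_zero, add_zero, sub_zero, mul_one] at r1 r2 r3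
  have h2 : g 2 0 = 0 ∧ g 2 1 = 0 ∧ g 2 2 = g 0 0 ∧ g 2 3 = 0 ∧ g 2 4 = 0 ∧ g 2 5 = 0 := by
    have s0 := r2 0 0 0 0
    have s1 := r2 1 (-1) 0 0
    have s2 := r2 1 0 0 0
    have s3 := r2 0 0 1 0
    have s4 := r2 0 0 0 1
    norm_num at s0 s1 s2 s3 s4
    clear main r1 r2 r3 r4 r5 h
    omega
  have h3 : g 3 0 = 0 ∧ g 3 1 = 0 ∧ g 3 2 = 0 ∧ g 3 3 = g 0 0 ∧ g 3 4 = 0 ∧ g 3 5 = 0 := by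
    have s0 := r3 0 0 0 0
    have s1 := r3 1 (-1) 0 0
    have s2 := r3 1 0 0 0
    have s3 := r3 0 0 1 0
    have s4 := r3 0 0 0 1
    norm_num at s0 s1 s2 s3 s4
    clear main r1 r2 r3 r4 r5 h
    omega
  have h1 : g 1 0 = 0 ∧ g 1 1 = g 0 0 ∧ g 1 2 = 0 ∧ g 1 3 = 0 ∧ g 1 4 = 0 ∧ g 1 5 = 0 := by
    have s0 := r1 0 0 0 0
    have s1 := r1 1 (-1) 0 0
    have s2 := r1 1 0 0 0
    have s3 := r1 0 0 1 0
    have s4 := r1 0 0 0 1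
    norm_num at s0 s1 s2 s3 s4
    clear main r1 r2 r3 r4 r5 h
    omega
  clear main r1 r2 r3 r4 r5 h
  ext i j
  rw [Matrix.smul_apply, smul_eq_mul]
  fin_cases i <;> fin_cases j <;> simp [*]

theorem coord6_mk (x y z w : ℂ) : coord6 !![x, z + ω * w; z + ω ^ 2 * w, y] = w := by
  rw [coord6, div_eq_iff ω_sub_ne]
  simp
  ring

theorem vecM_mk (x y z w : ℂ) : vecM !![x, z + ω * w; z + ω ^ 2 * w, y] = vec x y z w := by
  rw [vecM, coord6_mk]
  simp

theorem eq_one_or_neg_one_of_induces {g : GL (Fin 6) ℤ} (h : Induces g 1) : g = 1 ∨ g = -1 := by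
  have e : g.1 = g.1 0 0 • 1 := by
    refine eq_scalar_of_toC_vec fun a b z w => ?_
    have hmem : !![Complex.I + a, (z : ℂ) + ω * w; z + ω ^ 2 * w, Complex.I + b] ∈ H2 := by
      rw [mem_H2_iff]
      simp
    obtain ⟨c, -, e⟩ := h ⟨_, hmem⟩
    refine ⟨c, ?_⟩
    rw [Equiv.Perm.coe_one, id, vecM_mk] at e
    exact e
  have hu := (Matrix.isUnit_iff_isUnit_det _).mp g.isUnit
  rw [e, Matrix.det_smul, Matrix.det_one, mul_one] at hu
  have hu' : IsUnit (g.1 0 0) := isUnit_pow_iff (by simp) |>.mp hu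
  rcases Int.isUnit_iff.mp hu' with h1 | h1
  · left
    apply Units.ext
    rw [e, h1, one_smul, Units.val_one]
  · right
    apply Units.ext
    rw [e, h1, neg_smul, one_smul, Units.val_neg, Units.val_one]

theorem Induces.eq_or_neg {g k : GL (Fin 6) ℤ} {p : Equiv.Perm H2} (hg : Induces g p)
    (hk : Induces k p) : g = k ∨ g = -k := by
  have h := hg.mul hk.inv
  rw [mul_inv_cancel] at h
  rcases eq_one_or_neg_one_of_induces h with h | h
  · exact Or.inl (mul_inv_eq_one.mp h)
  · right
    rw [mul_inv_eq_iff_eq_mul.mp h, neg_one_mul]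

theorem mem_H2_of {x y z : ℂ} (hx : 0 < x.im) (h : 0 < x.im * y.im - z.im ^ 2) :
    !![x, z; z, y] ∈ H2 := by
  have := mem_H2_iff x y z 0
  simp only [mul_zero, add_zero, Complex.zero_im] at this
  rw [this]
  refine ⟨hx, ?_⟩
  simpa using h

/-- Trivial action means Aτ + B = τ(Cτ + D) on the half space, which forces a scalar matrix.
J-unitarity makes the scalar an Eisenstein integer of norm 1, hence a sixth root of unity. -/
theorem mem_mu6_of_actHG02 {h : HG02} (hh : actHG02 h = 1) : h.1 ∈ mu6 := by
  set A := h.1.1.toBlocks₁₁ with hA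
  set B := h.1.1.toBlocks₁₂ with hB
  set C := h.1.1.toBlocks₂₁ with hC
  set D := h.1.1.toBlocks₂₂ with hD
  have key : ∀ τ ∈ H2, A * τ + B = τ * (C * τ + D) := by
    intro τ hτ
    have hu := (Matrix.isUnit_iff_isUnit_det _).mp (denom_isUnit (HG02_le h.2) hτ)
    have e : moebius h.1.1 τ = τ := congrArg (fun p : Equiv.Perm H2 => (p ⟨τ, hτ⟩).1) hh
    rw [moebius] at e
    have e' := congrArg (· * (C * τ + D)) e
    rwa [Matrix.mul_assoc, Matrix.nonsing_inv_mul _ hu, Matrix.mul_one] at e'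
  have pt : ∀ (n : ℕ) (a z : ℤ), 0 < n →
      !![n * Complex.I + a, (z : ℂ); (z : ℂ), n * Complex.I] ∈ H2 := by
    intro n a z hn
    have hn' : (0 : ℝ) < n := by exact_mod_cast hn
    apply mem_H2_of
    · simpa using hn'
    · simp
      positivity
  -- At τ = ni the equation is quadratic in n, so n = 1, 2, 3 give C = 0, B = 0 and A = D. Then A
  -- commutes with diag(1, 0) and with the coordinate swap by the last two points, so it is scalar.
  have k1 := key _ (pt 1 0 0 (by norm_num))
  have k2 := key _ (pt 2 0 0 (by norm_num))
  have k3 := key _ (pt 3 0 0 (by norm_num))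
  have k4 := key _ (pt 1 1 0 (by norm_num))
  have k5 := key _ (pt 1 0 1 (by norm_num))
  have ent : ∀ {X Y : Matrix (Fin 2) (Fin 2) ℂ}, X = Y → ∀ i j, X i j = Y i j :=
    fun h i j => by rw [h]
  have hI : Complex.I ≠ 0 := Complex.I_ne_zero
  have hI2 := Complex.I_sq
  have e1 := ent k1
  have e2 := ent k2
  have e3 := ent k3
  have e4 := ent k4
  have e5 := ent k5
  simp only [Matrix.add_apply, Matrix.mul_apply, Fin.sum_univ_two] at e1 e2 e3 e4 e5
  simp [Fin.forall_fin_two] at e1 e2 e3 e4 e5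
  have hC0 : ∀ i j, C i j = 0 := by
    simp only [Fin.forall_fin_two]
    refine ⟨⟨?_, ?_⟩, ?_, ?_⟩ <;> grind
  have hB0 : ∀ i j, B i j = 0 := by
    simp only [hC0, Fin.forall_fin_two] at *
    refine ⟨⟨?_, ?_⟩, ?_, ?_⟩ <;> grind
  have hAD : ∀ i j, A i j = D i j := by
    simp only [hC0, hB0, Fin.forall_fin_two] at *
    refine ⟨⟨?_, ?_⟩, ?_, ?_⟩ <;> grind
  have h01 : A 0 1 = 0 := by simp only [hC0, hB0] at e4; grind
  have h10 : A 1 0 = 0 := by simp only [hC0, hB0] at e4; grind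
  have h11 : A 1 1 = A 0 0 := by simp only [hC0, hB0] at e5; grind
  have hs : h.1.1 = Matrix.scalar _ (A 0 0) := by
    ext i j
    rcases i with i | i <;> rcases j with j | j
    · change A i j = _
      fin_cases i <;> fin_cases j <;> simp [Matrix.scalar_apply, h01, h10, h11]
    · change B i j = _
      simp [hB0, Matrix.scalar_apply]
    · change C i j = _
      simp [hC0, Matrix.scalar_apply]
    · change D i j = _
      rw [← hAD]
      fin_cases i <;> fin_cases j <;> simp [Matrix.scalar_apply, h01, h10, h11]
  have hE : A 0 0 ∈ Eis := (h.2.1.1 (.inl 0) (.inl 0)).1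
  have hn : A 0 0 * star (A 0 0) = 1 := by
    have := congrFun (congrFun h.2.1.2 (.inl 0)) (.inr 0)
    rw [hs] at this
    simp [Matrix.scalar_apply, J] at this
    rw [mul_comm]
    exact this
  have hne : A 0 0 ≠ 0 := left_ne_zero_of_mul_eq_one hn
  refine ⟨Units.mk0 _ hne, (mem_rootsOfUnity _ _).mpr (Units.ext ?_), Units.ext ?_⟩
  · rw [Units.val_pow_eq_pow_val, Units.val_mk0, Units.val_one, pow_six_of_unit hE hn]
  · rw [hs]
    rfl

/-! ### The isomorphisms -/

/-- The group `K` and the group acting by `σ` induce the same permutations of the Hermitian upper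
half space. -/
def SameAutomorphisms {H : Type*} [Group H] (K : Subgroup (GL (Fin 6) ℤ))
    (σ : H →* Equiv.Perm H2) : Prop :=
  (∀ g ∈ K, ∃ x, Induces g (σ x)) ∧ ∀ x, ∃ g ∈ K, Induces g (σ x)

theorem actModPM_injective {K : Subgroup (GL (Fin 6) ℤ)} (hK : K ≤ OMplus) :
    Function.Injective (actModPM K hK) := by
  refine (injective_iff_map_eq_one _).mpr fun x hx => ?_
  obtain ⟨g, rfl⟩ := QuotientGroup.mk_surjective x
  have hx' : actK K hK g = 1 := hx
  refine (QuotientGroup.eq_one_iff g).mpr (Subgroup.mem_subgroupOf.mpr ?_)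
  refine eq_one_or_neg_one_of_induces ((induces_iff hK g 1).mpr fun z => ?_)
  rw [hx']
  rfl

/-- The map g ↦ x is forced by faithfulness of σ, hence multiplicative; faithfulness of ρ makes it
injective and the equality of images makes it surjective. -/
theorem isomorphicAsAutomorphisms_of_range_eq {G H D X : Type*} [Group G] [Group H] (Ψ : D ≃ X)
    {ρ : G →* Equiv.Perm D} {σ : H →* Equiv.Perm X} (hρ : Function.Injective ρ)
    (hσ : Function.Injective σ) (h1 : ∀ g, ∃ x, ∀ z, Ψ (ρ g z) = σ x (Ψ z))
    (h2 : ∀ x, ∃ g, ∀ z, Ψ (ρ g z) = σ x (Ψ z)) : IsomorphicAsAutomorphisms Ψ ρ σ := by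
  choose f hf using h1
  refine ⟨hρ, hσ, MulEquiv.ofBijective (MonoidHom.mk' f fun g k => hσ ?_) ⟨?_, ?_⟩, hf⟩
  · ext1 w
    obtain ⟨z, rfl⟩ := Ψ.surjective w
    rw [← hf, map_mul, map_mul, Equiv.Perm.mul_apply, Equiv.Perm.mul_apply, ← hf, ← hf]
  · intro g k hgk
    have e : f g = f k := hgk
    refine hρ (Equiv.ext fun z => Ψ.injective ?_)
    rw [hf, hf, e]
  · intro x
    obtain ⟨g, hg⟩ := h2 x
    refine ⟨g, hσ (Equiv.ext fun w => ?_)⟩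
    obtain ⟨z, rfl⟩ := Ψ.surjective w
    exact (hf g z).symm.trans (hg z)

theorem SameAutomorphisms.isomorphic {H : Type*} [Group H] {K : Subgroup (GL (Fin 6) ℤ)}
    (hK : K ≤ OMplus) {σ : H →* Equiv.Perm H2} (h : SameAutomorphisms K σ)
    (hσ : Function.Injective σ) : IsomorphicAsAutomorphisms Psi (actModPM K hK) σ := by
  refine isomorphicAsAutomorphisms_of_range_eq Psi (actModPM_injective hK) hσ (fun y => ?_)
    fun x => ?_
  · obtain ⟨g, rfl⟩ := QuotientGroup.mk_surjective y
    obtain ⟨x, hx⟩ := h.1 g.1 g.2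
    exact ⟨x, (induces_iff hK g _).mp hx⟩
  · obtain ⟨g, hg, hx⟩ := h.2 x
    exact ⟨QuotientGroup.mk ⟨g, hg⟩, (induces_iff hK ⟨g, hg⟩ _).mp hx⟩

/-! ### Adjoining an involution -/

section SemidirectProducts

variable {N : Type*} [Group N] {f : MulAut N} {hf : f * f = 1} {ρ : N →* Equiv.Perm H2}
  {t : Equiv.Perm H2} {ht : t * t = 1} {h : ∀ n, ρ (f n) = t * ρ n * t⁻¹}

theorem liftC2_apply (x : SemiC2 f hf) :
    liftC2 f hf ρ t ht h x = ρ x.left * c2Hom t ht x.right := rfl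

theorem c2Hom_generator : c2Hom t ht (Multiplicative.ofAdd 1) = t := by
  have h1 : (Multiplicative.ofAdd 1 : C2) ≠ 1 := by decide
  simp [c2Hom, h1]

/-- The hypotheses say L = K ∪ K t₀⁻¹ with t₀ inducing the involution t, which matches the two
cosets of N in the semidirect product. -/
theorem SameAutomorphisms.liftC2 {K L : Subgroup (GL (Fin 6) ℤ)} (hs : SameAutomorphisms K ρ)
    (hKL : K ≤ L) {t0 : GL (Fin 6) ℤ} (ht0 : t0 ∈ L) (hI : Induces t0 t)
    (hL : ∀ g ∈ L, g ∈ K ∨ g * t0 ∈ K) :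
    SameAutomorphisms L (HessianK3.liftC2 f hf ρ t ht h) := by
  constructor
  · intro g hg
    rcases hL g hg with hgK | hgK
    · obtain ⟨n, hn⟩ := hs.1 g hgK
      refine ⟨⟨n, 1⟩, ?_⟩
      rw [liftC2_apply, map_one, mul_one]
      exact hn
    · obtain ⟨n, hn⟩ := hs.1 _ hgK
      refine ⟨⟨n, Multiplicative.ofAdd 1⟩, ?_⟩
      rw [liftC2_apply, c2Hom_generator]
      have := hn.mul hI.inv
      rwa [mul_inv_cancel_right, inv_eq_of_mul_eq_one_left ht] at this
  · rintro ⟨n, c⟩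
    obtain ⟨g, hg, hn⟩ := hs.2 n
    rcases C2_cases c with rfl | rfl
    · refine ⟨g, hKL hg, ?_⟩
      rw [liftC2_apply, map_one, mul_one]
      exact hn
    · refine ⟨g * t0, mul_mem (hKL hg) ht0, ?_⟩
      rw [liftC2_apply, c2Hom_generator]
      exact hn.mul hI

/-- An integral matrix is determined up to sign by the permutation which it induces. If t came from
N, then t₀ would be ± an element of K, hence in K. -/
theorem SameAutomorphisms.notMem_range {K : Subgroup (GL (Fin 6) ℤ)} (hs : SameAutomorphisms K ρ)
    (hneg : -1 ∈ K) {t0 : GL (Fin 6) ℤ} (ht0 : t0 ∉ K) (hI : Induces t0 t) : t ∉ ρ.range := by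
  rintro ⟨n, rfl⟩
  obtain ⟨g, hg, hn⟩ := hs.2 n
  rcases hI.eq_or_neg hn with rfl | rfl
  · exact ht0 hg
  · rw [← neg_one_mul] at ht0
    exact ht0 (mul_mem hneg hg)

/-- An element of the nontrivial coset acting trivially would express t through the image of N. -/
theorem left_mem_ker_of_liftC2 (hr : t ∉ ρ.range) {x : SemiC2 f hf}
    (hx : liftC2 f hf ρ t ht h x = 1) : x.right = 1 ∧ ρ x.left = 1 := by
  rw [liftC2_apply] at hx
  rcases C2_cases x.right with e | e
  · rw [e, map_one, mul_one] at hx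
    exact ⟨e, hx⟩
  · rw [e, c2Hom_generator] at hx
    refine absurd ⟨x.left⁻¹, ?_⟩ hr
    rw [map_inv, ← eq_inv_of_mul_eq_one_right hx]

theorem liftC2_injective (hρ : Function.Injective ρ) (hr : t ∉ ρ.range) :
    Function.Injective (liftC2 f hf ρ t ht h) := by
  refine (injective_iff_map_eq_one _).mpr fun x hx => ?_
  obtain ⟨e1, e2⟩ := left_mem_ker_of_liftC2 hr hx
  ext1
  · exact (injective_iff_map_eq_one _).mp hρ _ e2
  · exact e1

end SemidirectProducts

theorem SameAutomorphisms.of_surjective {H H' : Type*} [Group H] [Group H']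
    {K : Subgroup (GL (Fin 6) ℤ)} {σ : H →* Equiv.Perm H2} (hs : SameAutomorphisms K σ)
    {τ : H' →* Equiv.Perm H2} {q : H → H'} (hq : Function.Surjective q)
    (e : ∀ x, τ (q x) = σ x) : SameAutomorphisms K τ := by
  constructor
  · intro g hg
    obtain ⟨x, hx⟩ := hs.1 g hg
    exact ⟨q x, by rwa [e]⟩
  · intro y
    obtain ⟨x, rfl⟩ := hq y
    rw [e]
    exact hs.2 x

theorem sameAutomorphisms_actHG02 : SameAutomorphisms SOMplus0 actHG02 :=
  ⟨fun _ hg => exists_HG02_induces hg, exists_SOMplus0_induces⟩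

theorem sameAutomorphisms_actPHG02 : SameAutomorphisms SOMplus0 actPHG02 :=
  sameAutomorphisms_actHG02.of_surjective QuotientGroup.mk_surjective fun _ => rfl

theorem sameAutomorphisms_actPHG02T : SameAutomorphisms OMplus0 actPHG02T :=
  sameAutomorphisms_actPHG02.liftC2 inf_le_left transpGL_mem induces_transpGL fun g hg => by
    rw [mem_SOMplus0_iff, mem_SOMplus0_iff]
    exact det_one_or.imp (fun h => ⟨hg, h⟩) fun h => ⟨mul_mem hg transpGL_mem, h⟩

theorem sameAutomorphisms_actPHG02star : SameAutomorphisms SOMplus actPHG02star := by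
  have hs : SameAutomorphisms SOMplus actHG02star :=
    sameAutomorphisms_actHG02.liftC2 inf_le_right invGL_mem induces_invGL fun g hg =>
      (mem_OMplus0_or hg.1).imp (fun h => ⟨h, hg⟩) fun h => ⟨h, mul_mem hg invGL_mem⟩
  exact hs.of_surjective QuotientGroup.mk_surjective fun _ => rfl

theorem sameAutomorphisms_actPHG02starT : SameAutomorphisms OMplus actPHG02starT :=
  sameAutomorphisms_actPHG02star.liftC2 SOMplus_le transpGL_mem.1 induces_transpGL fun g hg => by
    rw [mem_SOMplus_iff, mem_SOMplus_iff]
    exact det_one_or.imp (fun h => ⟨hg, h⟩) fun h => ⟨mul_mem hg transpGL_mem.1, h⟩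

theorem neg_one_mem : (-1 : GL (Fin 6) ℤ) ∈ SOMplus0 := by
  have hI : Induces (-1) 1 := fun τ => ⟨-1, by simp, by
    have : toC (-1 : GL (Fin 6) ℤ).1 = -1 := by
      ext i j
      by_cases hij : i = j <;> simp [toC, hij]
    rw [this, Matrix.neg_mulVec, Matrix.one_mulVec, neg_one_smul]
    rfl⟩
  have hO : (-1 : GL (Fin 6) ℤ) ∈ OM := by
    change (-1 : GL (Fin 6) ℤ).1ᵀ * Q * (-1 : GL (Fin 6) ℤ).1 = Q
    simp
  refine mem_SOMplus0_iff.mpr ⟨⟨mem_OMplus_of_induces hO hI, fun i j _ _ => ?_⟩, ?_⟩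
  · exact ⟨-(1 : Matrix (Fin 6) (Fin 6) ℤ) i j, by simp; ring⟩
  · simp [Matrix.det_neg]

theorem transpGL_notMem : transpGL ∉ SOMplus := fun h => by
  have h1 : transpMat.det = 1 := (mem_SOMplus_iff.mp h).2
  rw [transpMat_det] at h1
  norm_num at h1

theorem invGL_notMem : invGL ∉ OMplus0 := fun h => by
  have h1 : (2 : ℤ) ∣ invMat 0 0 - (1 : Matrix (Fin 6) (Fin 6) ℤ) 0 0 :=
    h.2 0 0 (by decide) (by decide)
  revert h1
  decide

theorem actPHG02_injective : Function.Injective actPHG02 := by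
  refine (injective_iff_map_eq_one _).mpr fun x hx => ?_
  obtain ⟨g, rfl⟩ := QuotientGroup.mk_surjective x
  exact (QuotientGroup.eq_one_iff g).mpr (Subgroup.mem_subgroupOf.mpr (mem_mu6_of_actHG02 hx))

/-- Here the quotient is taken after the semidirect product, so `liftC2_injective` does not apply:
the action of HΓ₀(2) itself has the sixth roots of unity as kernel. As W is not induced by HΓ₀(2),
the kernel of the larger action is that same subgroup. -/
theorem actPHG02star_injective : Function.Injective actPHG02star := by
  refine (injective_iff_map_eq_one _).mpr fun x hx => ?_
  obtain ⟨y, rfl⟩ := QuotientGroup.mk_surjective x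
  obtain ⟨e1, e2⟩ := left_mem_ker_of_liftC2 (h := W_actHG02) (sameAutomorphisms_actHG02.notMem_range neg_one_mem
    (fun h => invGL_notMem h.1) induces_invGL) (x := y) hx
  refine (QuotientGroup.eq_one_iff y).mpr ⟨y.left, mem_mu6_of_actHG02 e2, ?_⟩
  ext1
  · rfl
  · exact e1.symm

theorem actPHG02T_injective : Function.Injective actPHG02T :=
  liftC2_injective actPHG02_injective (sameAutomorphisms_actPHG02.notMem_range neg_one_mem
    (fun h => transpGL_notMem h.2) induces_transpGL)

theorem actPHG02starT_injective : Function.Injective actPHG02starT :=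
  liftC2_injective actPHG02star_injective (sameAutomorphisms_actPHG02star.notMem_range
    neg_one_mem.2 transpGL_notMem induces_transpGL)

end HessianK3

end

theorem theorem3 :
    HessianK3.IsomorphicAsAutomorphisms HessianK3.Psi
      (HessianK3.actModPM HessianK3.SOMplus0 HessianK3.SOMplus0_le) HessianK3.actPHG02 ∧
    HessianK3.IsomorphicAsAutomorphisms HessianK3.Psi
      (HessianK3.actModPM HessianK3.OMplus0 HessianK3.OMplus0_le) HessianK3.actPHG02T ∧
    HessianK3.IsomorphicAsAutomorphisms HessianK3.Psi
      (HessianK3.actModPM HessianK3.SOMplus HessianK3.SOMplus_le) HessianK3.actPHG02star ∧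
    HessianK3.IsomorphicAsAutomorphisms HessianK3.Psi
      (HessianK3.actModPM HessianK3.OMplus le_rfl) HessianK3.actPHG02starT :=
  ⟨HessianK3.sameAutomorphisms_actPHG02.isomorphic _ HessianK3.actPHG02_injective,
    HessianK3.sameAutomorphisms_actPHG02T.isomorphic _ HessianK3.actPHG02T_injective,
    HessianK3.sameAutomorphisms_actPHG02star.isomorphic _ HessianK3.actPHG02star_injective,
    HessianK3.sameAutomorphisms_actPHG02starT.isomorphic _ HessianK3.actPHG02starT_injective⟩
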